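/- **Definitions.** Write $f\cdot g$ for "first $f$, then $g$". A *closed category* is a category $\mathcal C$ with a functor $\underline{\mathcal C}(-,-):\mathcal C^{op}\times\mathcal C\to\mathcal C$, an object $\mathbb 1$, a natural isomorphism $i_X:X\to\underline{\mathcal C}(\mathbb 1,X)$, a dinatural transformation $j_X:\mathbb 1\to\underline{\mathcal C}(X,X)$ and a transformation $L^X_{YZ}:\underline{\mathcal C}(Y,Z)\to\underline{\mathcal C}(\underline{\mathcal C}(X,Y),\underline{\mathcal C}(X,Z))$, natural in $Y,Z$ and dinatural in $X$, such that * (CC1) $j_Y\cdot L^X_{YY}=j_{\underline{\mathcal C}(X,Y)}$; * (CC2) $L^X_{XY}\cdot\underline{\mathcal C}(j_X,1)=i_{\underline{\mathcal C}(X,Y)}$; * (CC3) $L^Y_{UV}\cdot\underline{\mathcal C}(1,L^X_{YV})=L^X_{UV}\cdot L^{\underline{\mathcal C}(X,Y)}_{\underline{\mathcal C}(X,U),\underline{\mathcal C}(X,V)}\cdot\underline{\mathcal C}(L^X_{YU},1)$; * (CC4) $L^{\mathbb 1}_{YZ}\cdot\underline{\mathcal C}(i_Y,1)=\underline{\mathcal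 C}(1,i_Z)$; * (CC5) $\mathcal C(X,Y)\to\mathcal C(\mathbb 1,\underline{\mathcal C}(X,Y))$, $f\mapsto j_X\cdot\underline{\mathcal C}(1,f)$, is a bijection. A *closed functor* $\mathcal C\to\mathcal D$ is a functor $\phi$ with a natural transformation $\hat\phi:\phi\underline{\mathcal C}(X,Y)\to\underline{\mathcal D}(\phi X,\phi Y)$ and a morphism $\phi^0:\mathbb 1\to\phi\mathbb 1$ such that $\phi^0\cdot\phi j_X\cdot\hat\phi=j_{\phi X}$, $\ \phi i_X\cdot\hat\phi\cdot\underline{\mathcal D}(\phi^0,1)=i_{\phi X}$ and $\phi L^X_{YZ}\cdot\hat\phi\cdot\underline{\mathcal D}(1,\hat\phi)=\hat\phi\cdot L^{\phi X}_{\phi Y,\phi Z}\cdot\underline{\mathcal D}(\hat\phi,1)$. A *closed natural transformation* $\Phi\to\Psi$ is a natural transformation $\eta:\phi\to\psi$ with $\phi^0\cdot\eta_{\mathbb 1}=\psi^0$ and $\hat\phi\cdot\underline{\mathcal D}(1,\eta_Y)=\eta_{\underline{\mathcal C}(X,Y)}\cdot\hat\psi\cdot\underline{\mathcal D}(\eta_X,1)$.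 The composite of $\Phi=(\phi,\hat\phi,\phi^0):\mathcal C\to\mathcal D$ and $\Psi=(\psi,\hat\psi,\psi^0):\mathcal D\to\mathcal E$ is $(\psi\circ\phi,\ \psi\hat\phi\cdot\hat\psi,\ \psi^0\cdot\psi\phi^0)$. With the usual composition of transformations these form a 2-category $\mathbf{ClCat}$. A (non-symmetric) multicategory $\mathsf C$ is *closed* if for all $m\ge 0$ and objects $X_1,\dots,X_m,Z$ there are an object $\underline{\mathsf C}(X_1,\dots,X_m;Z)$ and a morphism $\mathrm{ev}:X_1,\dots,X_m,\underline{\mathsf C}(X_1,\dots,X_m;Z)\to Z$ such that for all $Y_1,\dots,Y_n$ ($n\ge0$) the map $f\mapsto(1_{X_1},\dots,1_{X_m},f)\cdot\mathrm{ev}$ is a bijection $\mathsf C(Y_1,\dots,Y_n;\underline{\mathsf C}(X_1,\dots,X_m;Z))\to\mathsf C(X_1,\dots,X_m,Y_1,\dots,Y_n;Z)$. A *unit object* of a closed $\mathsf C$ is an object $\mathbb 1$ with a morphism $u:()\to\mathbb 1$ such that $(u,1)\cdot\mathrm{ev}:\underline{\mathsf C}(\mathbb 1;X)\to X$ is an isomorphism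 for every $X$. $\mathbf{ClMulticat}^u$ is the 2-category of closed multicategories that have a unit object, all multifunctors, and all multinatural transformations (families $r_X:FX\to GX$ with $Ff\cdot r_Y=(r_{X_1},\dots,r_{X_n})\cdot Gf$ for all $f:X_1,\dots,X_n\to Y$). **The 2-functor $U$.** Fix for every object $\mathsf C$ of $\mathbf{ClMulticat}^u$ a choice of the $\underline{\mathsf C}(X;Z)$ with their evaluations and of a unit object $(\mathbb 1,u)$. Then $U:\mathbf{ClMulticat}^u\to\mathbf{ClCat}$ is the following strict 2-functor. $U\mathsf C$ is the category of objects and unary morphisms of $\mathsf C$, with internal Hom-objects $\underline{\mathsf C}(X;Y)$. Here $\underline{\mathsf C}(f;1)$ and $\underline{\mathsf C}(1;g)$ are determined by $(1,\underline{\mathsf C}(f;1))\cdot\mathrm{ev}=(f,1)\cdot\mathrm{ev}$ and $(1,\underline{\mathsf C}(1;g))\cdot\mathrm{ev}=\mathrm{ev}\cdot g$. Its unit is $\mathbb 1$; $i_X$ is the inverse of $(u,1)\cdot\mathrm{ev}:\underline{\mathsf C}(\mathbb 1;X)\to X$; $j_X$ is determined by $(1_X,u\cdot j_X)\cdot\mathrm{ev}=1_X$;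 and $L^X_{YZ}$ by $(1,L^X_{YZ})\cdot\mathrm{ev}=\mu$, where $\mu:\underline{\mathsf C}(X;Y),\underline{\mathsf C}(Y;Z)\to\underline{\mathsf C}(X;Z)$ is determined by $(1_X,\mu)\cdot\mathrm{ev}=(\mathrm{ev},1)\cdot\mathrm{ev}$. For a multifunctor $F$, $UF$ is its restriction to unary morphisms, with $\hat\phi$ determined by $(1_{FX},\hat\phi)\cdot\mathrm{ev}=F\,\mathrm{ev}$ and $\phi^0$ by $u\cdot\phi^0=Fu$. On 2-morphisms, $U$ keeps the components. **Theorem.** For every such choice, the strict 2-functor $U$ is a $\mathbf{Cat}$-equivalence: there is a strict 2-functor $\mathbf{ClCat}\to\mathbf{ClMulticat}^u$ that is inverse to $U$ up to $\mathbf{Cat}$-natural (i.e. strict 2-natural) isomorphisms. Moreover: 1. for all $\mathsf C,\mathsf D$ in $\mathbf{ClMulticat}^u$, $U$ is a bijection from multifunctors $\mathsf C\to\mathsf D$ to closed functors $U\mathsf C\to U\mathsf D$; 2. for all multifunctors $F,G:\mathsf C\to\mathsf D$, $U$ is a bijection from multinatural transformations $F\to G$ to closed natural transformations $UF\to UG$;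 3. for every closed category $\mathcal V$ there is $\mathsf C$ in $\mathbf{ClMulticat}^u$ such that $U\mathsf C$ is isomorphic to $\mathcal V$ in $\mathbf{ClCat}$ (by closed functors whose two composites are equal to the identity closed functors). -/

import Mathlib

set_option linter.checkUnivs false

open CategoryTheory

universe v u

namespace ClosedMulti

/-! ### Multicategories -/

/-- For a multigraph with sets of morphisms `H (X₁,…,Xₙ) Y`, an element of
`Fam H Ws [Y₁,…,Yₙ]` is a finite sequence of morphisms `(f₁,…,fₙ)`,
`fᵢ : Xᵢ₁,…,Xᵢₖᵢ → Yᵢ`, whose sources concatenate to the sequence `Ws`. -/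
inductive Fam {Ob : Type u} (H : List Ob → Ob → Type v) :
    List Ob → List Ob → Type (max u v)
  | nil : Fam H [] []
  | cons {Xs Ws Vs Ys : List Ob} {Y : Ob} (f : H Xs Y) (fs : Fam H Ws Ys)
      (h : Vs = Xs ++ Ws) : Fam H Vs (Y :: Ys)

namespace Fam

variable {Ob : Type u} {H : List Ob → Ob → Type v}

/-- Transport along equalities of sequences of objects. -/
def cast {Ws Ws' Ys Ys' : List Ob} (h : Ws' = Ws) (h' : Ys' = Ys) (fs : Fam H Ws Ys) :
    Fam H Ws' Ys' :=
  h.symm ▸ h'.symm ▸ fs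

/-- The one-term sequence `(f)`. -/
def single {Xs : List Ob} {Y : Ob} (f : H Xs Y) : Fam H Xs [Y] :=
  cons f nil (List.append_nil Xs).symm

/-- Concatenation of sequences of morphisms. -/
def append {Ws Ys Ws' Ys' : List Ob} : Fam H Ws Ys → Fam H Ws' Ys' →
    Fam H (Ws ++ Ws') (Ys ++ Ys')
  | nil, gs => gs
  | cons f fs h, gs => cons f (append fs gs) (by rw [h, List.append_assoc])

/-- The sequence `(1_{X₁},…,1_{Xₙ})`. -/
def ids (e : ∀ X, H [X] X) : ∀ Xs : List Ob, Fam H Xs Xs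
  | [] => nil
  | X :: Xs => cons (e X) (ids e Xs) rfl

/-- The image of a sequence of morphisms under a morphism of multigraphs. -/
def map {Ob' : Type u} {H' : List Ob' → Ob' → Type v} (o : Ob → Ob')
    (m : ∀ {Xs : List Ob} {Y : Ob}, H Xs Y → H' (Xs.map o) (o Y)) {Ws Ys : List Ob} :
    Fam H Ws Ys → Fam H' (Ws.map o) (Ys.map o)
  | nil => nil
  | cons f fs h => cons (m f) (map o m fs) (by rw [h, List.map_append])

/-- The sequence `(r_{X₁},…,r_{Xₙ})` for a family of unary morphisms `r_X : FX → GX`. -/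
def components {A : Type u} {F G : A → Ob} (r : ∀ X, H [F X] (G X)) :
    ∀ Xs : List A, Fam H (Xs.map F) (Xs.map G)
  | [] => nil
  | X :: Xs => cons (r X) (components r Xs) rfl

end Fam

/-- An element of `Fam₂ H Ws Xs [Y₁,…,Yₙ]` is a sequence of pairs `(fsᵢ, gᵢ)`, where `gᵢ` is a
morphism with target `Yᵢ` and `fsᵢ` is a sequence of morphisms whose targets form the source
of `gᵢ`; `Ws` is the sequence of all sources of the `fsᵢ`, and `Xs` of all sources of the `gᵢ`. -/
inductive Fam₂ {Ob : Type u} (H : List Ob → Ob → Type v) :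
    List Ob → List Ob → List Ob → Type (max u v)
  | nil : Fam₂ H [] [] []
  | cons {W X Ws Xs Vs Us Ys : List Ob} {Y : Ob} (fs : Fam H W X) (g : H X Y)
      (p : Fam₂ H Ws Xs Ys) (h : Vs = W ++ Ws) (h' : Us = X ++ Xs) : Fam₂ H Vs Us (Y :: Ys)

namespace Fam₂

variable {Ob : Type u} {H : List Ob → Ob → Type v}

/-- The concatenation of all the `fsᵢ`. -/
def first {Ws Xs Ys : List Ob} : Fam₂ H Ws Xs Ys → Fam H Ws Xs
  | nil => .nil
  | cons fs _ p h h' => (fs.append p.first).cast h h'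

/-- The sequence of the `gᵢ`. -/
def second {Ws Xs Ys : List Ob} : Fam₂ H Ws Xs Ys → Fam H Xs Ys
  | nil => .nil
  | cons _ g p _ h' => .cons g p.second h'

/-- The sequence of the composites `fsᵢ · gᵢ`. -/
def composites (c : ∀ {Ws Xs : List Ob} {Y : Ob}, Fam H Ws Xs → H Xs Y → H Ws Y)
    {Ws Xs Ys : List Ob} : Fam₂ H Ws Xs Ys → Fam H Ws Ys
  | nil => .nil
  | cons fs g p h _ => .cons (c fs g) (composites c p) h

end Fam₂

/-- A multicategory; `comp (f₁,…,fₙ) g` is the composite `(f₁,…,fₙ)·g`. -/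
structure Multicategory where
  /-- The objects. -/
  Ob : Type u
  /-- The morphisms `X₁,…,Xₙ → Y`. -/
  Hom : List Ob → Ob → Type v
  /-- The composition. -/
  comp : ∀ {Ws Xs : List Ob} {Y : Ob}, Fam Hom Ws Xs → Hom Xs Y → Hom Ws Y
  /-- The identities. -/
  id : ∀ X : Ob, Hom [X] X
  id_comp : ∀ {Xs : List Ob} {Y : Ob} (f : Hom Xs Y), comp (Fam.ids id Xs) f = f
  comp_id : ∀ {Xs : List Ob} {Y : Ob} (f : Hom Xs Y), comp (Fam.single f) (id Y) = f
  assoc : ∀ {Ws Xs Ys : List Ob} {Z : Ob} (p : Fam₂ Hom Ws Xs Ys) (h : Hom Ys Z),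
    comp (p.composites comp) h = comp p.first (comp p.second h)

/-! ### Calculus of sequences of morphisms -/

namespace Fam

variable {Ob : Type u} {H : List Ob → Ob → Type v}

theorem cast_cons {Xs Ws Ws' Vs Vs' Ys Ys' : List Ob} {Y : Ob} (f : H Xs Y) (fs : Fam H Ws Ys)
    (e : Vs = Xs ++ Ws) (h : Vs' = Vs) (h' : Y :: Ys' = Y :: Ys) (hW : Ws' = Ws)
    (hY : Ys' = Ys) :
    (cons f fs e).cast h h' = cons f (fs.cast hW hY) (by rw [h, e, hW]) := by
  subst hW hY h
  rfl

theorem append_nil {Ws Ys : List Ob} (fs : Fam H Ws Ys) (h : Ws = Ws ++ [])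
    (h' : Ys = Ys ++ []) : (fs.append (nil : Fam H [] [])).cast h h' = fs := by
  induction fs with
  | nil => rfl
  | cons f fs e ih =>
    simp only [append]
    rw [cast_cons _ _ _ _ _ (List.append_nil _).symm (List.append_nil _).symm, ih]

theorem ids_append (e : ∀ X, H [X] X) (Xs Ys : List Ob) :
    (ids e Xs).append (ids e Ys) = ids e (Xs ++ Ys) := by
  induction Xs with
  | nil => rfl
  | cons X Xs ih => simp only [ids, append, ih]; rfl

theorem map_ids {Ob' : Type u} {H' : List Ob' → Ob' → Type v} (o : Ob → Ob')
    (m : ∀ {Xs : List Ob} {Y : Ob}, H Xs Y → H' (Xs.map o) (o Y)) (e : ∀ X, H [X] X)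
    (e' : ∀ X, H' [X] X) (he : ∀ X, m (e X) = e' (o X)) (Xs : List Ob) :
    (ids e Xs).map o m = ids e' (Xs.map o) := by
  induction Xs with
  | nil => rfl
  | cons X Xs ih => simp only [ids, map, ih, he]; rfl

end Fam

namespace Multicategory

variable (C : Multicategory.{v, u})

/-- Transport of a morphism along an equality of its source. -/
def castDom {C : Multicategory.{v, u}} {Xs Xs' : List C.Ob} {Y : C.Ob} (h : Xs' = Xs)
    (f : C.Hom Xs Y) : C.Hom Xs' Y :=
  h.symm ▸ f

variable {C}

@[simp] theorem castDom_rfl {Xs : List C.Ob} {Y : C.Ob} (h : Xs = Xs) (f : C.Hom Xs Y) :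
    castDom h f = f := rfl

/-- Pairs with trivial first components. -/
def padLeft {Ws Ys : List C.Ob} : Fam C.Hom Ws Ys → Fam₂ C.Hom Ws Ws Ys
  | .nil => .nil
  | .cons (Xs := Xs) g gs h => .cons (Fam.ids C.id Xs) g (padLeft gs) h h

/-- Pairs with trivial second components. -/
def padRight {Ws Ys : List C.Ob} : Fam C.Hom Ws Ys → Fam₂ C.Hom Ws Ys Ys
  | .nil => .nil
  | .cons (Y := Y) g gs h => .cons (Fam.single g) (C.id Y) (padRight gs) h rfl

theorem padLeft_first {Ws Ys : List C.Ob} (gs : Fam C.Hom Ws Ys) :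
    (padLeft gs).first = Fam.ids C.id Ws := by
  induction gs with
  | nil => rfl
  | cons g gs h ih =>
    subst h
    simp only [padLeft, Fam₂.first, ih, Fam.ids_append]
    rfl

theorem padLeft_second {Ws Ys : List C.Ob} (gs : Fam C.Hom Ws Ys) :
    (padLeft gs).second = gs := by
  induction gs with
  | nil => rfl
  | cons g gs h ih => simp only [padLeft, Fam₂.second, ih]

theorem padLeft_composites {Ws Ys : List C.Ob} (gs : Fam C.Hom Ws Ys) :
    (padLeft gs).composites C.comp = gs := by
  induction gs with
  | nil => rfl
  | cons g gs h ih => simp only [padLeft, Fam₂.composites, ih, C.id_comp]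

theorem padRight_first {Ws Ys : List C.Ob} (gs : Fam C.Hom Ws Ys) :
    (padRight gs).first = gs := by
  induction gs with
  | nil => rfl
  | cons g gs h ih =>
    subst h
    simp only [padRight, Fam₂.first, ih]
    rfl

theorem padRight_second {Ws Ys : List C.Ob} (gs : Fam C.Hom Ws Ys) :
    (padRight gs).second = Fam.ids C.id Ys := by
  induction gs with
  | nil => rfl
  | cons g gs h ih => simp only [padRight, Fam₂.second, ih]; rfl

theorem padRight_composites {Ws Ys : List C.Ob} (gs : Fam C.Hom Ws Ys) :
    (padRight gs).composites C.comp = gs := by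
  induction gs with
  | nil => rfl
  | cons g gs h ih => simp only [padRight, Fam₂.composites, ih, C.comp_id]

/-- The composite `f · g` with a unary morphism `g`. -/
def comp₁ {Xs : List C.Ob} {Y Z : C.Ob} (f : C.Hom Xs Y) (g : C.Hom [Y] Z) : C.Hom Xs Z :=
  C.comp (Fam.single f) g

/-- The composite `(f,1,…,1) · g`. -/
def pre {Xs Ys : List C.Ob} {A Z : C.Ob} (f : C.Hom Xs A) (g : C.Hom (A :: Ys) Z) :
    C.Hom (Xs ++ Ys) Z :=
  C.comp (Fam.cons f (Fam.ids C.id Ys) rfl) g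

theorem comp_comp₁ {Ws Xs : List C.Ob} {Y Z : C.Ob} (fs : Fam C.Hom Ws Xs) (g : C.Hom Xs Y)
    (h : C.Hom [Y] Z) : comp₁ (C.comp fs g) h = C.comp fs (comp₁ g h) := by
  have := C.assoc (Fam₂.cons fs g Fam₂.nil (List.append_nil _).symm (List.append_nil _).symm) h
  simp only [Fam₂.first, Fam₂.second, Fam₂.composites, Fam.append_nil] at this
  exact this

theorem comp₁_assoc {Xs : List C.Ob} {W Y Z : C.Ob} (f : C.Hom Xs W) (g : C.Hom [W] Y)
    (h : C.Hom [Y] Z) : comp₁ (comp₁ f g) h = comp₁ f (comp₁ g h) :=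
  comp_comp₁ _ _ _

theorem id_comp₁ {X Y : C.Ob} (f : C.Hom [X] Y) : comp₁ (C.id X) f = f := C.id_comp f

theorem comp₁_id {Xs : List C.Ob} {Y : C.Ob} (f : C.Hom Xs Y) : comp₁ f (C.id Y) = f :=
  C.comp_id f

theorem pre_comp₁ {Xs Ys : List C.Ob} {A Y Z : C.Ob} (f : C.Hom Xs A) (g : C.Hom (A :: Ys) Y)
    (h : C.Hom [Y] Z) : comp₁ (pre f g) h = pre f (comp₁ g h) :=
  comp_comp₁ _ _ _

theorem pre_id {Ys : List C.Ob} {A Z : C.Ob} (g : C.Hom (A :: Ys) Z) : pre (C.id A) g = g :=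
  C.id_comp g

/-- Associativity when the first morphism is a composite. -/
theorem comp_cons_comp {W X Vs Us Ws Ys : List C.Ob} {Y Z : C.Ob} (fs : Fam C.Hom W X)
    (f : C.Hom X Y) (gs : Fam C.Hom Ws Ys) (h : C.Hom (Y :: Ys) Z) (e : Vs = W ++ Ws)
    (e' : Us = X ++ Ys) :
    C.comp (.cons (C.comp fs f) gs e) h =
      C.comp ((fs.append gs).cast e e') (C.comp (.cons f (Fam.ids C.id Ys) e') h) := by
  have := C.assoc (Fam₂.cons fs f (padRight gs) e e') h
  simpa only [Fam₂.first, Fam₂.second, Fam₂.composites, padRight_first, padRight_second,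
    padRight_composites] using this

/-- Associativity when the remaining morphisms act last. -/
theorem comp_cons_comp' {W X Vs Us Ws Ys : List C.Ob} {Y Z : C.Ob} (fs : Fam C.Hom W X)
    (f : C.Hom X Y) (gs : Fam C.Hom Ws Ys) (h : C.Hom (Y :: Ys) Z) (e : Vs = W ++ Ws)
    (e' : Us = X ++ Ws) :
    C.comp (.cons (C.comp fs f) gs e) h =
      C.comp ((fs.append (Fam.ids C.id Ws)).cast e e') (C.comp (.cons f gs e') h) := by
  have := C.assoc (Fam₂.cons fs f (padLeft gs) e e') h
  simpa only [Fam₂.first, Fam₂.second, Fam₂.composites, padLeft_first, padLeft_second,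
    padLeft_composites] using this

/-- Associativity when the second morphism is a composite. -/
theorem comp_cons_single_comp {X Us Vs W Y : List C.Ob} {A B Z : C.Ob} (f : C.Hom X A)
    (fs : Fam C.Hom W Y) (g : C.Hom Y B) (h : C.Hom [A, B] Z) (e : Vs = X ++ W)
    (e' : Us = A :: Y) :
    C.comp (.cons f (.single (C.comp fs g)) e) h =
      C.comp ((Fam.cons f fs e).cast rfl e') (C.comp (.cons (C.id A) (.single g) e') h) := by
  have := C.assoc (Fam₂.cons (Fam.single f) (C.id A) (Fam₂.cons fs g Fam₂.nil
    (List.append_nil _).symm (List.append_nil _).symm) e e') h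
  subst e'
  simp only [Fam₂.first, Fam₂.second, Fam₂.composites, Fam.append_nil] at this
  rw [C.comp_id] at this
  subst e
  exact this

theorem pre_nil_pre {As Ys : List C.Ob} {A B Z : C.Ob} (f : C.Hom [] A) (g : C.Hom (A :: As) B)
    (h : C.Hom (B :: Ys) Z) : pre f (pre g h) = pre (Xs := As) (pre f g) h := by
  symm
  refine (comp_cons_comp' _ _ _ _ _ (Us := A :: As ++ Ys) rfl).trans ?_
  simp only [Fam.append, Fam.ids_append]
  rfl

theorem pre_one_pre {As Ys : List C.Ob} {X A B Z : C.Ob} (f : C.Hom [X] A)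
    (g : C.Hom (A :: As) B) (h : C.Hom (B :: Ys) Z) :
    pre f (pre g h) = pre (Xs := X :: As) (pre f g) h := by
  symm
  refine (comp_cons_comp' _ _ _ _ _ (Us := A :: As ++ Ys) rfl).trans ?_
  simp only [Fam.append, Fam.ids_append]
  rfl

theorem pre_two_pre {As Ys : List C.Ob} {X X' A B Z : C.Ob} (f : C.Hom [X, X'] A)
    (g : C.Hom (A :: As) B) (h : C.Hom (B :: Ys) Z) :
    pre f (pre g h) = pre (Xs := X :: X' :: As) (pre f g) h := by
  symm
  refine (comp_cons_comp' _ _ _ _ _ (Us := A :: As ++ Ys) rfl).trans ?_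
  simp only [Fam.append, Fam.ids_append]
  rfl

theorem pre_one_id {X A : C.Ob} (f : C.Hom [X] A) : pre f (C.id A) = f := C.comp_id f

theorem pre_nil_id {A : C.Ob} (f : C.Hom [] A) : pre f (C.id A) = f := C.comp_id f

theorem pre_nil_eq_comp₁ {A Z : C.Ob} (f : C.Hom [] A) (g : C.Hom [A] Z) :
    pre f g = comp₁ f g := rfl

theorem pre_one_eq_comp₁ {X A Z : C.Ob} (f : C.Hom [X] A) (g : C.Hom [A] Z) :
    pre f g = comp₁ f g := rfl

end Multicategory

end ClosedMulti
namespace ClosedMulti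

/-! ### The 2-category of multicategories -/

open Multicategory

/-- A multifunctor. -/
structure Multifunctor (C D : Multicategory.{v, u}) where
  /-- The function on objects. -/
  obj : C.Ob → D.Ob
  /-- The functions on morphisms. -/
  map : ∀ {Xs : List C.Ob} {Y : C.Ob}, C.Hom Xs Y → D.Hom (Xs.map obj) (obj Y)
  map_comp : ∀ {Ws Xs : List C.Ob} {Y : C.Ob} (fs : Fam C.Hom Ws Xs) (g : C.Hom Xs Y),
    map (C.comp fs g) = D.comp (fs.map obj map) (map g)
  map_id : ∀ X : C.Ob, map (C.id X) = D.id (obj X)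

/-- A multinatural transformation. -/
@[ext]
structure MultinatTrans {C D : Multicategory.{v, u}} (F G : Multifunctor C D) where
  /-- The components. -/
  app : ∀ X : C.Ob, D.Hom [F.obj X] (G.obj X)
  naturality : ∀ {Xs : List C.Ob} {Y : C.Ob} (f : C.Hom Xs Y),
    D.comp (Fam.single (F.map f)) (app Y) = D.comp (Fam.components app Xs) (G.map f)

namespace Multifunctor

variable {C D E : Multicategory.{v, u}}

theorem ext' {F G : Multifunctor C D} (h : F.obj = G.obj)
    (h' : ∀ {Xs : List C.Ob} {Y : C.Ob} (f : C.Hom Xs Y), HEq (F.map f) (G.map f)) : F = G := by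
  obtain ⟨o, m, _, _⟩ := F
  obtain ⟨o', m', _, _⟩ := G
  obtain rfl : o = o' := h
  have : @m = @m' := by
    funext Xs Y f
    exact eq_of_heq (h' f)
  subst this
  rfl

theorem castDom_heq {Xs Xs' : List C.Ob} {Y : C.Ob} (h : Xs' = Xs) (f : C.Hom Xs Y) :
    HEq (castDom h f) f := by
  subst h
  rfl

theorem map_castDom (F : Multifunctor C D) {Xs Xs' : List C.Ob} {Y : C.Ob} (h : Xs' = Xs)
    (f : C.Hom Xs Y) :
    F.map (castDom h f) = castDom (congrArg (List.map F.obj) h) (F.map f) := by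
  subst h
  rfl

theorem comp_castDom {Ws Ws' Xs Xs' : List C.Ob} {Y : C.Ob} (h : Ws' = Ws) (h' : Xs' = Xs)
    (fs : Fam C.Hom Ws Xs) (g : C.Hom Xs Y) :
    C.comp (fs.cast h h') (castDom h' g) = castDom h (C.comp fs g) := by
  subst h h'
  rfl

theorem comp_cast_left {Ws Ws' Xs : List C.Ob} {Y : C.Ob} (h : Ws' = Ws)
    (fs : Fam C.Hom Ws Xs) (g : C.Hom Xs Y) :
    C.comp (fs.cast h rfl) g = castDom h (C.comp fs g) := by
  subst h
  rfl

theorem cons_castDom {Xs Xs' Ws Ws' Vs Vs' Ys Ys' : List C.Ob} {Y : C.Ob} (f : C.Hom Xs Y)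
    (fs : Fam C.Hom Ws Ys) (hX : Xs' = Xs) (hW : Ws' = Ws) (hY : Ys' = Ys) (hV : Vs' = Vs)
    (e : Vs = Xs ++ Ws) (e' : Vs' = Xs' ++ Ws') :
    Fam.cons (castDom hX f) (fs.cast hW hY) e' =
      (Fam.cons f fs e).cast hV (congrArg (Y :: ·) hY) := by
  subst hX hW hY hV
  rfl

/-- The identity multifunctor. -/
def id (C : Multicategory.{v, u}) : Multifunctor C C where
  obj X := X
  map {Xs _} f := castDom (List.map_id' Xs) f
  map_comp {Ws Xs Y} fs g := by
    have : ∀ {Ws Xs : List C.Ob} (fs : Fam C.Hom Ws Xs),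
        fs.map (H' := C.Hom) (fun X => X) (fun {Xs _} f => castDom (List.map_id' Xs) f) =
          fs.cast (List.map_id' Ws) (List.map_id' Xs) := by
      intro Ws Xs fs
      induction fs with
      | nil => rfl
      | cons f fs h ih =>
        simp only [Fam.map, ih]
        exact cons_castDom _ _ _ _ _ _ _ _
    rw [this, comp_castDom]
  map_id X := rfl

/-- The composite `G ∘ F`. -/
def comp (F : Multifunctor C D) (G : Multifunctor D E) : Multifunctor C E where
  obj X := G.obj (F.obj X)
  map {Xs _} f := castDom (List.map_map (f := F.obj) (g := G.obj) (l := Xs)).symm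
    (G.map (F.map f))
  map_comp {Ws Xs Y} fs g := by
    have : ∀ {Ws Xs : List C.Ob} (fs : Fam C.Hom Ws Xs),
        fs.map (H' := E.Hom) (fun X => G.obj (F.obj X)) (fun {Xs _} f =>
          castDom (List.map_map (f := F.obj) (g := G.obj) (l := Xs)).symm (G.map (F.map f))) =
          ((fs.map F.obj F.map).map G.obj G.map).cast List.map_map.symm List.map_map.symm := by
      intro Ws Xs fs
      induction fs with
      | nil => rfl
      | cons f fs h ih =>
        simp only [Fam.map, ih]
        exact cons_castDom _ _ _ _ _ _ _ _
    rw [this, comp_castDom, F.map_comp, G.map_comp]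
  map_id X := by
    simp only [F.map_id, G.map_id]
    rfl

theorem id_comp (F : Multifunctor C D) : (id C).comp F = F :=
  ext' rfl fun {Xs Y} f => by
    refine (castDom_heq (by exact List.map_map.symm) _).trans ?_
    have : ∀ {Xs' : List C.Ob} (h : Xs' = Xs), HEq (F.map (castDom h f)) (F.map f) := by
      intro Xs' h
      subst h
      rfl
    exact this (List.map_id' _)

theorem comp_id (F : Multifunctor C D) : F.comp (id D) = F :=
  ext' rfl fun {Xs Y} f =>
    (castDom_heq (by exact List.map_map.symm) _).trans
      (castDom_heq (by exact List.map_id' _) _)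

theorem assoc {E' : Multicategory.{v, u}} (F : Multifunctor C D) (G : Multifunctor D E)
    (K : Multifunctor E E') : (F.comp G).comp K = F.comp (G.comp K) :=
  ext' rfl fun {Xs Y} f => by
    refine (castDom_heq (by exact List.map_map.symm) _).trans ?_
    refine HEq.trans ?_ (castDom_heq (by exact List.map_map.symm) _).symm
    refine HEq.trans ?_ (castDom_heq (by exact List.map_map.symm) _).symm
    have : ∀ {Xs' Xs : List E.Ob} {Y : E.Ob} (h : Xs' = Xs) (f : E.Hom Xs Y),
        HEq (K.map (castDom h f)) (K.map f) := by
      intro Xs' Xs Y h f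
      subst h
      rfl
    exact this List.map_map.symm _

end Multifunctor

namespace MultinatTrans

variable {C D E : Multicategory.{v, u}}

theorem naturality₁ {F G : Multifunctor C D} (r : MultinatTrans F G) {Xs : List C.Ob}
    {Y : C.Ob} (f : C.Hom Xs Y) :
    comp₁ (F.map f) (r.app Y) = D.comp (Fam.components r.app Xs) (G.map f) :=
  r.naturality f

theorem components_id (F : C.Ob → D.Ob) (Xs : List C.Ob) :
    Fam.components (H := D.Hom) (fun X => D.id (F X)) Xs = Fam.ids D.id (Xs.map F) := by
  induction Xs with
  | nil => rfl
  | cons X Xs ih => simp only [Fam.components, ih]; rfl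

/-- Pairs of components, used for vertical composition. -/
def pairs {F G K : C.Ob → D.Ob} (r : ∀ X, D.Hom [F X] (G X)) (s : ∀ X, D.Hom [G X] (K X)) :
    ∀ Xs : List C.Ob, Fam₂ D.Hom (Xs.map F) (Xs.map G) (Xs.map K)
  | [] => .nil
  | X :: Xs => .cons (Fam.single (r X)) (s X) (pairs r s Xs) rfl rfl

theorem pairs_first {F G K : C.Ob → D.Ob} (r : ∀ X, D.Hom [F X] (G X))
    (s : ∀ X, D.Hom [G X] (K X)) (Xs : List C.Ob) :
    (pairs r s Xs).first = Fam.components r Xs := by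
  induction Xs with
  | nil => rfl
  | cons X Xs ih => simp only [pairs, Fam₂.first, ih]; rfl

theorem pairs_second {F G K : C.Ob → D.Ob} (r : ∀ X, D.Hom [F X] (G X))
    (s : ∀ X, D.Hom [G X] (K X)) (Xs : List C.Ob) :
    (pairs r s Xs).second = Fam.components s Xs := by
  induction Xs with
  | nil => rfl
  | cons X Xs ih => simp only [pairs, Fam₂.second, ih]; rfl

theorem pairs_composites {F G K : C.Ob → D.Ob} (r : ∀ X, D.Hom [F X] (G X))
    (s : ∀ X, D.Hom [G X] (K X)) (Xs : List C.Ob) :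
    (pairs r s Xs).composites D.comp = Fam.components (fun X => comp₁ (r X) (s X)) Xs := by
  induction Xs with
  | nil => rfl
  | cons X Xs ih => simp only [pairs, Fam₂.composites, ih]; rfl

theorem comp_components {F G K : C.Ob → D.Ob} (r : ∀ X, D.Hom [F X] (G X))
    (s : ∀ X, D.Hom [G X] (K X)) (Xs : List C.Ob) {Z : D.Ob} (h : D.Hom (Xs.map K) Z) :
    D.comp (Fam.components (fun X => comp₁ (r X) (s X)) Xs) h =
      D.comp (Fam.components r Xs) (D.comp (Fam.components s Xs) h) := by
  rw [← pairs_composites, D.assoc, pairs_first, pairs_second]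

/-- The identity transformation. -/
def id (F : Multifunctor C D) : MultinatTrans F F where
  app X := D.id (F.obj X)
  naturality f := by rw [D.comp_id, components_id, D.id_comp]

/-- The vertical composite. -/
def vcomp {F G K : Multifunctor C D} (r : MultinatTrans F G) (s : MultinatTrans G K) :
    MultinatTrans F K where
  app X := comp₁ (r.app X) (s.app X)
  naturality f := by
    have h : comp₁ (F.map f) (comp₁ (r.app _) (s.app _)) = _ := (comp₁_assoc _ _ _).symm
    refine h.trans ?_
    rw [naturality₁, comp_comp₁, naturality₁, comp_components]

theorem comp₁_castDom {Xs Xs' : List C.Ob} {Y Z : C.Ob} (h : Xs' = Xs) (f : C.Hom Xs Y)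
    (g : C.Hom [Y] Z) : comp₁ (castDom h f) g = castDom h (comp₁ f g) := by
  subst h
  rfl

/-- Whiskering of a multinatural transformation with a multifunctor acting first. -/
def whiskerLeft (F : Multifunctor C D) {G K : Multifunctor D E} (r : MultinatTrans G K) :
    MultinatTrans (F.comp G) (F.comp K) where
  app X := r.app (F.obj X)
  naturality {Xs Y} f := by
    have h : ∀ Xs : List C.Ob, Fam.components (H := E.Hom) (fun X => r.app (F.obj X)) Xs =
        (Fam.components r.app (Xs.map F.obj)).cast List.map_map.symm List.map_map.symm := by
      intro Xs
      induction Xs with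
      | nil => rfl
      | cons X Xs ih =>
        simp only [Fam.components, ih]
        exact Multifunctor.cons_castDom (C := E) (r.app (F.obj X))
          (Fam.components r.app (Xs.map F.obj)) rfl List.map_map.symm List.map_map.symm
          List.map_map.symm rfl rfl
    refine (comp₁_castDom (C := E) List.map_map.symm _ _).trans ?_
    refine (congrArg (castDom (C := E) List.map_map.symm) (r.naturality₁ (F.map f))).trans ?_
    refine ((congrArg (fun q => E.comp q _) (h Xs)).trans ?_).symm
    exact Multifunctor.comp_castDom (C := E) List.map_map.symm List.map_map.symm _ _

/-- Whiskering of a multinatural transformation with a multifunctor acting last. -/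
def whiskerRight {F G : Multifunctor C D} (r : MultinatTrans F G) (K : Multifunctor D E) :
    MultinatTrans (F.comp K) (G.comp K) where
  app X := K.map (r.app X)
  naturality {Xs Y} f := by
    have h : ∀ Xs : List C.Ob, Fam.components (H := E.Hom) (fun X => K.map (r.app X)) Xs =
        ((Fam.components r.app Xs).map K.obj K.map).cast
          List.map_map.symm List.map_map.symm := by
      intro Xs
      induction Xs with
      | nil => rfl
      | cons X Xs ih =>
        simp only [Fam.components, ih, Fam.map]
        exact Multifunctor.cons_castDom (C := E) (K.map (r.app X))
          ((Fam.components r.app Xs).map K.obj K.map) rfl List.map_map.symm List.map_map.symm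
          List.map_map.symm rfl rfl
    refine (comp₁_castDom (C := E) List.map_map.symm _ _).trans ?_
    have h2 : comp₁ (K.map (F.map f)) (K.map (r.app Y)) =
        K.map (comp₁ (F.map f) (r.app Y)) :=
      (K.map_comp (Fam.single (F.map f)) (r.app Y)).symm
    refine (congrArg (castDom (C := E) List.map_map.symm) h2).trans ?_
    rw [naturality₁, K.map_comp]
    refine ((congrArg (fun q => E.comp q _) (h Xs)).trans ?_).symm
    exact Multifunctor.comp_castDom (C := E) List.map_map.symm List.map_map.symm _ _

end MultinatTrans

instance : CategoryStruct Multicategory.{v, u} where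
  Hom C D := Multifunctor C D
  id C := Multifunctor.id C
  comp F G := F.comp G

instance Multicategory.homCategory (C D : Multicategory.{v, u}) : Category (C ⟶ D) where
  Hom F G := MultinatTrans F G
  id F := MultinatTrans.id F
  comp r s := r.vcomp s
  id_comp _ := MultinatTrans.ext (funext fun _ => id_comp₁ _)
  comp_id _ := MultinatTrans.ext (funext fun _ => comp₁_id _)
  assoc _ _ _ := MultinatTrans.ext (funext fun _ => comp₁_assoc _ _ _)

namespace Multicategory

variable {C D E : Multicategory.{v, u}}

theorem hom_ext {F G : C ⟶ D} {r s : F ⟶ G} (h : ∀ X, r.app X = s.app X) : r = s :=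
  MultinatTrans.ext (funext h)

theorem comp_app {F G K : C ⟶ D} (r : F ⟶ G) (s : G ⟶ K) (X : C.Ob) :
    (r ≫ s).app X = comp₁ (r.app X) (s.app X) := rfl

theorem eqToHom_app {F G : C ⟶ D} (h : F = G) (X : C.Ob) :
    HEq ((eqToHom h).app X) (D.id (F.obj X)) := by
  subst h
  rfl

theorem id_comp_app (F : C ⟶ D) (X : C.Ob) :
    (eqToHom (Multifunctor.id_comp F) : 𝟙 C ≫ F ⟶ F).app X = D.id (F.obj X) :=
  eq_of_heq (eqToHom_app _ _)

theorem id_comp_app' (F : C ⟶ D) (X : C.Ob) :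
    (eqToHom (Multifunctor.id_comp F).symm : F ⟶ 𝟙 C ≫ F).app X = D.id (F.obj X) :=
  eq_of_heq (eqToHom_app _ _)

theorem comp_id_app (F : C ⟶ D) (X : C.Ob) :
    (eqToHom (Multifunctor.comp_id F) : F ≫ 𝟙 D ⟶ F).app X = D.id (F.obj X) :=
  eq_of_heq (eqToHom_app _ _)

theorem comp_id_app' (F : C ⟶ D) (X : C.Ob) :
    (eqToHom (Multifunctor.comp_id F).symm : F ⟶ F ≫ 𝟙 D).app X = D.id (F.obj X) :=
  eq_of_heq (eqToHom_app _ _)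

theorem assoc_app {E' : Multicategory.{v, u}} (F : C ⟶ D) (G : D ⟶ E) (K : E ⟶ E') (X : C.Ob) :
    (eqToHom (Multifunctor.assoc F G K) : (F ≫ G) ≫ K ⟶ F ≫ G ≫ K).app X =
      E'.id (K.obj (G.obj (F.obj X))) :=
  eq_of_heq (eqToHom_app _ _)

theorem assoc_app' {E' : Multicategory.{v, u}} (F : C ⟶ D) (G : D ⟶ E) (K : E ⟶ E')
    (X : C.Ob) :
    (eqToHom (Multifunctor.assoc F G K).symm : F ≫ G ≫ K ⟶ (F ≫ G) ≫ K).app X =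
      E'.id (K.obj (G.obj (F.obj X))) :=
  eq_of_heq (eqToHom_app _ _)

theorem map_comp₁ (F : Multifunctor C D) {Xs : List C.Ob} {Y Z : C.Ob} (f : C.Hom Xs Y)
    (g : C.Hom [Y] Z) : F.map (comp₁ f g) = comp₁ (F.map f) (F.map g) :=
  F.map_comp (Fam.single f) g

/-- Left whiskering in the 2-category of multicategories. -/
def wl (F : C ⟶ D) {G K : D ⟶ E} (r : G ⟶ K) : F ≫ G ⟶ F ≫ K :=
  MultinatTrans.whiskerLeft F r

/-- Right whiskering in the 2-category of multicategories. -/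
def wr {F G : C ⟶ D} (r : F ⟶ G) (K : D ⟶ E) : F ≫ K ⟶ G ≫ K :=
  MultinatTrans.whiskerRight r K

theorem wl_app (F : C ⟶ D) {G K : D ⟶ E} (r : G ⟶ K) (X : C.Ob) :
    (wl F r).app X = r.app (F.obj X) := rfl

theorem wr_app {F G : C ⟶ D} (r : F ⟶ G) (K : D ⟶ E) (X : C.Ob) :
    (wr r K).app X = K.map (r.app X) := rfl

end Multicategory

namespace Multicategory

variable {C : Multicategory.{v, u}}

theorem conj_id {A B : C.Ob} {x : C.Hom [A] A} {y : C.Hom [B] B} (f : C.Hom [A] B)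
    (hx : x = C.id A) (hy : y = C.id B) : f = comp₁ x (comp₁ f y) := by
  rw [hx, hy, comp₁_id, id_comp₁]

end Multicategory

open Multicategory in
/-- The 2-category of multicategories, multifunctors and multinatural transformations. -/
instance : Bicategory Multicategory.{v, u} where
  homCategory C D := Multicategory.homCategory C D
  whiskerLeft F _ _ r := wl F r
  whiskerRight r K := wr r K
  associator F G K := eqToIso (Multifunctor.assoc F G K)
  leftUnitor F := eqToIso (Multifunctor.id_comp F)
  rightUnitor F := eqToIso (Multifunctor.comp_id F)
  whiskerLeft_id F G := hom_ext fun X => rfl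
  whiskerLeft_comp F _ _ _ r s := hom_ext fun X => rfl
  id_whiskerLeft r := hom_ext fun X =>
    conj_id (MultinatTrans.app r X) (id_comp_app _ X) (id_comp_app' _ X)
  comp_whiskerLeft F G _ _ r := hom_ext fun X =>
    conj_id (MultinatTrans.app r (G.obj (F.obj X))) (assoc_app _ _ _ X) (assoc_app' _ _ _ X)
  id_whiskerRight F G := hom_ext fun X => G.map_id (F.obj X)
  comp_whiskerRight r s K := hom_ext fun X => map_comp₁ K (MultinatTrans.app r X) (MultinatTrans.app s X)
  whiskerRight_id r := hom_ext fun X =>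
    conj_id (MultinatTrans.app r X) (comp_id_app _ X) (comp_id_app' _ X)
  whiskerRight_comp r G K := hom_ext fun X =>
    conj_id (K.map (G.map (MultinatTrans.app r X))) (assoc_app' _ _ _ X) (assoc_app _ _ _ X)
  whisker_assoc F _ _ r K := hom_ext fun X =>
    conj_id (K.map (MultinatTrans.app r (F.obj X))) (assoc_app _ _ _ X) (assoc_app' _ _ _ X)
  whisker_exchange r s := hom_ext fun X => (MultinatTrans.naturality s (MultinatTrans.app r X)).symm
  pentagon F G K M := hom_ext fun X => by
    refine (congrArg₂ comp₁ (congrArg M.map (assoc_app F G K X))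
      (congrArg₂ comp₁ (assoc_app F (G ≫ K) M X) (assoc_app G K M (F.obj X)))).trans ?_
    refine Eq.trans ?_
      (congrArg₂ comp₁ (assoc_app (F ≫ G) K M X) (assoc_app F G (K ≫ M) X)).symm
    refine (congrArg₂ comp₁ (M.map_id (K.obj (G.obj (F.obj X)))) rfl).trans ?_
    exact id_comp₁ _
  triangle {_ E _} F G := hom_ext fun X => by
    refine (congrArg₂ comp₁ (assoc_app F (𝟙 E) G X) (id_comp_app G (F.obj X))).trans ?_
    refine Eq.trans ?_ (congrArg G.map (comp_id_app F X)).symm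
    exact (id_comp₁ _).trans (G.map_id (F.obj X)).symm

instance : Bicategory.Strict Multicategory.{v, u} where
  id_comp F := Multifunctor.id_comp F
  comp_id F := Multifunctor.comp_id F
  assoc F G K := Multifunctor.assoc F G K
  leftUnitor_eqToIso _ := rfl
  rightUnitor_eqToIso _ := rfl
  associator_eqToIso _ _ _ := rfl

end ClosedMulti
namespace ClosedMulti

/-! ### The 2-category of closed categories -/

section

variable {C : Type u} [Category.{v} C] (H : Cᵒᵖ ⥤ C ⥤ C)

/-- The value of a bifunctor on a pair of objects. -/
abbrev hobj (X Y : C) : C := (H.obj (Opposite.op X)).obj Y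

/-- The morphism `H(f,1)`. -/
def hl {X' X : C} (f : X' ⟶ X) (Y : C) : hobj H X Y ⟶ hobj H X' Y := (H.map f.op).app Y

/-- The morphism `H(1,g)`. -/
def hr (X : C) {Y Y' : C} (g : Y ⟶ Y') : hobj H X Y ⟶ hobj H X Y' :=
  (H.obj (Opposite.op X)).map g

theorem hl_id (X Y : C) : hl H (𝟙 X) Y = 𝟙 (hobj H X Y) := by simp [hl]

theorem hr_id (X Y : C) : hr H X (𝟙 Y) = 𝟙 (hobj H X Y) := by simp [hr]

theorem hl_comp {X'' X' X : C} (f : X'' ⟶ X') (g : X' ⟶ X) (Y : C) :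
    hl H (f ≫ g) Y = hl H g Y ≫ hl H f Y := by simp [hl]

theorem hr_comp (X : C) {Y Y' Y'' : C} (f : Y ⟶ Y') (g : Y' ⟶ Y'') :
    hr H X (f ≫ g) = hr H X f ≫ hr H X g := by simp [hr]

theorem hr_hl {X' X Y Y' : C} (f : X' ⟶ X) (g : Y ⟶ Y') :
    hr H X g ≫ hl H f Y' = hl H f Y ≫ hr H X' g := by simp [hl, hr]

end

/-- A closed category. -/
structure ClosedCategory where
  /-- The objects of the underlying category. -/
  carrier : Type u
  [category : Category.{v} carrier]
  /-- The internal Hom-functor. -/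
  hom : carrierᵒᵖ ⥤ carrier ⥤ carrier
  /-- The unit object. -/
  unit : carrier
  /-- The isomorphisms `i_X : X → C(1,X)`. -/
  i : ∀ X : carrier, X ≅ hobj hom unit X
  i_natural : ∀ {X Y : carrier} (f : X ⟶ Y), f ≫ (i Y).hom = (i X).hom ≫ hr hom unit f
  /-- The morphisms `j_X : 1 → C(X,X)`. -/
  j : ∀ X : carrier, unit ⟶ hobj hom X X
  j_dinatural : ∀ {X Y : carrier} (f : X ⟶ Y), j X ≫ hr hom X f = j Y ≫ hl hom f Y
  /-- The morphisms `L^X_{YZ} : C(Y,Z) → C(C(X,Y),C(X,Z))`. -/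
  L : ∀ X Y Z : carrier, hobj hom Y Z ⟶ hobj hom (hobj hom X Y) (hobj hom X Z)
  L_natural_left : ∀ (X : carrier) {Y' Y : carrier} (f : Y' ⟶ Y) (Z : carrier),
    hl hom f Z ≫ L X Y' Z = L X Y Z ≫ hl hom (hr hom X f) (hobj hom X Z)
  L_natural_right : ∀ (X Y : carrier) {Z Z' : carrier} (g : Z ⟶ Z'),
    hr hom Y g ≫ L X Y Z' = L X Y Z ≫ hr hom (hobj hom X Y) (hr hom X g)
  L_dinatural : ∀ {X' X : carrier} (f : X' ⟶ X) (Y Z : carrier),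
    L X Y Z ≫ hr hom (hobj hom X Y) (hl hom f Z) =
      L X' Y Z ≫ hl hom (hl hom f Y) (hobj hom X' Z)
  cc1 : ∀ X Y : carrier, j Y ≫ L X Y Y = j (hobj hom X Y)
  cc2 : ∀ X Y : carrier, L X X Y ≫ hl hom (j X) (hobj hom X Y) = (i (hobj hom X Y)).hom
  cc3 : ∀ X Y U V : carrier,
    L Y U V ≫ hr hom (hobj hom Y U) (L X Y V) =
      L X U V ≫ L (hobj hom X Y) (hobj hom X U) (hobj hom X V) ≫
        hl hom (L X Y U) (hobj hom (hobj hom X Y) (hobj hom X V))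
  cc4 : ∀ Y Z : carrier,
    L unit Y Z ≫ hl hom (i Y).hom (hobj hom unit Z) = hr hom Y (i Z).hom
  cc5 : ∀ X Y : carrier,
    Function.Bijective (fun f : X ⟶ Y => (j X ≫ hr hom X f : unit ⟶ hobj hom X Y))

attribute [instance] ClosedCategory.category

namespace ClosedCategory

/-- A closed functor. -/
structure ClosedFunctor (C D : ClosedCategory.{v, u}) where
  /-- The underlying functor. -/
  functor : C.carrier ⥤ D.carrier
  /-- The natural transformation from the image of the internal Hom-object. -/
  hat : ∀ X Y : C.carrier,
    functor.obj (hobj C.hom X Y) ⟶ hobj D.hom (functor.obj X) (functor.obj Y)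
  hat_natural_left : ∀ {X' X : C.carrier} (f : X' ⟶ X) (Y : C.carrier),
    functor.map (hl C.hom f Y) ≫ hat X' Y = hat X Y ≫ hl D.hom (functor.map f) (functor.obj Y)
  hat_natural_right : ∀ (X : C.carrier) {Y Y' : C.carrier} (g : Y ⟶ Y'),
    functor.map (hr C.hom X g) ≫ hat X Y' = hat X Y ≫ hr D.hom (functor.obj X) (functor.map g)
  /-- The comparison of the unit objects. -/
  zero : D.unit ⟶ functor.obj C.unit
  cf1 : ∀ X : C.carrier, zero ≫ functor.map (C.j X) ≫ hat X X = D.j (functor.obj X)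
  cf2 : ∀ X : C.carrier,
    functor.map (C.i X).hom ≫ hat C.unit X ≫ hl D.hom zero (functor.obj X) =
      (D.i (functor.obj X)).hom
  cf3 : ∀ X Y Z : C.carrier,
    functor.map (C.L X Y Z) ≫ hat (hobj C.hom X Y) (hobj C.hom X Z) ≫
        hr D.hom (functor.obj (hobj C.hom X Y)) (hat X Z) =
      hat Y Z ≫ D.L (functor.obj X) (functor.obj Y) (functor.obj Z) ≫
        hl D.hom (hat X Y) (hobj D.hom (functor.obj X) (functor.obj Z))

/-- A closed natural transformation. -/
structure ClosedNatTrans {C D : ClosedCategory.{v, u}} (F G : ClosedFunctor C D) where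
  /-- The underlying natural transformation. -/
  trans : F.functor ⟶ G.functor
  cn1 : F.zero ≫ trans.app C.unit = G.zero
  cn2 : ∀ X Y : C.carrier,
    F.hat X Y ≫ hr D.hom (F.functor.obj X) (trans.app Y) =
      trans.app (hobj C.hom X Y) ≫ G.hat X Y ≫ hl D.hom (trans.app X) (G.functor.obj Y)

namespace ClosedFunctor

variable {C D E : ClosedCategory.{v, u}}

theorem ext' {F G : ClosedFunctor C D} (h : F.functor = G.functor)
    (h' : ∀ X Y, HEq (F.hat X Y) (G.hat X Y)) (h₀ : HEq F.zero G.zero) : F = G := by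
  obtain ⟨f, a, _, _, z, _, _, _⟩ := F
  obtain ⟨g, b, _, _, w, _, _, _⟩ := G
  obtain rfl : f = g := h
  have : a = b := by
    funext X Y
    exact eq_of_heq (h' X Y)
  subst this
  obtain rfl : z = w := eq_of_heq h₀
  rfl

/-- The identity closed functor. -/
def id (C : ClosedCategory.{v, u}) : ClosedFunctor C C where
  functor := 𝟭 C.carrier
  hat X Y := 𝟙 (hobj C.hom X Y)
  hat_natural_left f Y := by simp
  hat_natural_right X _ _ g := by simp
  zero := 𝟙 C.unit
  cf1 X := by simp
  cf2 X := by simp [hl_id]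
  cf3 X Y Z := by simp [hl_id, hr_id]

/-- The composite of closed functors. -/
def comp (F : ClosedFunctor C D) (G : ClosedFunctor D E) : ClosedFunctor C E where
  functor := F.functor ⋙ G.functor
  hat X Y := G.functor.map (F.hat X Y) ≫ G.hat (F.functor.obj X) (F.functor.obj Y)
  hat_natural_left f Y := by
    have := G.hat_natural_left (F.functor.map f) (F.functor.obj Y)
    simp only [Functor.comp_map, Functor.comp_obj, Category.assoc, ← this]
    simp only [← Category.assoc, ← Functor.map_comp, F.hat_natural_left]
  hat_natural_right X _ _ g := by
    have := G.hat_natural_right (F.functor.obj X) (F.functor.map g)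
    simp only [Functor.comp_map, Functor.comp_obj, Category.assoc, ← this]
    simp only [← Category.assoc, ← Functor.map_comp, F.hat_natural_right]
  zero := G.zero ≫ G.functor.map F.zero
  cf1 X := by
    have h := G.cf1 (F.functor.obj X)
    simp only [← F.cf1, Functor.map_comp, Category.assoc] at h
    simpa using h
  cf2 X := by
    have h := G.cf2 (F.functor.obj X)
    simp only [← F.cf2, Functor.map_comp, Category.assoc] at h
    refine Eq.trans ?_ h
    have h2 := G.hat_natural_left F.zero (F.functor.obj X)
    simp only [Functor.comp_map, Functor.comp_obj, Category.assoc, hl_comp]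
    rw [reassoc_of% h2]
  cf3 X Y Z := by
    have h := congrArg G.functor.map (F.cf3 X Y Z)
    have h' := G.cf3 (F.functor.obj X) (F.functor.obj Y) (F.functor.obj Z)
    have h1 := G.hat_natural_left (F.hat X Y)
      (hobj D.hom (F.functor.obj X) (F.functor.obj Z))
    have h2 := G.hat_natural_right (F.functor.obj (hobj C.hom X Y)) (F.hat X Z)
    simp only [Functor.map_comp] at h
    simp only [Functor.comp_map, Functor.comp_obj, Category.assoc, hl_comp, hr_comp]
    rw [← reassoc_of% h2, reassoc_of% h, reassoc_of% h1, ← reassoc_of% h', hr_hl]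

theorem id_comp (F : ClosedFunctor C D) : (id C).comp F = F :=
  ext' rfl (fun X Y => heq_of_eq (by simp [comp, id])) (heq_of_eq (by simp [comp, id]))

theorem comp_id (F : ClosedFunctor C D) : F.comp (id D) = F :=
  ext' rfl (fun X Y => heq_of_eq (by simp [comp, id])) (heq_of_eq (by simp [comp, id]))

theorem assoc {E' : ClosedCategory.{v, u}} (F : ClosedFunctor C D) (G : ClosedFunctor D E)
    (K : ClosedFunctor E E') : (F.comp G).comp K = F.comp (G.comp K) :=
  ext' rfl (fun X Y => heq_of_eq (by simp [comp])) (heq_of_eq (by simp [comp]))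

end ClosedFunctor

namespace ClosedNatTrans

variable {C D E : ClosedCategory.{v, u}}

@[ext]
theorem ext' {F G : ClosedFunctor C D} {r s : ClosedNatTrans F G} (h : r.trans = s.trans) :
    r = s := by
  cases r
  cases s
  congr

/-- The identity transformation. -/
def id (F : ClosedFunctor C D) : ClosedNatTrans F F where
  trans := 𝟙 F.functor
  cn1 := by simp
  cn2 X Y := by simp [hl_id, hr_id]

/-- The vertical composite. -/
def vcomp {F G K : ClosedFunctor C D} (r : ClosedNatTrans F G) (s : ClosedNatTrans G K) :
    ClosedNatTrans F K where
  trans := r.trans ≫ s.trans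
  cn1 := by rw [NatTrans.comp_app, ← Category.assoc, r.cn1, s.cn1]
  cn2 X Y := by
    have hr := r.cn2 X Y
    have hs := s.cn2 X Y
    simp only [NatTrans.comp_app, hl_comp, hr_comp, Category.assoc]
    rw [reassoc_of% hr, ← hr_hl, reassoc_of% hs]

/-- Whiskering with a closed functor acting first. -/
def whiskerLeft (F : ClosedFunctor C D) {G K : ClosedFunctor D E} (r : ClosedNatTrans G K) :
    ClosedNatTrans (F.comp G) (F.comp K) where
  trans := F.functor.whiskerLeft r.trans
  cn1 := by
    have := r.cn1
    simp only [ClosedFunctor.comp, Functor.whiskerLeft_app, Category.assoc]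
    rw [r.trans.naturality, reassoc_of% this]
  cn2 X Y := by
    have := r.cn2 (F.functor.obj X) (F.functor.obj Y)
    simp only [ClosedFunctor.comp, Functor.whiskerLeft_app, Category.assoc, Functor.comp_obj]
    rw [this, r.trans.naturality_assoc]

/-- Whiskering with a closed functor acting last. -/
def whiskerRight {F G : ClosedFunctor C D} (r : ClosedNatTrans F G) (K : ClosedFunctor D E) :
    ClosedNatTrans (F.comp K) (G.comp K) where
  trans := Functor.whiskerRight r.trans K.functor
  cn1 := by
    have := r.cn1
    simp only [ClosedFunctor.comp, Functor.whiskerRight_app, Category.assoc, ← Functor.map_comp,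
      this]
  cn2 X Y := by
    have h := congrArg K.functor.map (r.cn2 X Y)
    have h1 := K.hat_natural_right (F.functor.obj X) (r.trans.app Y)
    have h2 := K.hat_natural_left (r.trans.app X) (G.functor.obj Y)
    simp only [Functor.map_comp] at h
    simp only [ClosedFunctor.comp, Functor.whiskerRight_app, Category.assoc, Functor.comp_obj]
    rw [← h1, reassoc_of% h, h2]

end ClosedNatTrans

instance : CategoryStruct ClosedCategory.{v, u} where
  Hom C D := ClosedFunctor C D
  id C := ClosedFunctor.id C
  comp F G := F.comp G

instance homCategory (C D : ClosedCategory.{v, u}) : Category (C ⟶ D) where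
  Hom F G := ClosedNatTrans F G
  id F := ClosedNatTrans.id F
  comp r s := r.vcomp s
  id_comp r := ClosedNatTrans.ext' (Category.id_comp r.trans)
  comp_id r := ClosedNatTrans.ext' (Category.comp_id r.trans)
  assoc r s t := ClosedNatTrans.ext' (Category.assoc r.trans s.trans t.trans)

variable {C D E : ClosedCategory.{v, u}}

theorem hom_ext {F G : C ⟶ D} {r s : F ⟶ G} (h : ∀ X, r.trans.app X = s.trans.app X) :
    r = s :=
  ClosedNatTrans.ext' (NatTrans.ext (funext h))

theorem eqToHom_app {F G : C ⟶ D} (h : F = G) (X : C.carrier) :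
    HEq ((eqToHom h).trans.app X) (𝟙 (F.functor.obj X)) := by
  subst h
  rfl

theorem id_comp_app (F : C ⟶ D) (X : C.carrier) :
    (eqToHom (ClosedFunctor.id_comp F) : 𝟙 C ≫ F ⟶ F).trans.app X = 𝟙 (F.functor.obj X) :=
  eq_of_heq (eqToHom_app _ _)

theorem id_comp_app' (F : C ⟶ D) (X : C.carrier) :
    (eqToHom (ClosedFunctor.id_comp F).symm : F ⟶ 𝟙 C ≫ F).trans.app X =
      𝟙 (F.functor.obj X) :=
  eq_of_heq (eqToHom_app _ _)

theorem comp_id_app (F : C ⟶ D) (X : C.carrier) :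
    (eqToHom (ClosedFunctor.comp_id F) : F ≫ 𝟙 D ⟶ F).trans.app X = 𝟙 (F.functor.obj X) :=
  eq_of_heq (eqToHom_app _ _)

theorem comp_id_app' (F : C ⟶ D) (X : C.carrier) :
    (eqToHom (ClosedFunctor.comp_id F).symm : F ⟶ F ≫ 𝟙 D).trans.app X =
      𝟙 (F.functor.obj X) :=
  eq_of_heq (eqToHom_app _ _)

theorem assoc_app {E' : ClosedCategory.{v, u}} (F : C ⟶ D) (G : D ⟶ E) (K : E ⟶ E')
    (X : C.carrier) :
    (eqToHom (ClosedFunctor.assoc F G K) : (F ≫ G) ≫ K ⟶ F ≫ G ≫ K).trans.app X =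
      𝟙 (K.functor.obj (G.functor.obj (F.functor.obj X))) :=
  eq_of_heq (eqToHom_app _ _)

theorem assoc_app' {E' : ClosedCategory.{v, u}} (F : C ⟶ D) (G : D ⟶ E) (K : E ⟶ E')
    (X : C.carrier) :
    (eqToHom (ClosedFunctor.assoc F G K).symm : F ≫ G ≫ K ⟶ (F ≫ G) ≫ K).trans.app X =
      𝟙 (K.functor.obj (G.functor.obj (F.functor.obj X))) :=
  eq_of_heq (eqToHom_app _ _)

/-- Left whiskering in the 2-category of closed categories. -/
def wl (F : C ⟶ D) {G K : D ⟶ E} (r : G ⟶ K) : F ≫ G ⟶ F ≫ K :=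
  ClosedNatTrans.whiskerLeft F r

/-- Right whiskering in the 2-category of closed categories. -/
def wr {F G : C ⟶ D} (r : F ⟶ G) (K : D ⟶ E) : F ≫ K ⟶ G ≫ K :=
  ClosedNatTrans.whiskerRight r K

theorem conj_id {X : Type u} [Category.{v} X] {A B : X} {x : A ⟶ A} {y : B ⟶ B} (f : A ⟶ B)
    (hx : x = 𝟙 A) (hy : y = 𝟙 B) : f = x ≫ f ≫ y := by
  rw [hx, hy, Category.comp_id, Category.id_comp]

/-- The 2-category of closed categories, closed functors and closed natural transformations. -/
instance : Bicategory ClosedCategory.{v, u} where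
  homCategory C D := homCategory C D
  whiskerLeft F _ _ r := wl F r
  whiskerRight r K := wr r K
  associator F G K := eqToIso (ClosedFunctor.assoc F G K)
  leftUnitor F := eqToIso (ClosedFunctor.id_comp F)
  rightUnitor F := eqToIso (ClosedFunctor.comp_id F)
  whiskerLeft_id F G := hom_ext fun X => rfl
  whiskerLeft_comp F _ _ _ r s := hom_ext fun X => rfl
  id_whiskerLeft r := hom_ext fun X =>
    conj_id ((ClosedNatTrans.trans r).app X) (id_comp_app _ X) (id_comp_app' _ X)
  comp_whiskerLeft F G _ _ r := hom_ext fun X =>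
    conj_id ((ClosedNatTrans.trans r).app (G.functor.obj (F.functor.obj X)))
      (assoc_app _ _ _ X) (assoc_app' _ _ _ X)
  id_whiskerRight F G := hom_ext fun X => G.functor.map_id (F.functor.obj X)
  comp_whiskerRight r s K := hom_ext fun X =>
    K.functor.map_comp ((ClosedNatTrans.trans r).app X) ((ClosedNatTrans.trans s).app X)
  whiskerRight_id r := hom_ext fun X =>
    conj_id ((ClosedNatTrans.trans r).app X) (comp_id_app _ X) (comp_id_app' _ X)
  whiskerRight_comp r G K := hom_ext fun X =>
    conj_id (K.functor.map (G.functor.map ((ClosedNatTrans.trans r).app X)))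
      (assoc_app' _ _ _ X) (assoc_app _ _ _ X)
  whisker_assoc F _ _ r K := hom_ext fun X =>
    conj_id (K.functor.map ((ClosedNatTrans.trans r).app (F.functor.obj X)))
      (assoc_app _ _ _ X) (assoc_app' _ _ _ X)
  whisker_exchange r s := hom_ext fun X =>
    ((ClosedNatTrans.trans s).naturality ((ClosedNatTrans.trans r).app X)).symm
  pentagon {_ _ _ _ E'} F G K M := hom_ext fun X => by
    refine (congrArg₂ (CategoryStruct.comp (obj := E'.carrier))
      (congrArg M.functor.map (assoc_app F G K X))
      (congrArg₂ (CategoryStruct.comp (obj := E'.carrier)) (assoc_app F (G ≫ K) M X)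
        (assoc_app G K M (F.functor.obj X)))).trans ?_
    refine Eq.trans ?_ (congrArg₂ (CategoryStruct.comp (obj := E'.carrier))
      (assoc_app (F ≫ G) K M X) (assoc_app F G (K ≫ M) X)).symm
    refine (congrArg₂ (CategoryStruct.comp (obj := E'.carrier))
      (M.functor.map_id (K.functor.obj (G.functor.obj (F.functor.obj X)))) rfl).trans ?_
    exact Category.id_comp _
  triangle {_ D E} F G := hom_ext fun X => by
    refine (congrArg₂ (CategoryStruct.comp (obj := E.carrier)) (assoc_app F (𝟙 D) G X)
      (id_comp_app G (F.functor.obj X))).trans ?_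
    refine Eq.trans ?_ (congrArg G.functor.map (comp_id_app F X)).symm
    exact (Category.id_comp _).trans (G.functor.map_id (F.functor.obj X)).symm

instance : Bicategory.Strict ClosedCategory.{v, u} where
  id_comp F := ClosedFunctor.id_comp F
  comp_id F := ClosedFunctor.comp_id F
  assoc F G K := ClosedFunctor.assoc F G K
  leftUnitor_eqToIso _ := rfl
  rightUnitor_eqToIso _ := rfl
  associator_eqToIso _ _ _ := rfl

end ClosedCategory

end ClosedMulti
namespace ClosedMulti

/-! ### Closed multicategories with unit objects -/

namespace Multicategory

variable (C : Multicategory.{v, u})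

/-- The map `f ↦ (1_{X₁},…,1_{Xₘ},f)·ev` from morphisms `Y₁,…,Yₙ → E` to morphisms
`X₁,…,Xₘ,Y₁,…,Yₙ → Z`, where `ev : X₁,…,Xₘ,E → Z`. -/
def evalMap {Xs : List C.Ob} {E Z : C.Ob} (ev : C.Hom (Xs ++ [E]) Z) (Ys : List C.Ob)
    (f : C.Hom Ys E) : C.Hom (Xs ++ Ys) Z :=
  C.comp ((Fam.ids C.id Xs).append (Fam.single f)) ev

/-- An internal Hom-object `C(X₁,…,Xₘ;Z)` with its evaluation morphism. -/
structure InternalHom (Xs : List C.Ob) (Z : C.Ob) where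
  /-- The internal Hom-object. -/
  obj : C.Ob
  /-- The evaluation morphism. -/
  ev : C.Hom (Xs ++ [obj]) Z
  bijective : ∀ Ys : List C.Ob, Function.Bijective (C.evalMap ev Ys)

/-- A multicategory is closed if all internal Hom-objects exist. -/
def IsClosed : Prop := ∀ (Xs : List C.Ob) (Z : C.Ob), Nonempty (C.InternalHom Xs Z)

/-- A unary morphism is an isomorphism if it has a two-sided inverse. -/
def IsIso₁ {X Y : C.Ob} (f : C.Hom [X] Y) : Prop :=
  ∃ g : C.Hom [Y] X, C.comp (Fam.single f) g = C.id X ∧ C.comp (Fam.single g) f = C.id Y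

/-- A unit object: an object `1` together with a morphism `u : () → 1` such that, for each
object `X` and each internal Hom-object `C(1;X)`, the morphism
`(u,1)·ev : C(1;X) → X` is an isomorphism. -/
structure UnitObject where
  /-- The object `1`. -/
  one : C.Ob
  /-- The morphism `() → 1`. -/
  u : C.Hom [] one
  isIso : ∀ (X : C.Ob) (E : C.InternalHom [one] X),
    C.IsIso₁ (C.comp (Fam.cons u (Fam.single (C.id E.obj)) rfl) E.ev)

/-- A choice of internal Hom-objects `C(X;Z)` and of a unit object. -/
structure ClosedData where
  /-- The chosen internal Hom-objects. -/
  ihom : ∀ X Z : C.Ob, C.InternalHom [X] Z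
  /-- The chosen unit object. -/
  unit : C.UnitObject

namespace ClosedData

variable {C} (K : C.ClosedData)

/-- The internal Hom-object `C(X;Z)`. -/
def h (X Z : C.Ob) : C.Ob := (K.ihom X Z).obj

/-- The evaluation `X, C(X;Z) → Z`. -/
def ev (X Z : C.Ob) : C.Hom [X, K.h X Z] Z := (K.ihom X Z).ev

/-- The map `f ↦ (1_X,f)·ev`. -/
def phi {Ys : List C.Ob} {X Z : C.Ob} (f : C.Hom Ys (K.h X Z)) : C.Hom (X :: Ys) Z :=
  C.comp (Fam.cons (C.id X) (Fam.single f) rfl) (K.ev X Z)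

theorem phi_bijective (Ys : List C.Ob) (X Z : C.Ob) :
    Function.Bijective (K.phi : C.Hom Ys (K.h X Z) → C.Hom (X :: Ys) Z) :=
  (K.ihom X Z).bijective Ys

/-- The morphism `⟨f⟩` with `(1,⟨f⟩)·ev = f`. -/
noncomputable def cur {Ys : List C.Ob} {X Z : C.Ob} (f : C.Hom (X :: Ys) Z) :
    C.Hom Ys (K.h X Z) :=
  (Equiv.ofBijective _ (K.phi_bijective Ys X Z)).symm f

theorem phi_cur {Ys : List C.Ob} {X Z : C.Ob} (f : C.Hom (X :: Ys) Z) :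
    K.phi (K.cur f) = f :=
  (Equiv.ofBijective _ (K.phi_bijective Ys X Z)).apply_symm_apply f

theorem phi_inj {Ys : List C.Ob} {X Z : C.Ob} {f g : C.Hom Ys (K.h X Z)}
    (e : K.phi f = K.phi g) : f = g :=
  (K.phi_bijective Ys X Z).1 e

/-- `C(f;Z) : C(X;Z) → C(X';Z)`. -/
noncomputable def homL {X' X : C.Ob} (f : C.Hom [X'] X) (Z : C.Ob) :
    C.Hom [K.h X Z] (K.h X' Z) :=
  K.cur (C.comp (Fam.cons f (Fam.single (C.id (K.h X Z))) rfl) (K.ev X Z))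

/-- `C(X;g) : C(X;Y) → C(X;Z)`. -/
noncomputable def homR (X : C.Ob) {Y Z : C.Ob} (g : C.Hom [Y] Z) :
    C.Hom [K.h X Y] (K.h X Z) :=
  K.cur (C.comp (Fam.single (K.ev X Y)) g)

/-- The composition `C(X;Y), C(Y;Z) → C(X;Z)`. -/
noncomputable def mu (X Y Z : C.Ob) : C.Hom [K.h X Y, K.h Y Z] (K.h X Z) :=
  K.cur (C.comp (Fam.cons (K.ev X Y) (Fam.single (C.id (K.h Y Z))) rfl) (K.ev Y Z))

/-- The morphism `L^X_{YZ}` with `(1,L^X_{YZ})·ev` the composition. -/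
noncomputable def L (X Y Z : C.Ob) : C.Hom [K.h Y Z] (K.h (K.h X Y) (K.h X Z)) :=
  K.cur (K.mu X Y Z)

/-- The morphism `C(u;X) = (u,1)·ev : C(1;X) → X`. -/
def nullary (X : C.Ob) : C.Hom [K.h K.unit.one X] X :=
  C.comp (Fam.cons K.unit.u (Fam.single (C.id (K.h K.unit.one X))) rfl) (K.ev K.unit.one X)

/-- The identity `() → C(X;X)`. -/
noncomputable def one (X : C.Ob) : C.Hom [] (K.h X X) := K.cur (C.id X)

/-! ### Calculus of evaluations -/

theorem phi_id (X Z : C.Ob) : K.phi (C.id (K.h X Z)) = K.ev X Z := C.id_comp (K.ev X Z)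

theorem phi_homL {X' X : C.Ob} (f : C.Hom [X'] X) (Z : C.Ob) :
    K.phi (K.homL f Z) = pre f (K.ev X Z) := K.phi_cur _

theorem phi_homR (X : C.Ob) {Y Z : C.Ob} (g : C.Hom [Y] Z) :
    K.phi (K.homR X g) = comp₁ (K.ev X Y) g := K.phi_cur _

theorem phi_mu (X Y Z : C.Ob) : K.phi (K.mu X Y Z) = pre (K.ev X Y) (K.ev Y Z) := K.phi_cur _

theorem phi_L (X Y Z : C.Ob) : K.phi (K.L X Y Z) = K.mu X Y Z := K.phi_cur _

theorem phi_one (X : C.Ob) : K.phi (K.one X) = C.id X := K.phi_cur _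

/-- Plugging `k` into the second slot of a binary morphism. -/
theorem phi_comp₁ {Ys : List C.Ob} {B X Z : C.Ob} (k : C.Hom Ys B) (g : C.Hom [B] (K.h X Z)) :
    K.phi (comp₁ k g) = C.comp (Fam.cons (C.id X) (Fam.single k) rfl) (K.phi g) :=
  comp_cons_single_comp (C.id X) (Fam.single k) g (K.ev X Z) rfl rfl

theorem sec_pre {Ys : List C.Ob} {X X' B Z : C.Ob} (f : C.Hom [X'] X) (k : C.Hom Ys B)
    (h : C.Hom [X, B] Z) :
    C.comp (Fam.cons (C.id X') (Fam.single k) rfl) (pre f h) =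
      pre f (C.comp (Fam.cons (C.id X) (Fam.single k) rfl) h) := by
  have h1 : C.comp (Fam.cons f (Fam.single k) rfl) h =
      pre f (C.comp (Fam.cons (C.id X) (Fam.single k) rfl) h) := by
    have := comp_cons_single_comp f (Fam.ids C.id Ys) k h (Vs := [X'] ++ Ys) rfl
      (Us := [X] ++ Ys) rfl
    rw [C.id_comp] at this
    exact this
  have h2 : C.comp (Fam.cons f (Fam.single k) rfl) h =
      C.comp (Fam.cons (C.id X') (Fam.single k) rfl) (pre f h) := by
    have := comp_cons_comp (Fam.single (C.id X')) f (Fam.single k) h (Vs := [X'] ++ Ys) rfl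
      (Us := [X'] ++ [B]) rfl
    have e : C.comp (Fam.single (C.id X')) f = f := C.id_comp f
    rw [e] at this
    exact this
  rw [← h1, h2]

theorem sec_pre_nil {Ys : List C.Ob} {X B Z : C.Ob} (f : C.Hom [] X) (k : C.Hom Ys B)
    (h : C.Hom [X, B] Z) :
    C.comp (Fam.single k) (pre (Ys := [B]) f h) =
      pre f (C.comp (Fam.cons (C.id X) (Fam.single k) rfl) h) := by
  have h1 : C.comp (Fam.cons f (Fam.single k) rfl) h =
      pre f (C.comp (Fam.cons (C.id X) (Fam.single k) rfl) h) := by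
    have := comp_cons_single_comp f (Fam.ids C.id Ys) k h (Vs := [] ++ Ys) rfl
      (Us := [X] ++ Ys) rfl
    rw [C.id_comp] at this
    exact this
  have h2 : C.comp (Fam.cons f (Fam.single k) rfl) h =
      C.comp (Fam.single k) (pre (Ys := [B]) f h) := by
    have := comp_cons_comp (Fam.nil) f (Fam.single k) h (Vs := [] ++ Ys) rfl
      (Us := [] ++ [B]) rfl
    have e : C.comp Fam.nil f = f := C.id_comp f
    rw [e] at this
    exact this
  rw [← h1, h2]

theorem phi_comp_homL {Ys : List C.Ob} {X' X Z : C.Ob} (k : C.Hom Ys (K.h X Z))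
    (f : C.Hom [X'] X) : K.phi (comp₁ k (K.homL f Z)) = pre f (K.phi k) := by
  rw [phi_comp₁, phi_homL, sec_pre]
  rfl

theorem phi_comp_homR {Ys : List C.Ob} {X Y Z : C.Ob} (k : C.Hom Ys (K.h X Y))
    (g : C.Hom [Y] Z) : K.phi (comp₁ k (K.homR X g)) = comp₁ (K.phi k) g := by
  rw [phi_comp₁, phi_homR]
  exact (comp_comp₁ _ _ _).symm

theorem comp_nullary {Ys : List C.Ob} {X : C.Ob} (k : C.Hom Ys (K.h K.unit.one X)) :
    comp₁ k (K.nullary X) = pre K.unit.u (K.phi k) :=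
  sec_pre_nil K.unit.u k (K.ev K.unit.one X)

/-- Evaluation of a composite whose last factor evaluates to `(ev,1)·f'`. -/
theorem phi_pre {Xs Ys : List C.Ob} {X Y Z : C.Ob} (g : C.Hom Xs (K.h X Y))
    (f : C.Hom (K.h X Y :: Ys) (K.h X Z)) (f' : C.Hom (Y :: Ys) Z)
    (hf : K.phi f = pre (K.ev X Y) f') :
    K.phi (pre g f) = pre (Xs := X :: Xs) (K.phi g) f' := by
  have h1 := comp_cons_single_comp (C.id X) (Fam.cons g (Fam.ids C.id Ys) rfl) f (K.ev X Z)
    (Vs := [X] ++ (Xs ++ Ys)) rfl (Us := [X] ++ (K.h X Y :: Ys)) rfl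
  refine h1.trans ?_
  have h2 := comp_cons_comp (Fam.cons (C.id X) (Fam.single g) rfl) (K.ev X Y)
    (Fam.ids C.id Ys) f' (Vs := (X :: Xs) ++ Ys) rfl (Us := [X, K.h X Y] ++ Ys) rfl
  refine Eq.trans ?_ h2.symm
  exact congrArg _ hf

/-- `φ(k·L) = (1,k)·μ`, and evaluating once more gives `(ev,1)·φ(k)`. -/
theorem phi_phi_comp_L {Ys : List C.Ob} {X Y Z : C.Ob} (k : C.Hom Ys (K.h Y Z)) :
    K.phi (K.phi (comp₁ k (K.L X Y Z))) = pre (K.ev X Y) (K.phi k) := by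
  rw [phi_comp₁, phi_L]
  have h1 := comp_cons_single_comp (C.id X) (Fam.cons (C.id (K.h X Y)) (Fam.single k) rfl)
    (K.mu X Y Z) (K.ev X Z) (Vs := [X, K.h X Y] ++ Ys) rfl
    (Us := [X, K.h X Y, K.h Y Z]) rfl
  refine h1.trans ?_
  have h2 : C.comp (Fam.cons (C.id X) (Fam.single (K.mu X Y Z)) rfl) (K.ev X Z) =
    pre (K.ev X Y) (K.ev Y Z) := K.phi_mu X Y Z
  refine (congrArg _ h2).trans ?_
  have h3 := comp_cons_comp (Fam.ids C.id [X, K.h X Y]) (K.ev X Y) (Fam.single k) (K.ev Y Z)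
    (Vs := [X, K.h X Y] ++ Ys) rfl (Us := [X, K.h X Y] ++ [K.h Y Z]) rfl
  rw [C.id_comp] at h3
  refine h3.symm.trans ?_
  have h4 := comp_cons_single_comp (K.ev X Y) (Fam.ids C.id Ys) k (K.ev Y Z)
    (Vs := [X, K.h X Y] ++ Ys) rfl (Us := [Y] ++ Ys) rfl
  rw [C.id_comp] at h4
  exact h4

theorem phi_phi_L (X Y Z : C.Ob) :
    K.phi (K.phi (K.L X Y Z)) = pre (K.ev X Y) (K.ev Y Z) := by
  rw [phi_L, phi_mu]

/-- The inverse of `C(u;X)`. -/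
noncomputable def i (X : C.Ob) : C.Hom [X] (K.h K.unit.one X) :=
  (K.unit.isIso X (K.ihom K.unit.one X)).choose

theorem nullary_i (X : C.Ob) : comp₁ (K.nullary X) (K.i X) = C.id (K.h K.unit.one X) :=
  (K.unit.isIso X (K.ihom K.unit.one X)).choose_spec.1

theorem i_nullary (X : C.Ob) : comp₁ (K.i X) (K.nullary X) = C.id X :=
  (K.unit.isIso X (K.ihom K.unit.one X)).choose_spec.2

theorem nullary_cancel {Ys : List C.Ob} {X : C.Ob} {f g : C.Hom Ys (K.h K.unit.one X)}
    (e : comp₁ f (K.nullary X) = comp₁ g (K.nullary X)) : f = g := by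
  have := congrArg (fun q => comp₁ q (K.i X)) e
  simpa only [comp₁_assoc, nullary_i, comp₁_id] using this

/-- Composition with `u` is a bijection from morphisms `1 → X` to morphisms `() → X`. -/
theorem u_bijective (X : C.Ob) :
    Function.Bijective (fun f : C.Hom [K.unit.one] X => comp₁ K.unit.u f) := by
  have hphi : ∀ k : C.Hom [] (K.h K.unit.one X),
      comp₁ K.unit.u (K.phi k) = comp₁ k (K.nullary X) := fun k => (K.comp_nullary k).symm
  constructor
  · intro f g e
    obtain ⟨f, rfl⟩ := (K.phi_bijective [] K.unit.one X).2 f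
    obtain ⟨g, rfl⟩ := (K.phi_bijective [] K.unit.one X).2 g
    simp only [hphi] at e
    rw [K.nullary_cancel e]
  · intro f
    refine ⟨K.phi (comp₁ f (K.i X)), ?_⟩
    simp only [hphi, comp₁_assoc, i_nullary, comp₁_id]

/-- The morphism `f̄ : 1 → X` with `u·f̄ = f`. -/
noncomputable def bar {X : C.Ob} (f : C.Hom [] X) : C.Hom [K.unit.one] X :=
  (Equiv.ofBijective _ (K.u_bijective X)).symm f

theorem u_bar {X : C.Ob} (f : C.Hom [] X) : comp₁ K.unit.u (K.bar f) = f :=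
  (Equiv.ofBijective _ (K.u_bijective X)).apply_symm_apply f

theorem u_cancel {X : C.Ob} {f g : C.Hom [K.unit.one] X}
    (e : comp₁ K.unit.u f = comp₁ K.unit.u g) : f = g :=
  (K.u_bijective X).1 e

/-- The morphism `j_X : 1 → C(X;X)` with `u·j_X` the identity `() → C(X;X)`. -/
noncomputable def j (X : C.Ob) : C.Hom [K.unit.one] (K.h X X) := K.bar (K.one X)

theorem u_j (X : C.Ob) : comp₁ K.unit.u (K.j X) = K.one X := K.u_bar _

end ClosedData

/-- The objects of the underlying category of a multicategory. -/
def Underlying (C : Multicategory.{v, u}) : Type u := C.Ob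

instance (C : Multicategory.{v, u}) : Category.{v} C.Underlying where
  Hom X Y := C.Hom [X] Y
  id X := C.id X
  comp f g := comp₁ f g
  id_comp f := id_comp₁ f
  comp_id f := comp₁_id f
  assoc f g h := comp₁_assoc f g h

namespace ClosedData

variable {C} (K : C.ClosedData)

/-- The internal Hom-functor `C(-;-)`. -/
noncomputable def homFunctor : C.Underlyingᵒᵖ ⥤ C.Underlying ⥤ C.Underlying where
  obj X :=
    { obj := fun Y => K.h X.unop Y
      map := fun g => K.homR X.unop g
      map_id := fun Y => K.phi_inj ((K.phi_homR _ _).trans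
        ((comp₁_id _).trans (K.phi_id _ _).symm))
      map_comp := fun {A B D} f g => K.phi_inj <| by
        refine (K.phi_homR _ _).trans ?_
        refine Eq.trans ?_ (K.phi_comp_homR _ _).symm
        refine Eq.trans ?_ (congrArg (fun q => comp₁ q g) (K.phi_homR _ _).symm)
        exact (comp₁_assoc _ _ _).symm }
  map {X X'} f :=
    { app := fun Y => K.homL f.unop Y
      naturality := fun {Y Z} g => K.phi_inj <| by
        refine (K.phi_comp_homL (K.homR X.unop g) f.unop).trans ?_
        refine Eq.trans ?_ (K.phi_comp_homR (K.homL f.unop Y) g).symm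
        refine (congrArg _ (K.phi_homR _ _)).trans ?_
        refine Eq.trans ?_ (congrArg (fun q => comp₁ q g) (K.phi_homL _ _).symm)
        exact (pre_comp₁ _ _ _).symm }
  map_id X := NatTrans.ext <| funext fun Y => K.phi_inj <| by
    refine (K.phi_homL _ _).trans ?_
    exact (pre_id _).trans (K.phi_id _ _).symm
  map_comp {X X' X''} f g := NatTrans.ext <| funext fun Y => K.phi_inj <| by
    refine (K.phi_homL _ _).trans ?_
    refine Eq.trans ?_ (K.phi_comp_homL (K.homL f.unop Y) g.unop).symm
    refine Eq.trans ?_ (congrArg _ (K.phi_homL _ _).symm)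
    exact (pre_one_pre (As := []) g.unop f.unop (K.ev _ _)).symm

end ClosedData

end Multicategory

end ClosedMulti
namespace ClosedMulti

namespace Multicategory

namespace ClosedData

variable {C : Multicategory.{v, u}} (K : C.ClosedData)

theorem nullary_natural {X Y : C.Ob} (f : C.Hom [X] Y) :
    comp₁ (K.homR K.unit.one f) (K.nullary Y) = comp₁ (K.nullary X) f := by
  rw [comp_nullary, phi_homR]
  exact (pre_comp₁ (Ys := [K.h K.unit.one X]) K.unit.u (K.ev K.unit.one X) f).symm

theorem i_natural {X Y : C.Ob} (f : C.Hom [X] Y) :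
    comp₁ f (K.i Y) = comp₁ (K.i X) (K.homR K.unit.one f) := by
  apply K.nullary_cancel
  rw [comp₁_assoc, i_nullary, comp₁_assoc, nullary_natural, ← comp₁_assoc, i_nullary,
    comp₁_id, id_comp₁]

theorem j_dinatural {X Y : C.Ob} (f : C.Hom [X] Y) :
    comp₁ (K.j X) (K.homR X f) = comp₁ (K.j Y) (K.homL f Y) := by
  apply K.u_cancel
  rw [← comp₁_assoc, ← comp₁_assoc, u_j, u_j]
  apply K.phi_inj
  rw [phi_comp_homR, phi_comp_homL, phi_one, phi_one, id_comp₁]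
  exact (pre_one_id f).symm

theorem L_natural_left (X : C.Ob) {Y' Y : C.Ob} (f : C.Hom [Y'] Y) (Z : C.Ob) :
    comp₁ (K.homL f Z) (K.L X Y' Z) =
      comp₁ (K.L X Y Z) (K.homL (K.homR X f) (K.h X Z)) := by
  apply K.phi_inj
  apply K.phi_inj
  rw [phi_phi_comp_L, phi_homL, phi_comp_homL]
  refine Eq.trans ?_ (K.phi_pre (K.homR X f) (K.phi (K.L X Y Z)) (K.ev Y Z)
    (K.phi_phi_L _ _ _)).symm
  rw [phi_homR]
  exact pre_two_pre (As := []) (K.ev X Y') f (K.ev Y Z)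

theorem L_natural_right (X Y : C.Ob) {Z Z' : C.Ob} (g : C.Hom [Z] Z') :
    comp₁ (K.homR Y g) (K.L X Y Z') =
      comp₁ (K.L X Y Z) (K.homR (K.h X Y) (K.homR X g)) := by
  apply K.phi_inj
  apply K.phi_inj
  rw [phi_phi_comp_L, phi_homR, phi_comp_homR, phi_comp_homR, phi_phi_L]
  exact (pre_comp₁ _ _ _).symm

theorem L_dinatural {X' X : C.Ob} (f : C.Hom [X'] X) (Y Z : C.Ob) :
    comp₁ (K.L X Y Z) (K.homR (K.h X Y) (K.homL f Z)) =
      comp₁ (K.L X' Y Z) (K.homL (K.homL f Y) (K.h X' Z)) := by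
  apply K.phi_inj
  apply K.phi_inj
  rw [phi_comp_homR, phi_comp_homL, phi_comp_homL, phi_phi_L]
  refine Eq.trans ?_ (K.phi_pre (K.homL f Y) (K.phi (K.L X' Y Z)) (K.ev Y Z)
    (K.phi_phi_L _ _ _)).symm
  rw [phi_homL]
  exact pre_one_pre (As := [K.h X Y]) f (K.ev X Y) (K.ev Y Z)

theorem cc1 (X Y : C.Ob) : comp₁ (K.j Y) (K.L X Y Y) = K.j (K.h X Y) := by
  apply K.u_cancel
  rw [← comp₁_assoc, u_j, u_j]
  apply K.phi_inj
  apply K.phi_inj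
  rw [phi_phi_comp_L, phi_one, phi_one, phi_id]
  exact C.comp_id (K.ev X Y)

theorem cc2 (X Y : C.Ob) :
    comp₁ (K.L X X Y) (K.homL (K.j X) (K.h X Y)) = K.i (K.h X Y) := by
  apply K.nullary_cancel
  rw [i_nullary, comp_nullary, phi_comp_homL]
  apply K.phi_inj
  have h : pre K.unit.u (pre (K.j X) (K.phi (K.L X X Y))) =
      pre (Xs := []) (K.one X) (K.phi (K.L X X Y)) := by
    rw [← u_j]
    exact pre_nil_pre (As := []) K.unit.u (K.j X) (K.phi (K.L X X Y))
  refine (congrArg K.phi h).trans ?_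
  refine (K.phi_pre (K.one X) (K.phi (K.L X X Y)) (K.ev X Y) (K.phi_phi_L _ _ _)).trans ?_
  rw [phi_one]
  exact (pre_id _).trans (K.phi_id _ _).symm

theorem cc3 (X Y U V : C.Ob) :
    comp₁ (K.L Y U V) (K.homR (K.h Y U) (K.L X Y V)) =
      comp₁ (K.L X U V) (comp₁ (K.L (K.h X Y) (K.h X U) (K.h X V))
        (K.homL (K.L X Y U) (K.h (K.h X Y) (K.h X V)))) := by
  apply K.phi_inj
  apply K.phi_inj
  apply K.phi_inj
  rw [phi_comp_homR, phi_phi_comp_L, phi_phi_L, ← comp₁_assoc, phi_comp_homL]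
  have h := K.phi_pre (K.L X Y U)
    (K.phi (comp₁ (K.L X U V) (K.L (K.h X Y) (K.h X U) (K.h X V))))
    (K.phi (K.L X U V)) (K.phi_phi_comp_L _)
  refine Eq.trans ?_ (congrArg K.phi h).symm
  have h' := K.phi_pre (K.phi (K.L X Y U)) (K.phi (K.L X U V)) (K.ev U V) (K.phi_phi_L _ _ _)
  refine Eq.trans ?_ h'.symm
  rw [phi_phi_L]
  exact pre_two_pre (As := [K.h Y U]) (K.ev X Y) (K.ev Y U) (K.ev U V)

theorem cc4 (Y Z : C.Ob) :
    comp₁ (K.L K.unit.one Y Z) (K.homL (K.i Y) (K.h K.unit.one Z)) = K.homR Y (K.i Z) := by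
  apply K.phi_inj
  apply K.nullary_cancel
  rw [phi_homR, comp₁_assoc, i_nullary, comp₁_id, phi_comp_homL, comp_nullary]
  have h := K.phi_pre (K.i Y) (K.phi (K.L K.unit.one Y Z)) (K.ev Y Z) (K.phi_phi_L _ _ _)
  refine (congrArg (pre K.unit.u) h).trans ?_
  refine (pre_nil_pre (As := [Y]) K.unit.u (K.phi (K.i Y)) (K.ev Y Z)).trans ?_
  have h' : pre K.unit.u (K.phi (K.i Y)) = C.id Y := by
    rw [← comp_nullary, i_nullary]
  refine (congrArg (fun q => pre (Xs := [Y]) q (K.ev Y Z)) h').trans ?_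
  exact pre_id _

theorem cc5 (X Y : C.Ob) :
    Function.Bijective (fun f : C.Hom [X] Y => comp₁ (K.j X) (K.homR X f)) := by
  have h : ∀ f : C.Hom [X] Y,
      K.phi (comp₁ K.unit.u (comp₁ (K.j X) (K.homR X f))) = f := by
    intro f
    rw [← comp₁_assoc, u_j, phi_comp_homR, phi_one, id_comp₁]
  have hb : Function.Bijective
      (fun g : C.Hom [K.unit.one] (K.h X Y) => K.phi (comp₁ K.unit.u g)) :=
    (K.phi_bijective [] X Y).comp (K.u_bijective (K.h X Y))
  refine (Function.Bijective.of_comp_iff' hb _).1 ?_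
  have : ((fun g : C.Hom [K.unit.one] (K.h X Y) => K.phi (comp₁ K.unit.u g)) ∘
      fun f : C.Hom [X] Y => comp₁ (K.j X) (K.homR X f)) = _root_.id := funext h
  rw [this]
  exact Function.bijective_id

/-- The underlying closed category of a closed multicategory with a unit object. -/
noncomputable def closedCategory : ClosedCategory.{v, u} where
  carrier := C.Underlying
  hom := K.homFunctor
  unit := K.unit.one
  i X :=
    { hom := K.i X
      inv := K.nullary X
      hom_inv_id := K.i_nullary X
      inv_hom_id := K.nullary_i X }
  i_natural f := K.i_natural f
  j X := K.j X
  j_dinatural f := K.j_dinatural f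
  L X Y Z := K.L X Y Z
  L_natural_left X _ _ f Z := K.L_natural_left X f Z
  L_natural_right X Y _ _ g := K.L_natural_right X Y g
  L_dinatural f Y Z := K.L_dinatural f Y Z
  cc1 X Y := K.cc1 X Y
  cc2 X Y := K.cc2 X Y
  cc3 X Y U V := K.cc3 X Y U V
  cc4 Y Z := K.cc4 Y Z
  cc5 X Y := K.cc5 X Y

end ClosedData

end Multicategory

namespace Multifunctor

open Multicategory

variable {C D E : Multicategory.{v, u}} (KC : C.ClosedData) (KD : D.ClosedData)
  (KE : E.ClosedData)

/-- The closing transformation `F C(X;Y) → D(FX;FY)`. -/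
noncomputable def closing (F : Multifunctor C D) (X Y : C.Ob) :
    D.Hom [F.obj (KC.h X Y)] (KD.h (F.obj X) (F.obj Y)) :=
  KD.cur (F.map (KC.ev X Y))

theorem phi_closing (F : Multifunctor C D) (X Y : C.Ob) :
    KD.phi (F.closing KC KD X Y) = F.map (KC.ev X Y) := KD.phi_cur _

theorem phi_map_comp_closing₀ (F : Multifunctor C D) {X Y : C.Ob} (k : C.Hom [] (KC.h X Y)) :
    KD.phi (comp₁ (F.map k) (F.closing KC KD X Y)) = F.map (KC.phi k) := by
  rw [ClosedData.phi_comp₁, phi_closing]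
  have h := F.map_comp (Fam.cons (C.id X) (Fam.single k) rfl) (KC.ev X Y)
  simp only [Fam.map, Fam.single, F.map_id] at h
  exact h.symm

theorem phi_map_comp_closing₁ (F : Multifunctor C D) {W X Y : C.Ob}
    (k : C.Hom [W] (KC.h X Y)) :
    KD.phi (comp₁ (F.map k) (F.closing KC KD X Y)) = F.map (KC.phi k) := by
  rw [ClosedData.phi_comp₁, phi_closing]
  have h := F.map_comp (Fam.cons (C.id X) (Fam.single k) rfl) (KC.ev X Y)
  simp only [Fam.map, Fam.single, F.map_id] at h
  exact h.symm

theorem phi_map_comp_closing₂ (F : Multifunctor C D) {W W' X Y : C.Ob}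
    (k : C.Hom [W, W'] (KC.h X Y)) :
    KD.phi (comp₁ (F.map k) (F.closing KC KD X Y)) = F.map (KC.phi k) := by
  rw [ClosedData.phi_comp₁, phi_closing]
  have h := F.map_comp (Fam.cons (C.id X) (Fam.single k) rfl) (KC.ev X Y)
  simp only [Fam.map, Fam.single, F.map_id] at h
  exact h.symm

theorem map_pre_one (F : Multifunctor C D) {X A B Z : C.Ob} (f : C.Hom [X] A)
    (g : C.Hom [A, B] Z) :
    F.map (pre f g) = pre (Ys := [F.obj B]) (F.map f) (F.map g) := by
  have h := F.map_comp (Fam.cons f (Fam.ids C.id [B]) rfl) g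
  simp only [Fam.map, Fam.ids, F.map_id] at h
  exact h

theorem map_pre_nil (F : Multifunctor C D) {A B Z : C.Ob} (f : C.Hom [] A)
    (g : C.Hom [A, B] Z) :
    F.map (pre f g) = pre (Ys := [F.obj B]) (F.map f) (F.map g) := by
  have h := F.map_comp (Fam.cons f (Fam.ids C.id [B]) rfl) g
  simp only [Fam.map, Fam.ids, F.map_id] at h
  exact h

theorem map_pre_two (F : Multifunctor C D) {X X' A B Z : C.Ob} (f : C.Hom [X, X'] A)
    (g : C.Hom [A, B] Z) :
    F.map (pre f g) = pre (Ys := [F.obj B]) (F.map f) (F.map g) := by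
  have h := F.map_comp (Fam.cons f (Fam.ids C.id [B]) rfl) g
  simp only [Fam.map, Fam.ids, F.map_id] at h
  exact h

/-- The underlying functor of a multifunctor. -/
def functor (F : Multifunctor C D) : C.Underlying ⥤ D.Underlying where
  obj X := F.obj X
  map f := F.map (Xs := [_]) f
  map_id X := F.map_id X
  map_comp f g := map_comp₁ F f g

/-- The comparison `1 → F1` of unit objects. -/
noncomputable def unitComparison (F : Multifunctor C D) : D.Hom [KD.unit.one] (F.obj KC.unit.one) :=
  KD.bar (F.map KC.unit.u)

theorem u_unitComparison (F : Multifunctor C D) :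
    comp₁ KD.unit.u (F.unitComparison KC KD) = F.map KC.unit.u := KD.u_bar _

theorem closing_natural_left (F : Multifunctor C D) {X' X : C.Ob} (f : C.Hom [X'] X)
    (Y : C.Ob) :
    comp₁ (F.map (KC.homL f Y)) (F.closing KC KD X' Y) =
      comp₁ (F.closing KC KD X Y) (KD.homL (F.map f) (F.obj Y)) := by
  apply KD.phi_inj
  refine (F.phi_map_comp_closing₁ KC KD (KC.homL f Y)).trans ?_
  refine Eq.trans ?_ (KD.phi_comp_homL (F.closing KC KD X Y) (F.map f)).symm
  rw [phi_closing, ClosedData.phi_homL]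
  exact F.map_pre_one f (KC.ev X Y)

theorem closing_natural_right (F : Multifunctor C D) (X : C.Ob) {Y Y' : C.Ob}
    (g : C.Hom [Y] Y') :
    comp₁ (F.map (KC.homR X g)) (F.closing KC KD X Y') =
      comp₁ (F.closing KC KD X Y) (KD.homR (F.obj X) (F.map g)) := by
  apply KD.phi_inj
  refine (F.phi_map_comp_closing₁ KC KD (KC.homR X g)).trans ?_
  refine Eq.trans ?_ (KD.phi_comp_homR (F.closing KC KD X Y) (F.map g)).symm
  rw [phi_closing, ClosedData.phi_homR]
  exact map_comp₁ F _ _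

theorem closing_cf1 (F : Multifunctor C D) (X : C.Ob) :
    comp₁ (F.unitComparison KC KD) (comp₁ (F.map (KC.j X)) (F.closing KC KD X X)) =
      KD.j (F.obj X) := by
  apply KD.u_cancel
  rw [← comp₁_assoc, u_unitComparison, ← comp₁_assoc, ClosedData.u_j]
  have h : comp₁ (F.map KC.unit.u) (F.map (KC.j X)) = F.map (KC.one X) := by
    rw [← KC.u_j]
    exact (map_comp₁ F KC.unit.u (KC.j X)).symm
  refine (congrArg (fun q => comp₁ q (F.closing KC KD X X)) h).trans ?_
  apply KD.phi_inj
  refine (F.phi_map_comp_closing₀ KC KD (KC.one X)).trans ?_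
  rw [ClosedData.phi_one, ClosedData.phi_one, F.map_id]

theorem closing_cf2 (F : Multifunctor C D) (X : C.Ob) :
    comp₁ (F.map (KC.i X)) (comp₁ (F.closing KC KD KC.unit.one X)
      (KD.homL (F.unitComparison KC KD) (F.obj X))) = KD.i (F.obj X) := by
  apply KD.nullary_cancel
  rw [ClosedData.i_nullary, ← comp₁_assoc, ClosedData.comp_nullary]
  refine (congrArg (pre KD.unit.u) (KD.phi_comp_homL _ _)).trans ?_
  refine (congrArg (fun q => pre KD.unit.u (pre (F.unitComparison KC KD) q))
    (F.phi_map_comp_closing₁ KC KD (KC.i X))).trans ?_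
  refine (pre_nil_pre (As := []) KD.unit.u (F.unitComparison KC KD)
    (F.map (KC.phi (KC.i X)))).trans ?_
  refine (congrArg (fun q => pre (Xs := []) (Ys := [F.obj X]) q (F.map (KC.phi (KC.i X))))
    (F.u_unitComparison KC KD)).trans ?_
  refine (F.map_pre_nil KC.unit.u (KC.phi (KC.i X))).symm.trans ?_
  rw [← F.map_id]
  refine congrArg (fun q : C.Hom [X] X => F.map q) ?_
  rw [← KC.i_nullary]
  exact (KC.comp_nullary _).symm

theorem closing_cf3 (F : Multifunctor C D) (X Y Z : C.Ob) :
    comp₁ (F.map (KC.L X Y Z)) (comp₁ (F.closing KC KD (KC.h X Y) (KC.h X Z))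
        (KD.homR (F.obj (KC.h X Y)) (F.closing KC KD X Z))) =
      comp₁ (F.closing KC KD Y Z) (comp₁ (KD.L (F.obj X) (F.obj Y) (F.obj Z))
        (KD.homL (F.closing KC KD X Y) (KD.h (F.obj X) (F.obj Z)))) := by
  apply KD.phi_inj
  apply KD.phi_inj
  rw [← comp₁_assoc, ← comp₁_assoc]
  refine (congrArg KD.phi (KD.phi_comp_homR _ _)).trans ?_
  refine Eq.trans ?_ (congrArg KD.phi (KD.phi_comp_homL _ _)).symm
  refine (congrArg (fun q => KD.phi (comp₁ q (F.closing KC KD X Z)))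
    (F.phi_map_comp_closing₁ KC KD (KC.L X Y Z))).trans ?_
  refine (F.phi_map_comp_closing₂ KC KD (KC.phi (KC.L X Y Z))).trans ?_
  refine Eq.trans ?_ (KD.phi_pre (F.closing KC KD X Y) (KD.phi (comp₁ (F.closing KC KD Y Z)
    (KD.L (F.obj X) (F.obj Y) (F.obj Z)))) (KD.phi (F.closing KC KD Y Z))
    (KD.phi_phi_comp_L _)).symm
  rw [phi_closing, phi_closing, ClosedData.phi_phi_L]
  exact F.map_pre_two (KC.ev X Y) (KC.ev Y Z)

/-- The closed functor between the underlying closed categories given by a multifunctor. -/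
noncomputable def closedFunctor (F : Multifunctor C D) :
    ClosedCategory.ClosedFunctor KC.closedCategory KD.closedCategory where
  functor := F.functor
  hat X Y := F.closing KC KD X Y
  hat_natural_left f Y := F.closing_natural_left KC KD f Y
  hat_natural_right X _ _ g := F.closing_natural_right KC KD X g
  zero := F.unitComparison KC KD
  cf1 X := F.closing_cf1 KC KD X
  cf2 X := F.closing_cf2 KC KD X
  cf3 X Y Z := F.closing_cf3 KC KD X Y Z

end Multifunctor

namespace MultinatTrans

open Multicategory

variable {C D : Multicategory.{v, u}} (KC : C.ClosedData) (KD : D.ClosedData)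
  {F G : Multifunctor C D}

theorem cn1 (r : MultinatTrans F G) :
    comp₁ (F.unitComparison KC KD) (r.app KC.unit.one) = G.unitComparison KC KD := by
  apply KD.u_cancel
  rw [← comp₁_assoc, Multifunctor.u_unitComparison, Multifunctor.u_unitComparison]
  exact (r.naturality KC.unit.u).trans (D.id_comp _)

theorem cn2 (r : MultinatTrans F G) (X Y : C.Ob) :
    comp₁ (F.closing KC KD X Y) (KD.homR (F.obj X) (r.app Y)) =
      comp₁ (r.app (KC.h X Y)) (comp₁ (G.closing KC KD X Y)
        (KD.homL (r.app X) (G.obj Y))) := by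
  apply KD.phi_inj
  rw [← comp₁_assoc]
  refine (KD.phi_comp_homR _ _).trans ?_
  refine Eq.trans ?_ (KD.phi_comp_homL _ _).symm
  rw [Multifunctor.phi_closing, ClosedData.phi_comp₁, Multifunctor.phi_closing]
  refine (r.naturality (KC.ev X Y)).trans ?_
  have h := comp_cons_single_comp (r.app X) (Fam.ids D.id [F.obj (KC.h X Y)])
    (r.app (KC.h X Y)) (G.map (KC.ev X Y)) (Vs := [F.obj X, F.obj (KC.h X Y)]) rfl
    (Us := [G.obj X, F.obj (KC.h X Y)]) rfl
  rw [D.id_comp] at h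
  exact h

/-- The closed natural transformation given by a multinatural transformation. -/
noncomputable def closedNatTrans (r : MultinatTrans F G) :
    ClosedCategory.ClosedNatTrans (F.closedFunctor KC KD) (G.closedFunctor KC KD) where
  trans :=
    { app := fun X => r.app X
      naturality := fun _ _ f => r.naturality (Xs := [_]) f }
  cn1 := r.cn1 KC KD
  cn2 X Y := r.cn2 KC KD X Y

end MultinatTrans

end ClosedMulti
namespace ClosedMulti

/-! ### The 2-functor from closed multicategories with units to closed categories -/

open Multicategory

/-- A closed multicategory with a unit object; both are properties of a multicategory. -/
structure ClosedMulticategory where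
  /-- The underlying multicategory. -/
  toMulticategory : Multicategory.{v, u}
  isClosed : toMulticategory.IsClosed
  hasUnit : Nonempty toMulticategory.UnitObject

/-- Internal Hom-objects and a unit object can be chosen. -/
theorem ClosedMulticategory.nonempty_closedData (C : ClosedMulticategory.{v, u}) :
    Nonempty C.toMulticategory.ClosedData :=
  ⟨⟨fun X Z => (C.isClosed [X] Z).some, C.hasUnit.some⟩⟩

/-- The full sub-2-category of closed multicategories with unit objects in the 2-category of
multicategories. -/
abbrev ClMulticatU :=
  Bicategory.InducedBicategory Multicategory.{v, u}
    (fun C : ClosedMulticategory.{v, u} => C.toMulticategory)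

/-- The 2-category of closed categories. -/
abbrev ClCat := ClosedCategory.{v, u}

section

variable (K : ∀ C : ClosedMulticategory.{v, u}, C.toMulticategory.ClosedData)

theorem closedFunctor_id {C : Multicategory.{v, u}} (KC : C.ClosedData) :
    (Multifunctor.id C).closedFunctor KC KC = ClosedCategory.ClosedFunctor.id KC.closedCategory :=
  ClosedCategory.ClosedFunctor.ext' rfl
    (fun X Y => heq_of_eq (KC.phi_inj ((KC.phi_cur (KC.ev X Y)).trans (KC.phi_id X Y).symm)))
    (heq_of_eq (KC.u_cancel ((KC.u_bar _).trans (comp₁_id KC.unit.u).symm)))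

theorem closedFunctor_comp {C D E : Multicategory.{v, u}} (KC : C.ClosedData)
    (KD : D.ClosedData) (KE : E.ClosedData) (F : Multifunctor C D) (G : Multifunctor D E) :
    (F.comp G).closedFunctor KC KE =
      (F.closedFunctor KC KD).comp (G.closedFunctor KD KE) :=
  ClosedCategory.ClosedFunctor.ext' rfl
    (fun X Y => heq_of_eq (KE.phi_inj (by
      refine (KE.phi_cur _).trans ?_
      refine Eq.trans ?_ (G.phi_map_comp_closing₁ KD KE (F.closing KC KD X Y)).symm
      exact congrArg (fun q : D.Hom [F.obj X, F.obj (KC.h X Y)] (F.obj Y) => G.map q)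
        (F.phi_closing KC KD X Y).symm)))
    (heq_of_eq (KE.u_cancel (by
      refine (KE.u_bar _).trans ?_
      refine Eq.trans ?_ (comp₁_assoc KE.unit.u (G.unitComparison KD KE)
        (G.map (F.unitComparison KC KD)))
      rw [G.u_unitComparison]
      refine Eq.trans ?_ (map_comp₁ G KD.unit.u (F.unitComparison KC KD))
      rw [F.u_unitComparison]
      rfl)))

theorem trans_app_eqToHom {C D : ClosedCategory.{v, u}} {F F' G G' : C ⟶ D} (h : F = F')
    (h' : G' = G) (r : F' ⟶ G') (X : C.carrier) :
    HEq ((eqToHom h ≫ r ≫ eqToHom h').trans.app X) (r.trans.app X) := by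
  subst h h'
  simp only [eqToHom_refl, Category.id_comp, Category.comp_id]
  rfl

/-- The strict 2-functor `U` that assigns to a closed multicategory with a unit object its
underlying closed category, formed with the internal Hom-objects and the unit object that are
chosen by `K`. -/
noncomputable def underlyingTwoFunctor : StrictPseudofunctor ClMulticatU.{v, u} ClCat.{v, u} :=
  StrictPseudofunctor.mk''
    { obj := fun C => (K C).closedCategory
      map := fun {C D} F => Multifunctor.closedFunctor (K C) (K D) F.hom
      map₂ := fun {C D _ _} r => MultinatTrans.closedNatTrans (K C) (K D) r.hom
      map₂_id := fun _ => ClosedCategory.hom_ext fun _ => rfl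
      map₂_comp := fun _ _ => ClosedCategory.hom_ext fun _ => rfl
      map_id := fun C => closedFunctor_id (K C)
      map_comp := fun {C D E} F G => closedFunctor_comp (K C) (K D) (K E) F.hom G.hom
      map₂_whisker_left := fun {C D E} F _ _ r => ClosedCategory.hom_ext fun X =>
        (eq_of_heq (trans_app_eqToHom (closedFunctor_comp (K C) (K D) (K E) F.hom _)
          (closedFunctor_comp (K C) (K D) (K E) F.hom _).symm
          (ClosedCategory.wl (Multifunctor.closedFunctor (K C) (K D) F.hom)
            (MultinatTrans.closedNatTrans (K D) (K E) r.hom)) X)).symm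
      map₂_whisker_right := fun {C D E} _ _ r G => ClosedCategory.hom_ext fun X =>
        (eq_of_heq (trans_app_eqToHom (closedFunctor_comp (K C) (K D) (K E) _ G.hom)
          (closedFunctor_comp (K C) (K D) (K E) _ G.hom).symm
          (ClosedCategory.wr (MultinatTrans.closedNatTrans (K C) (K D) r.hom)
            (Multifunctor.closedFunctor (K D) (K E) G.hom)) X)).symm }

end

/-! ### Equivalences of 2-categories in the strict sense -/

section

universe w₁ w₂ v₁ v₂ u₁ u₂

variable {A : Type u₁} [Bicategory.{w₁, v₁} A] [Bicategory.Strict A]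
  {B : Type u₂} [Bicategory.{w₂, v₂} B] [Bicategory.Strict B]

open Bicategory

/-- A natural isomorphism of strict 2-functors between strict 2-categories, in the sense of
categories enriched in the category of categories. -/
structure CatNatIso (F G : StrictPseudofunctor A B) where
  /-- The components, which are isomorphisms in the underlying category. -/
  app : ∀ X : A, F.obj X ≅ G.obj X
  naturality : ∀ {X Y : A} (f : X ⟶ Y), F.map f ≫ (app Y).hom = (app X).hom ≫ G.map f
  naturality₂ : ∀ {X Y : A} {f g : X ⟶ Y} (α : f ⟶ g),
    F.map₂ α ▷ (app Y).hom =
      eqToHom (naturality f) ≫ (app X).hom ◁ G.map₂ α ≫ eqToHom (naturality g).symm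

/-- A strict 2-functor is a `Cat`-equivalence if it has an inverse up to `Cat`-natural
isomorphisms. -/
def IsCatEquivalence (F : StrictPseudofunctor A B) : Prop :=
  ∃ G : StrictPseudofunctor B A,
    Nonempty (CatNatIso (StrictPseudofunctor.id A) (F.comp G)) ∧
      Nonempty (CatNatIso (G.comp F) (StrictPseudofunctor.id B))

end

end ClosedMulti

open ClosedMulti

namespace ClosedMulti

/-! ### Multifunctors and closed functors -/

/-! ### Composites expressed through currying -/

namespace Multicategory

variable {C : Multicategory.{v, u}}

/-! Morphisms of several arguments carry no information beyond the closed structure. Currying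
removes one argument, and a nullary morphism f factors uniquely as u·f̄ with f̄ unary. By induction
on the number of arguments, a multifunctor is therefore forced by its unary part, φ̂ and φ⁰
(`phi_map_comp_closing`, `ext_closing`), and the same induction derives multinaturality from closed
naturality (`naturality_of_closed`). Conversely, the forced recursion defines an extension of any
closed functor. What needs proof is that it preserves composition, and this reduces to inserting one
morphism into the first slot (`extend_pre_phi`): the axiom for i settles a nullary insertion, and
the axiom for L carries the induction step.

For surjectivity on objects, a closed category V must yield a multicategory although it has no
tensor product. A morphism X₁,…,Xₙ → Y is taken to be a morphism 1 → V(Xₙ,…V(X₁,Y)…). The functors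
V(Xₙ,…V(X₁,-)…) are enriched over V, by CC1 and CC3 for V(X,-), and the enriched Yoneda lemma
(`j_yonedaApp`, `eq_yonedaApp`) identifies such a morphism with an enriched transformation from
V(Y,-) to that functor. Its proof rests on CC2, CC4 and their consequence j_1 = i_1 (`j_unit`).
Composition of morphisms becomes pasting of transformations, so associativity is the interchange law
(`famApp_composites`). In this multicategory currying is the identity map, so it is closed for free,
and invertibility of i provides the unit object. CC5 identifies its unary morphisms with those of V,
and the remaining structure matches.

The passage to a `Cat`-equivalence is formal: for a strict 2-functor that is bijective on 1- and
2-morphisms and surjective on objects up to isomorphism, an inverse is obtained by conjugating with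
chosen isomorphisms and lifting uniquely. -/

theorem pre_comp₁_pre {Xs Ys : List C.Ob} {A B Z : C.Ob} (f : C.Hom Xs A) (g : C.Hom [A] B)
    (h : C.Hom (B :: Ys) Z) : pre (comp₁ f g) h = pre f (pre g h) := by
  refine (comp_cons_comp' _ _ _ _ _ (Us := [A] ++ Ys) rfl).trans ?_
  simp only [Fam.append, Fam.single]
  rfl

theorem comp_nil {Z : C.Ob} (g : C.Hom [] Z) : C.comp Fam.nil g = g := C.id_comp g

theorem comp_cons {Xs Ws Vs Ys : List C.Ob} {Y Z : C.Ob} (f : C.Hom Xs Y) (fs : Fam C.Hom Ws Ys)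
    (h : Vs = Xs ++ Ws) (g : C.Hom (Y :: Ys) Z) :
    C.comp (.cons f fs h) g = castDom h (C.comp (.cons f fs rfl) g) := by
  subst h
  rfl

namespace ClosedData

variable (K : C.ClosedData)

theorem pre_phi {Xs Ys : List C.Ob} {Y Z : C.Ob} (f : C.Hom Xs Y) (m : C.Hom Ys (K.h Y Z)) :
    C.comp (.cons f (.single m) rfl) (K.ev Y Z) = pre f (K.phi m) := by
  have := comp_cons_single_comp f (Fam.ids C.id Ys) m (K.ev Y Z) (Vs := Xs ++ Ys) rfl
    (Us := [Y] ++ Ys) rfl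
  rw [C.id_comp] at this
  exact this

/-- The first argument of φ(k) is used only by the evaluation, so f and fs can be plugged in
separately. This splits any composite into a shorter composite and a single insertion into the first
slot, which drives the inductions on sequences. -/
theorem comp_cons_phi {Xs Ws Ys : List C.Ob} {Y Z : C.Ob} (f : C.Hom Xs Y)
    (fs : Fam C.Hom Ws Ys) (k : C.Hom Ys (K.h Y Z)) :
    C.comp (.cons f fs rfl) (K.phi k) = pre f (K.phi (C.comp fs k)) := by
  rw [← pre_phi]
  exact (comp_cons_single_comp f fs k (K.ev Y Z) rfl rfl).symm

/-- By the defining property of L, m·L is the curried operation of composing with φ(m). The inserted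
morphism loses one argument, at the price of replacing m by m·L. -/
theorem pre_phi_phi {Xs Ys : List C.Ob} {X Y Z : C.Ob} (f : C.Hom Xs (K.h X Y))
    (m : C.Hom Ys (K.h Y Z)) :
    pre (K.phi f) (K.phi m) = K.phi (pre f (K.phi (comp₁ m (K.L X Y Z)))) :=
  (K.phi_pre f _ _ (K.phi_phi_comp_L m)).symm

/-- Inserting a nullary morphism deletes an argument. Here the deletion becomes postcomposition with
unary morphisms, which a closed functor can see. -/
theorem pre_bar_phi {Ys : List C.Ob} {Y Z : C.Ob} (f : C.Hom [K.unit.one] Y)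
    (m : C.Hom Ys (K.h Y Z)) :
    pre (comp₁ K.unit.u f) (K.phi m) = comp₁ m (comp₁ (K.homL f Z) (K.nullary Z)) := by
  rw [pre_comp₁_pre, ← phi_comp_homL, ← comp₁_assoc, comp_nullary]

theorem cur_phi {Ys : List C.Ob} {X Z : C.Ob} (f : C.Hom Ys (K.h X Z)) : K.cur (K.phi f) = f :=
  K.phi_inj (K.phi_cur _)

theorem cur_comp₁ {Xs : List C.Ob} {X Y Z : C.Ob} (f : C.Hom (X :: Xs) Y) (g : C.Hom [Y] Z) :
    K.cur (comp₁ f g) = comp₁ (K.cur f) (K.homR X g) :=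
  K.phi_inj (by rw [phi_cur, phi_comp_homR, phi_cur])

theorem bar_comp₁ {Y Z : C.Ob} (f : C.Hom [] Y) (g : C.Hom [Y] Z) :
    K.bar (comp₁ f g) = comp₁ (K.bar f) g :=
  K.u_cancel (by rw [u_bar, ← comp₁_assoc, u_bar])

theorem bar_u : K.bar K.unit.u = C.id K.unit.one :=
  K.u_cancel (by rw [u_bar, comp₁_id])

theorem homL_comp {X X' X'' : C.Ob} (f : C.Hom [X''] X') (g : C.Hom [X'] X) (Z : C.Ob) :
    K.homL (comp₁ f g) Z = comp₁ (K.homL g Z) (K.homL f Z) :=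
  K.phi_inj (by rw [phi_comp_homL, phi_homL, phi_homL, pre_comp₁_pre])

theorem phi_castDom {Ys Ys' : List C.Ob} {X Z : C.Ob} (h : Ys' = Ys) (f : C.Hom Ys (K.h X Z)) :
    K.phi (castDom h f) = castDom (congrArg (X :: ·) h) (K.phi f) := by
  subst h
  rfl

end ClosedData

end Multicategory

/-! ### Uniqueness of multifunctors and automatic multinaturality -/

open Multicategory

variable {C D : Multicategory.{v, u}} (KC : C.ClosedData) (KD : D.ClosedData)

namespace Multifunctor

/-- F preserves the composite (1,k)·ev, and F(ev) is φ of the closing transformation. This is the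
recursion that forces the value of F at φ(k) from its value at k, which has one argument fewer. -/
theorem phi_map_comp_closing (F : Multifunctor C D) {Ws : List C.Ob} {X Y : C.Ob}
    (k : C.Hom Ws (KC.h X Y)) :
    KD.phi (comp₁ (F.map k) (F.closing KC KD X Y)) = F.map (KC.phi k) := by
  rw [ClosedData.phi_comp₁, phi_closing]
  have h := F.map_comp (Fam.cons (C.id X) (Fam.single k) rfl) (KC.ev X Y)
  simp only [Fam.map, Fam.single, F.map_id] at h
  exact h.symm

/-- A multifunctor is determined by its restriction to unary morphisms, its closing
transformation and its value at `u`. -/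
theorem ext_closing {F G : Multifunctor C D} (ho : F.obj = G.obj)
    (hm : ∀ {X Y : C.Ob} (f : C.Hom [X] Y), HEq (F.map f) (G.map f))
    (hc : ∀ X Y : C.Ob, HEq (F.closing KC KD X Y) (G.closing KC KD X Y))
    (hu : HEq (F.unitComparison KC KD) (G.unitComparison KC KD)) : F = G := by
  refine ext' ho fun {Xs Y} f => ?_
  have hF := @phi_map_comp_closing _ _ KC KD F
  have hG := @phi_map_comp_closing _ _ KC KD G
  have hFu := F.u_unitComparison KC KD
  have hGu := G.u_unitComparison KC KD
  have hFc := @map_comp₁ _ _ F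
  have hGc := @map_comp₁ _ _ G
  -- The closings depend on the whole of F and G. Replaced by variables subject only to the
  -- identities just recorded, they no longer prevent identifying the object functions, after which
  -- the heterogeneous equalities become equalities.
  generalize F.closing KC KD = cF at *
  generalize G.closing KC KD = cG at *
  generalize F.unitComparison KC KD = zF at *
  generalize G.unitComparison KC KD = zG at *
  obtain ⟨o, m, _, _⟩ := F
  obtain ⟨o', m', _, _⟩ := G
  obtain rfl : o = o' := ho
  apply heq_of_eq
  simp only [heq_eq_eq] at *
  induction Xs generalizing Y with
  | nil =>
    rw [← KC.u_bar f]
    refine (hFc _ _).trans (Eq.trans ?_ (hGc _ _).symm)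
    rw [hm, ← hFu, ← hGu, hu]
  | cons X Xs ih =>
    obtain ⟨k, rfl⟩ := (KC.phi_bijective Xs X Y).2 f
    refine (hF k).symm.trans (Eq.trans ?_ (hG k))
    rw [ih, hc]

theorem closedFunctor_injective :
    Function.Injective (fun F : Multifunctor C D => F.closedFunctor KC KD) := by
  intro F G h
  -- The types of the components depend on the object function, so equality of closed functors is
  -- unpacked into heterogeneous equalities.
  have aux : ∀ {Φ Ψ : ClosedCategory.ClosedFunctor KC.closedCategory KD.closedCategory},
      Φ = Ψ → Φ.functor.obj = Ψ.functor.obj ∧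
        (∀ {X Y : KC.closedCategory.carrier} (f : X ⟶ Y),
          HEq (Φ.functor.map f) (Ψ.functor.map f)) ∧
        (∀ X Y, HEq (Φ.hat X Y) (Ψ.hat X Y)) ∧ HEq Φ.zero Ψ.zero := by
    rintro Φ _ rfl
    exact ⟨rfl, fun _ => HEq.rfl, fun _ _ => HEq.rfl, HEq.rfl⟩
  obtain ⟨h₁, h₂, h₃, h₄⟩ := aux h
  exact ext_closing KC KD h₁ (fun f => h₂ f) h₃ h₄

end Multifunctor

namespace MultinatTrans

variable {F G : Multifunctor C D}

/-- A closed natural transformation is natural with respect to all morphisms. -/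
theorem naturality_of_closed (r : ∀ X : C.Ob, D.Hom [F.obj X] (G.obj X))
    (hn : ∀ {X Y : C.Ob} (f : C.Hom [X] Y), comp₁ (F.map f) (r Y) = comp₁ (r X) (G.map f))
    (h₁ : comp₁ (F.unitComparison KC KD) (r KC.unit.one) = G.unitComparison KC KD)
    (h₂ : ∀ X Y : C.Ob, comp₁ (F.closing KC KD X Y) (KD.homR (F.obj X) (r Y)) =
      comp₁ (r (KC.h X Y)) (comp₁ (G.closing KC KD X Y) (KD.homL (r X) (G.obj Y))))
    {Xs : List C.Ob} {Y : C.Ob} (f : C.Hom Xs Y) :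
    comp₁ (F.map f) (r Y) = D.comp (Fam.components r Xs) (G.map f) := by
  induction Xs generalizing Y with
  | nil =>
    refine Eq.trans ?_ (comp_nil (C := D) (G.map f)).symm
    -- A nullary f is u·f̄, so naturality at the unary f̄ combines with the unit axiom `h₁`.
    rw [← KC.u_bar f]
    refine (congrArg (fun q => comp₁ q (r Y)) (map_comp₁ F KC.unit.u (KC.bar f))).trans ?_
    refine Eq.trans ?_ (map_comp₁ G KC.unit.u (KC.bar f)).symm
    rw [comp₁_assoc, hn, ← F.u_unitComparison KC KD, ← G.u_unitComparison KC KD, comp₁_assoc,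
      ← comp₁_assoc (F.unitComparison KC KD), h₁, comp₁_assoc]
  | cons X Xs ih =>
    obtain ⟨k, rfl⟩ := (KC.phi_bijective Xs X Y).2 f
    refine (congrArg (fun q => comp₁ q (r Y)) (F.phi_map_comp_closing KC KD k)).symm.trans ?_
    refine Eq.trans ?_ (congrArg (D.comp _) (G.phi_map_comp_closing KC KD k))
    -- The component at Y moves under φ, `h₂` passes from the closing of F to that of G, and the
    -- induction hypothesis applies to the curried k. The component at X is left as an insertion
    -- into the first slot.
    rw [← ClosedData.phi_comp_homR, comp₁_assoc, h₂, ← comp₁_assoc, ← comp₁_assoc,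
      ClosedData.phi_comp_homL, ih, comp_comp₁]
    exact (KD.comp_cons_phi (r X) _ _).symm

theorem closedNatTrans_bijective :
    Function.Bijective (fun r : MultinatTrans F G => r.closedNatTrans KC KD) := by
  constructor
  · intro r s h
    apply MultinatTrans.ext
    funext X
    exact congrArg (fun t => ClosedCategory.ClosedNatTrans.trans t |>.app X) h
  · intro t
    exact ⟨⟨fun X => t.trans.app X, fun f => naturality_of_closed KC KD (F := F) (G := G)
      (fun X => t.trans.app X) (fun f => t.trans.naturality f) t.cn1 t.cn2 f⟩,
      ClosedCategory.ClosedNatTrans.ext' rfl⟩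

end MultinatTrans

end ClosedMulti

/-! ### Extension of a closed functor to a multifunctor -/

namespace ClosedMulti

open Multicategory

/-- A closed functor between the underlying closed categories of closed multicategories,
expressed by means of unary morphisms. -/
structure UnaryClosedMap {C D : Multicategory.{v, u}} (KC : C.ClosedData)
    (KD : D.ClosedData) where
  /-- The function on objects. -/
  obj : C.Ob → D.Ob
  /-- The function on unary morphisms. -/
  map : ∀ {X Y : C.Ob}, C.Hom [X] Y → D.Hom [obj X] (obj Y)
  map_id : ∀ X : C.Ob, map (C.id X) = D.id (obj X)
  map_comp : ∀ {X Y Z : C.Ob} (f : C.Hom [X] Y) (g : C.Hom [Y] Z),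
    map (comp₁ f g) = comp₁ (map f) (map g)
  /-- The closing transformation. -/
  hat : ∀ X Y : C.Ob, D.Hom [obj (KC.h X Y)] (KD.h (obj X) (obj Y))
  hat_left : ∀ {X' X : C.Ob} (f : C.Hom [X'] X) (Y : C.Ob),
    comp₁ (map (KC.homL f Y)) (hat X' Y) = comp₁ (hat X Y) (KD.homL (map f) (obj Y))
  hat_right : ∀ (X : C.Ob) {Y Y' : C.Ob} (g : C.Hom [Y] Y'),
    comp₁ (map (KC.homR X g)) (hat X Y') = comp₁ (hat X Y) (KD.homR (obj X) (map g))
  /-- The comparison of the unit objects. -/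
  zero : D.Hom [KD.unit.one] (obj KC.unit.one)
  cf1 : ∀ X : C.Ob, comp₁ zero (comp₁ (map (KC.j X)) (hat X X)) = KD.j (obj X)
  cf2 : ∀ X : C.Ob,
    comp₁ (map (KC.i X)) (comp₁ (hat KC.unit.one X) (KD.homL zero (obj X))) = KD.i (obj X)
  cf3 : ∀ X Y Z : C.Ob,
    comp₁ (map (KC.L X Y Z)) (comp₁ (hat (KC.h X Y) (KC.h X Z))
        (KD.homR (obj (KC.h X Y)) (hat X Z))) =
      comp₁ (hat Y Z) (comp₁ (KD.L (obj X) (obj Y) (obj Z))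
        (KD.homL (hat X Y) (KD.h (obj X) (obj Z))))

namespace UnaryClosedMap

variable {C D : Multicategory.{v, u}} {KC : C.ClosedData} {KD : D.ClosedData}

/-- A closed functor as a map of unary morphisms. -/
def ofClosedFunctor (Φ : ClosedCategory.ClosedFunctor KC.closedCategory KD.closedCategory) :
    UnaryClosedMap KC KD where
  obj X := Φ.functor.obj X
  map f := Φ.functor.map f
  map_id X := Φ.functor.map_id X
  map_comp f g := Φ.functor.map_comp f g
  hat X Y := Φ.hat X Y
  hat_left f Y := Φ.hat_natural_left f Y
  hat_right X _ _ g := Φ.hat_natural_right X g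
  zero := Φ.zero
  cf1 X := Φ.cf1 X
  cf2 X := Φ.cf2 X
  cf3 X Y Z := Φ.cf3 X Y Z

variable (Φ : UnaryClosedMap KC KD)

/-- The extension to all morphisms. -/
noncomputable def extend : ∀ {Xs : List C.Ob} {Y : C.Ob}, C.Hom Xs Y →
    D.Hom (Xs.map Φ.obj) (Φ.obj Y)
  | [], _, f => comp₁ KD.unit.u (comp₁ Φ.zero (Φ.map (KC.bar f)))
  | X :: _, Y, f => KD.phi (comp₁ (extend (KC.cur f)) (Φ.hat X Y))

theorem extend_nil {Y : C.Ob} (f : C.Hom [] Y) :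
    Φ.extend f = comp₁ KD.unit.u (comp₁ Φ.zero (Φ.map (KC.bar f))) := rfl

theorem extend_cons {X : C.Ob} {Xs : List C.Ob} {Y : C.Ob} (f : C.Hom (X :: Xs) Y) :
    Φ.extend f = KD.phi (comp₁ (Φ.extend (KC.cur f)) (Φ.hat X Y)) := rfl

theorem extend_phi {X : C.Ob} {Xs : List C.Ob} {Y : C.Ob} (k : C.Hom Xs (KC.h X Y)) :
    Φ.extend (KC.phi k) = KD.phi (comp₁ (Φ.extend k) (Φ.hat X Y)) := by
  rw [extend_cons, ClosedData.cur_phi]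

/-- Currying turns postcomposition with g into postcomposition with C(X;g), and `hat_right` carries
this past the closing transformation. The targets vary because the induction replaces Y by C(X;Y).
-/
theorem extend_comp₁ {Xs : List C.Ob} {Y Z : C.Ob} (f : C.Hom Xs Y) (g : C.Hom [Y] Z) :
    Φ.extend (comp₁ f g) = comp₁ (Φ.extend f) (Φ.map g) := by
  induction Xs generalizing Y Z with
  | nil => rw [extend_nil, extend_nil, ClosedData.bar_comp₁, map_comp, comp₁_assoc, comp₁_assoc]
  | cons X Xs ih =>
    rw [extend_cons, extend_cons, ClosedData.cur_comp₁, ih, comp₁_assoc, hat_right,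
      ← comp₁_assoc, ClosedData.phi_comp_homR]

/-- The curried identity is the nullary morphism u·j_X, so this is `cf1` read through u. -/
theorem extend_id (X : C.Ob) : Φ.extend (C.id X) = D.id (Φ.obj X) := by
  rw [extend_cons, extend_nil, comp₁_assoc, comp₁_assoc]
  refine (congrArg (fun q => KD.phi (comp₁ KD.unit.u q)) (Φ.cf1 X)).trans ?_
  rw [ClosedData.u_j, ClosedData.phi_one]

theorem extend_unary {X Y : C.Ob} (f : C.Hom [X] Y) : Φ.extend f = Φ.map f := by
  have h := Φ.extend_comp₁ (C.id X) f
  rw [id_comp₁, extend_id] at h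
  exact h.trans (id_comp₁ _)

/-- This is `cf2` solved for the inverses of i: the one of C is applied in front and the one of D
behind. -/
theorem map_nullary (Z : C.Ob) :
    Φ.map (KC.nullary Z) =
      comp₁ (Φ.hat KC.unit.one Z) (comp₁ (KD.homL Φ.zero (Φ.obj Z)) (KD.nullary (Φ.obj Z))) := by
  have h := congrArg (fun q => comp₁ (Φ.map (KC.nullary Z)) (comp₁ q (KD.nullary (Φ.obj Z))))
    (Φ.cf2 Z)
  rw [ClosedData.i_nullary, comp₁_id, comp₁_assoc, ← comp₁_assoc (Φ.map (KC.nullary Z)),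
    ← map_comp, ClosedData.nullary_i, map_id, id_comp₁, comp₁_assoc] at h
  exact h.symm

/-- The heart of the extension, by induction on the arguments of f. A nullary insertion is unary
postcomposition by `pre_bar_phi`, and `map_nullary` and `hat_left` settle it. Otherwise
`pre_phi_phi` moves the insertion under one level of currying and replaces m by m·L; compatibility
of the closing transformation with L is `cf3`. -/
theorem extend_pre_phi {Xs Ws : List C.Ob} {Y Z : C.Ob} (f : C.Hom Xs Y)
    (m : C.Hom Ws (KC.h Y Z)) :
    Φ.extend (pre f (KC.phi m)) = castDom List.map_append
      (pre (Φ.extend f) (KD.phi (comp₁ (Φ.extend m) (Φ.hat Y Z)))) := by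
  induction Xs generalizing Y Z with
  | nil =>
    rw [← KC.u_bar f, ClosedData.pre_bar_phi]
    refine (Φ.extend_comp₁ m _).trans ?_
    rw [extend_nil, ClosedData.bar_comp₁, ClosedData.bar_u, id_comp₁]
    refine Eq.trans ?_ (KD.pre_bar_phi _ _).symm
    rw [map_comp, map_nullary, ClosedData.homL_comp, ← comp₁_assoc (Φ.map _), hat_left]
    simp only [comp₁_assoc]
  | cons X Xs ih =>
    obtain ⟨f, rfl⟩ := (KC.phi_bijective Xs X Y).2 f
    rw [ClosedData.pre_phi_phi, extend_phi, ih, extend_phi, extend_comp₁,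
      MultinatTrans.comp₁_castDom, ClosedData.phi_castDom]
    refine congrArg (castDom _) ?_
    refine Eq.trans ?_ (KD.pre_phi_phi _ _).symm
    -- The closing applied after the insertion enters φ through `homR`, and the one applied to the
    -- inserted morphism enters through `homL`. These are the two sides of `cf3`.
    rw [pre_comp₁, ← ClosedData.phi_comp_homR, pre_comp₁_pre, ← ClosedData.phi_comp_homL,
      comp₁_assoc, comp₁_assoc, cf3, comp₁_assoc, comp₁_assoc]

/-- Induction on the sequence: `comp_cons_phi` leaves a shorter composite and one insertion, to
which `extend_pre_phi` applies. -/
theorem extend_comp {Ws Xs : List C.Ob} {Y : C.Ob} (fs : Fam C.Hom Ws Xs) (g : C.Hom Xs Y) :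
    Φ.extend (C.comp fs g) = D.comp (fs.map Φ.obj Φ.extend) (Φ.extend g) := by
  induction fs generalizing Y with
  | nil => exact (congrArg Φ.extend (comp_nil g)).trans (comp_nil (C := D) _).symm
  | @cons _ _ _ Ys Z f fs h ih =>
    subst h
    obtain ⟨k, rfl⟩ := (KC.phi_bijective Ys Z Y).2 g
    rw [ClosedData.comp_cons_phi, extend_pre_phi, extend_phi, ih, comp_comp₁]
    refine Eq.trans ?_ (comp_cons _ _ _ _).symm
    exact congrArg (castDom _) (KD.comp_cons_phi _ _ _).symm

/-- The multifunctor that extends a closed functor. -/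
noncomputable def multifunctor : Multifunctor C D where
  obj := Φ.obj
  map := Φ.extend
  map_comp := Φ.extend_comp
  map_id := Φ.extend_id

end UnaryClosedMap

variable {C D : Multicategory.{v, u}} (KC : C.ClosedData) (KD : D.ClosedData)

theorem Multifunctor.closedFunctor_bijective :
    Function.Bijective (fun F : Multifunctor C D => F.closedFunctor KC KD) := by
  refine ⟨Multifunctor.closedFunctor_injective KC KD, fun Φ => ?_⟩
  let Ψ := UnaryClosedMap.ofClosedFunctor Φ
  refine ⟨Ψ.multifunctor, ClosedCategory.ClosedFunctor.ext' ?_ (fun X Y => heq_of_eq ?_)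
    (heq_of_eq ?_)⟩
  · exact CategoryTheory.Functor.hext (fun _ => rfl) fun X Y f => heq_of_eq (Ψ.extend_unary f)
  -- The evaluation is φ(1), so its extension is φ of the given `hat`, which is what defines the
  -- closing.
  · apply KD.phi_inj
    refine (Ψ.multifunctor.phi_closing KC KD X Y).trans ?_
    refine (congrArg Ψ.extend (KC.phi_id X Y)).symm.trans ?_
    refine (Ψ.extend_phi (C.id (KC.h X Y))).trans ?_
    rw [Ψ.extend_id, id_comp₁]
    rfl
  -- The unary morphism corresponding to u is the identity, so u is sent to u·`zero`.
  · apply KD.u_cancel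
    refine (Ψ.multifunctor.u_unitComparison KC KD).trans ?_
    refine (Ψ.extend_nil KC.unit.u).trans ?_
    rw [ClosedData.bar_u, Ψ.map_id, comp₁_id]
    rfl

end ClosedMulti

namespace ClosedMulti

/-! ### A criterion for `Cat`-equivalences -/

section

universe w₁ w₂ v₁ v₂ u₁ u₂

open Bicategory

/-- In strict bicategories, and for strict 2-functors, all structural isomorphisms are given by
`eqToHom`. Up to heterogeneous equality they disappear, and the laws take the form they have in a
strict 2-category. -/
theorem heq_eqToHom_conj {C : Type*} [Category C] {a b c d : C} (h : a = b) (k : c = d)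
    (f : b ⟶ c) : HEq (eqToHom h ≫ f ≫ eqToHom k) f := by
  subst h k
  simp

theorem eq_eqToHom_conj {C : Type*} [Category C] {a b c d : C} (h : a = b) (k : c = d)
    {f : a ⟶ d} {g : b ⟶ c} (e : HEq f g) : f = eqToHom h ≫ g ≫ eqToHom k := by
  subst h k
  simpa using e

theorem comp_heq_comp {C : Type*} [Category C] {a b c a' b' c' : C} (ha : a = a') (hb : b = b')
    (hc : c = c') {f : a ⟶ b} {g : b ⟶ c} {f' : a' ⟶ b'} {g' : b' ⟶ c'} (hf : HEq f f')
    (hg : HEq g g') : HEq (f ≫ g) (f' ≫ g') := by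
  subst ha hb hc hf hg
  rfl

theorem id_heq_id {C : Type*} [Category C] {a b : C} (h : a = b) : HEq (𝟙 a) (𝟙 b) := by
  subst h
  rfl

section Strict

variable {B : Type u₂} [Bicategory.{w₂, v₂} B]

theorem whiskerLeft_heq_whiskerLeft {a b c : B} {f f' : a ⟶ b} {g g' h h' : b ⟶ c}
    (hf : f = f') (hg : g = g') (hh : h = h') {η : g ⟶ h} {θ : g' ⟶ h'} (e : HEq η θ) :
    HEq (f ◁ η) (f' ◁ θ) := by
  subst hf hg hh e
  rfl

theorem whiskerRight_heq_whiskerRight {a b c : B} {f f' : b ⟶ c} {g g' h h' : a ⟶ b}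
    (hf : f = f') (hg : g = g') (hh : h = h') {η : g ⟶ h} {θ : g' ⟶ h'} (e : HEq η θ) :
    HEq (η ▷ f) (θ ▷ f') := by
  subst hf hg hh e
  rfl

variable [Bicategory.Strict B]

theorem id_whiskerLeft_heq {a b : B} {f g : a ⟶ b} (η : f ⟶ g) : HEq (𝟙 a ◁ η) η := by
  rw [id_whiskerLeft, Strict.leftUnitor_eqToIso, Strict.leftUnitor_eqToIso]
  simp only [eqToIso.hom, eqToIso.inv]
  exact heq_eqToHom_conj _ _ _

theorem whiskerRight_id_heq {a b : B} {f g : a ⟶ b} (η : f ⟶ g) : HEq (η ▷ 𝟙 b) η := by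
  rw [whiskerRight_id, Strict.rightUnitor_eqToIso, Strict.rightUnitor_eqToIso]
  simp only [eqToIso.hom, eqToIso.inv]
  exact heq_eqToHom_conj _ _ _

theorem comp_whiskerLeft_heq {a b c d : B} (f : a ⟶ b) (g : b ⟶ c) {h h' : c ⟶ d}
    (η : h ⟶ h') : HEq ((f ≫ g) ◁ η) (f ◁ g ◁ η) := by
  rw [comp_whiskerLeft, Strict.associator_eqToIso, Strict.associator_eqToIso]
  simp only [eqToIso.hom, eqToIso.inv]
  exact heq_eqToHom_conj _ _ _

theorem whiskerRight_comp_heq {a b c d : B} {f f' : a ⟶ b} (η : f ⟶ f') (g : b ⟶ c)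
    (h : c ⟶ d) : HEq (η ▷ (g ≫ h)) ((η ▷ g) ▷ h) := by
  rw [whiskerRight_comp, Strict.associator_eqToIso, Strict.associator_eqToIso]
  simp only [eqToIso.hom, eqToIso.inv]
  exact heq_eqToHom_conj _ _ _

theorem whisker_assoc_heq {a b c d : B} (f : a ⟶ b) {g g' : b ⟶ c} (η : g ⟶ g')
    (h : c ⟶ d) : HEq ((f ◁ η) ▷ h) (f ◁ η ▷ h) := by
  rw [whisker_assoc, Strict.associator_eqToIso, Strict.associator_eqToIso]
  simp only [eqToIso.hom, eqToIso.inv]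
  exact heq_eqToHom_conj _ _ _

end Strict

variable {A : Type u₁} [Bicategory.{w₁, v₁} A] {B : Type u₂} [Bicategory.{w₂, v₂} B]

section

variable (F : StrictPseudofunctor A B)

theorem map₂_whiskerLeft_heq {a b c : A} (f : a ⟶ b) {g h : b ⟶ c} (η : g ⟶ h) :
    HEq (F.map₂ (f ◁ η)) (F.map f ◁ F.map₂ η) := by
  rw [F.map₂_whisker_left, F.mapComp_eq_eqToIso, F.mapComp_eq_eqToIso]
  simp only [eqToIso.hom, eqToIso.inv]
  exact heq_eqToHom_conj _ _ _

theorem map₂_whiskerRight_heq {a b c : A} {f g : a ⟶ b} (η : f ⟶ g) (h : b ⟶ c) :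
    HEq (F.map₂ (η ▷ h)) (F.map₂ η ▷ F.map h) := by
  rw [F.map₂_whisker_right, F.mapComp_eq_eqToIso, F.mapComp_eq_eqToIso]
  simp only [eqToIso.hom, eqToIso.inv]
  exact heq_eqToHom_conj _ _ _

/-- The images of x and y are p and q only up to propositional equality, so a lift of β can be
compared with β only heterogeneously. -/
theorem exists_map₂_heq (h₂ : ∀ {a b : A} (f g : a ⟶ b),
      Function.Bijective (fun r : f ⟶ g => F.map₂ r))
    {a b : A} {x y : a ⟶ b} {p q : F.obj a ⟶ F.obj b} (hx : F.map x = p) (hy : F.map y = q)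
    (β : p ⟶ q) : ∃ γ : x ⟶ y, HEq (F.map₂ γ) β := by
  subst hx hy
  obtain ⟨γ, h⟩ := (h₂ x y).2 β
  exact ⟨γ, heq_of_eq h⟩

theorem heq_of_map₂_heq (h₂ : ∀ {a b : A} (f g : a ⟶ b),
      Function.Bijective (fun r : f ⟶ g => F.map₂ r))
    {a b : A} {x y x' y' : a ⟶ b} (hx : x = x') (hy : y = y') {γ : x ⟶ y} {γ' : x' ⟶ y'}
    (e : HEq (F.map₂ γ) (F.map₂ γ')) : HEq γ γ' := by
  subst hx hy
  exact heq_of_eq ((h₂ x y).1 (eq_of_heq e))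

end

variable [Bicategory.Strict A] [Bicategory.Strict B]

/-- Seen through F, the 2-functor G is conjugation by e, so e is itself the natural isomorphism from
F∘G to the identity. The other one is the lift of e⁻¹ at the objects F(a); its naturality is
reflected by F. -/
theorem IsCatEquivalence.of_conjugation (F : StrictPseudofunctor A B)
    (h₁ : ∀ a b : A, Function.Bijective (fun f : a ⟶ b => F.map f))
    (h₂ : ∀ {a b : A} (f g : a ⟶ b), Function.Bijective (fun r : f ⟶ g => F.map₂ r))
    (G : StrictPseudofunctor B A) (e : ∀ b : B, F.obj (G.obj b) ≅ b)
    (hG : ∀ {b c : B} (f : b ⟶ c), F.map (G.map f) = (e b).hom ≫ f ≫ (e c).inv)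
    (hG₂ : ∀ {b c : B} {f g : b ⟶ c} (α : f ⟶ g),
      HEq (F.map₂ (G.map₂ α)) ((e b).hom ◁ (α ▷ (e c).inv))) : IsCatEquivalence F := by
  have h₁' : ∀ {a b : A} {f g : a ⟶ b}, F.map f = F.map g → f = g := fun h => (h₁ _ _).1 h
  have lift : ∀ a : A, ∃ p : (a ⟶ G.obj (F.obj a)) × (G.obj (F.obj a) ⟶ a),
      F.map p.1 = (e (F.obj a)).inv ∧ F.map p.2 = (e (F.obj a)).hom := fun a => by
    obtain ⟨x, hx⟩ := (h₁ _ _).2 (e (F.obj a)).inv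
    obtain ⟨y, hy⟩ := (h₁ _ _).2 (e (F.obj a)).hom
    exact ⟨⟨x, y⟩, hx, hy⟩
  choose p hp₁ hp₂ using lift
  let η : ∀ a : A, a ≅ G.obj (F.obj a) := fun a =>
    { hom := (p a).1
      inv := (p a).2
      hom_inv_id := h₁' (by rw [F.map_comp, hp₁, hp₂, F.map_id]; exact (e _).inv_hom_id)
      inv_hom_id := h₁' (by rw [F.map_comp, hp₁, hp₂, F.map_id]; exact (e _).hom_inv_id) }
  have nat : ∀ {a b : A} (f : a ⟶ b), f ≫ (η b).hom = (η a).hom ≫ G.map (F.map f) := by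
    intro a b f
    apply h₁'
    rw [F.map_comp, F.map_comp, hG, hp₁, hp₁, Iso.inv_hom_id_assoc]
  have nat' : ∀ {b c : B} (f : b ⟶ c), F.map (G.map f) ≫ (e c).hom = (e b).hom ≫ f := by
    intro b c f
    rw [hG, Category.assoc, Category.assoc, Iso.inv_hom_id, Category.comp_id]
  have nat₂ : ∀ {a b : A} {f g : a ⟶ b} (α : f ⟶ g),
      HEq (α ▷ (η b).hom) ((η a).hom ◁ G.map₂ (F.map₂ α)) := by
    intro a b f g α
    refine heq_of_map₂_heq F h₂ (nat f) (nat g) ?_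
    refine (map₂_whiskerRight_heq F _ _).trans ?_
    refine HEq.trans ?_ (map₂_whiskerLeft_heq F _ _).symm
    refine HEq.trans ?_ (whiskerLeft_heq_whiskerLeft (hp₁ _) (hG _) (hG _)
      (hG₂ (F.map₂ α))).symm
    -- The two left whiskerings merge into one with e⁻¹·e, which is an identity.
    refine HEq.trans ?_ (comp_whiskerLeft_heq _ _ _)
    refine (whiskerRight_heq_whiskerRight (hp₁ _) rfl rfl HEq.rfl).trans ?_
    refine (id_whiskerLeft_heq _).symm.trans ?_
    exact whiskerLeft_heq_whiskerLeft (Iso.inv_hom_id _).symm rfl rfl HEq.rfl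
  have nat₂' : ∀ {b c : B} {f g : b ⟶ c} (α : f ⟶ g),
      HEq (F.map₂ (G.map₂ α) ▷ (e c).hom) ((e b).hom ◁ α) := by
    intro b c f g α
    have hc : ∀ f : b ⟶ c, (f ≫ (e c).inv) ≫ (e c).hom = f := fun f => by
      rw [Category.assoc, Iso.inv_hom_id, Category.comp_id]
    refine (whiskerRight_heq_whiskerRight rfl (hG _) (hG _) (hG₂ α)).trans ?_
    refine (whisker_assoc_heq _ _ _).trans ?_
    refine whiskerLeft_heq_whiskerLeft rfl (hc f) (hc g) ?_
    refine (whiskerRight_comp_heq _ _ _).symm.trans ?_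
    refine (whiskerRight_heq_whiskerRight (Iso.inv_hom_id _) rfl rfl HEq.rfl).trans ?_
    exact whiskerRight_id_heq α
  exact ⟨G, ⟨⟨η, nat, fun α => eq_eqToHom_conj _ _ (nat₂ α)⟩⟩,
    ⟨⟨e, nat', fun α => eq_eqToHom_conj _ _ (nat₂' α)⟩⟩⟩

/-- A strict 2-functor that is bijective on 1-morphisms and on 2-morphisms and that is
surjective on objects up to isomorphism is a `Cat`-equivalence. -/
theorem IsCatEquivalence.of_bijective (F : StrictPseudofunctor A B)
    (h₁ : ∀ a b : A, Function.Bijective (fun f : a ⟶ b => F.map f))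
    (h₂ : ∀ {a b : A} (f g : a ⟶ b), Function.Bijective (fun r : f ⟶ g => F.map₂ r))
    (h₀ : ∀ b : B, ∃ a : A, Nonempty (F.obj a ≅ b)) : IsCatEquivalence F := by
  choose o e using h₀
  replace e := fun b => (e b).some
  -- The inverse 2-functor sends a morphism to the lift of its conjugate by e. Conjugation respects
  -- all the operations, and injectivity of F transfers each law to the lifts.
  choose lift hlift using fun {a a'} => (h₁ a a').2
  simp only at hlift
  have h₁' : ∀ {a b : A} {f g : a ⟶ b}, F.map f = F.map g → f = g := fun h => (h₁ _ _).1 h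
  choose lift₂ hlift₂ using fun {b c : B} (f g : b ⟶ c) (α : f ⟶ g) =>
    exists_map₂_heq F h₂ (hlift ((e b).hom ≫ f ≫ (e c).inv))
      (hlift ((e b).hom ≫ g ≫ (e c).inv)) ((e b).hom ◁ (α ▷ (e c).inv))
  have mid : ∀ b : B, lift ((e b).hom ≫ 𝟙 b ≫ (e b).inv) = 𝟙 (o b) := fun b => h₁' (by
    rw [hlift, F.map_id, Category.id_comp, Iso.hom_inv_id])
  have mcomp : ∀ {b c d : B} (f : b ⟶ c) (g : c ⟶ d),
      lift ((e b).hom ≫ (f ≫ g) ≫ (e d).inv) =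
        lift ((e b).hom ≫ f ≫ (e c).inv) ≫ lift ((e c).hom ≫ g ≫ (e d).inv) :=
    fun f g => h₁' (by rw [hlift, F.map_comp, hlift, hlift]; simp)
  let G : StrictPseudofunctor B A := StrictPseudofunctor.mk''
    { obj := o
      map := fun {b c} f => lift ((e b).hom ≫ f ≫ (e c).inv)
      map₂ := fun α => lift₂ _ _ α
      map₂_id := fun {b c} f => by
        apply eq_of_heq
        refine heq_of_map₂_heq F h₂ rfl rfl ((hlift₂ _ _ _).trans ?_)
        rw [F.map₂_id, id_whiskerRight, whiskerLeft_id]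
        exact id_heq_id (hlift _).symm
      map₂_comp := fun {b c f g h} η θ => by
        apply eq_of_heq
        refine heq_of_map₂_heq F h₂ rfl rfl ((hlift₂ _ _ _).trans ?_)
        rw [F.map₂_comp, comp_whiskerRight, whiskerLeft_comp]
        exact (comp_heq_comp (hlift _) (hlift _) (hlift _) (hlift₂ _ _ η) (hlift₂ _ _ θ)).symm
      map_id := mid
      map_comp := mcomp
      map₂_whisker_left := fun {b c d} f {g g'} η => by
        apply eq_eqToHom_conj
        refine heq_of_map₂_heq F h₂ (mcomp _ _) (mcomp _ _) ((hlift₂ _ _ _).trans ?_)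
        refine HEq.trans ?_ (map₂_whiskerLeft_heq F _ _).symm
        refine HEq.trans ?_
          (whiskerLeft_heq_whiskerLeft (hlift _) (hlift _) (hlift _) (hlift₂ _ _ η)).symm
        refine HEq.trans ?_ (comp_whiskerLeft_heq _ _ _)
        refine (whiskerLeft_heq_whiskerLeft rfl (Category.assoc _ _ _) (Category.assoc _ _ _)
          (whisker_assoc_heq _ _ _)).trans ?_
        refine (comp_whiskerLeft_heq _ _ _).symm.trans ?_
        -- The factor e⁻¹·e at the middle object cancels.
        exact whiskerLeft_heq_whiskerLeft (by simp) rfl rfl HEq.rfl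
      map₂_whisker_right := fun {b c d f f'} η g => by
        apply eq_eqToHom_conj
        refine heq_of_map₂_heq F h₂ (mcomp _ _) (mcomp _ _) ((hlift₂ _ _ _).trans ?_)
        refine HEq.trans ?_ (map₂_whiskerRight_heq F _ _).symm
        refine HEq.trans ?_
          (whiskerRight_heq_whiskerRight (hlift _) (hlift _) (hlift _) (hlift₂ _ _ η)).symm
        refine HEq.trans ?_ (whisker_assoc_heq _ _ _).symm
        refine whiskerLeft_heq_whiskerLeft rfl (by simp) (by simp) ?_
        refine HEq.trans ?_ (whiskerRight_comp_heq _ _ _)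
        refine (whiskerRight_comp_heq _ _ _).symm.trans ?_
        exact whiskerRight_heq_whiskerRight (by simp) rfl rfl HEq.rfl }
  exact .of_conjugation F h₁ h₂ G e (fun f => hlift _) (fun α => hlift₂ _ _ α)

end

end ClosedMulti

namespace ClosedMulti

/-! ### Functors enriched over a closed category -/

namespace ClosedCategory

variable (V : ClosedCategory.{v, u})

/-- Naturality of i at the morphism i_X, with the invertible i_X cancelled. -/
theorem hr_i (X : V.carrier) : hr V.hom V.unit (V.i X).hom = (V.i (hobj V.hom V.unit X)).hom := by
  rw [← cancel_epi (V.i X).hom, ← V.i_natural]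

/-- CC2 and CC4 together with `hr_i` give L·V(j_1,1) = i = L·V(i_1,1) for L = L^1_{1Z}, and CC4
makes this L invertible. Hence V(j_1,1) = V(i_1,1) on V(1,Z). For Z = 1, dinaturality of j turns
this into j_1·V(1,j_1) = j_1·V(1,i_1), and CC5 is injective. -/
theorem j_unit : V.j V.unit = (V.i V.unit).hom := by
  have hinv : ∀ Y : V.carrier, hl V.hom (V.i Y).inv (hobj V.hom V.unit Y) ≫
      hl V.hom (V.i Y).hom (hobj V.hom V.unit Y) = 𝟙 _ := fun Y => by
    rw [← hl_comp, Iso.hom_inv_id, hl_id]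
  have hinv' : ∀ W : V.carrier, hl V.hom (V.i V.unit).hom W ≫
      hl V.hom (V.i V.unit).inv W = 𝟙 _ := fun W => by
    rw [← hl_comp, Iso.inv_hom_id, hl_id]
  have h₁ : ∀ Z : V.carrier, V.L V.unit V.unit Z =
      (V.i (hobj V.hom V.unit Z)).hom ≫
        hl V.hom (V.i V.unit).inv (hobj V.hom V.unit Z) := fun Z => by
    have := V.cc4 V.unit Z
    rw [hr_i] at this
    rw [← this, Category.assoc, hinv', Category.comp_id]
  have h₂ : ∀ Z : V.carrier, hl V.hom (V.j V.unit) (hobj V.hom V.unit Z) =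
      hl V.hom (V.i V.unit).hom (hobj V.hom V.unit Z) := fun Z => by
    have := V.cc2 V.unit Z
    rw [h₁, Category.assoc] at this
    have h := (cancel_epi (V.i (hobj V.hom V.unit Z)).hom).1
      (this.trans (Category.comp_id _).symm)
    have h' := congrArg (fun q => hl V.hom (V.i V.unit).hom (hobj V.hom V.unit Z) ≫ q) h
    simp only [Category.comp_id] at h'
    rw [← Category.assoc, hinv', Category.id_comp] at h'
    exact h'
  apply (V.cc5 V.unit (hobj V.hom V.unit V.unit)).1
  simp only [V.j_dinatural, h₂]

/-- A functor enriched over the closed category `V` from `V` to itself. -/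
structure EndoFunctor where
  /-- The underlying functor. -/
  functor : V.carrier ⥤ V.carrier
  /-- The action on internal Hom-objects. -/
  st : ∀ X Y : V.carrier,
    hobj V.hom X Y ⟶ hobj V.hom (functor.obj X) (functor.obj Y)
  st_left : ∀ {X' X : V.carrier} (f : X' ⟶ X) (Y : V.carrier),
    hl V.hom f Y ≫ st X' Y = st X Y ≫ hl V.hom (functor.map f) (functor.obj Y)
  st_right : ∀ (X : V.carrier) {Y Y' : V.carrier} (g : Y ⟶ Y'),
    hr V.hom X g ≫ st X Y' = st X Y ≫ hr V.hom (functor.obj X) (functor.map g)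
  j_st : ∀ X : V.carrier, V.j X ≫ st X X = V.j (functor.obj X)
  L_st : ∀ X Y Z : V.carrier,
    V.L X Y Z ≫ hr V.hom (hobj V.hom X Y) (st X Z) =
      st Y Z ≫ V.L (functor.obj X) (functor.obj Y) (functor.obj Z) ≫
        hl V.hom (st X Y) (hobj V.hom (functor.obj X) (functor.obj Z))

namespace EndoFunctor

variable {V}

theorem ext' {F G : EndoFunctor V} (h : F.functor = G.functor)
    (h' : ∀ X Y, HEq (F.st X Y) (G.st X Y)) : F = G := by
  obtain ⟨f, a, _, _, _, _⟩ := F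
  obtain ⟨g, b, _, _, _, _⟩ := G
  obtain rfl : f = g := h
  obtain rfl : a = b := by
    funext X Y
    exact eq_of_heq (h' X Y)
  rfl

variable (V) in
/-- The identity functor. -/
def id : EndoFunctor V where
  functor := 𝟭 V.carrier
  st X Y := 𝟙 (hobj V.hom X Y)
  st_left f Y := by simp
  st_right X _ _ g := by simp
  j_st X := by simp
  L_st X Y Z := by simp [hl_id, hr_id]

/-- The composite of functors. -/
def comp (F G : EndoFunctor V) : EndoFunctor V where
  functor := F.functor ⋙ G.functor
  st X Y := F.st X Y ≫ G.st (F.functor.obj X) (F.functor.obj Y)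
  st_left f Y := by
    rw [← Category.assoc, F.st_left, Category.assoc, G.st_left, Category.assoc]
    rfl
  st_right X _ _ g := by
    rw [← Category.assoc, F.st_right, Category.assoc, G.st_right, Category.assoc]
    rfl
  j_st X := by
    rw [← Category.assoc, F.j_st, G.j_st]
    rfl
  L_st X Y Z := by
    have h := F.L_st X Y Z
    have h' := G.L_st (F.functor.obj X) (F.functor.obj Y) (F.functor.obj Z)
    rw [hr_comp, hl_comp, reassoc_of% h, ← hr_hl, reassoc_of% h', Category.assoc]
    rfl

theorem id_comp (F : EndoFunctor V) : (id V).comp F = F :=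
  ext' rfl fun X Y => heq_of_eq (Category.id_comp (F.st X Y))

theorem assoc (F G K : EndoFunctor V) : (F.comp G).comp K = F.comp (G.comp K) :=
  ext' rfl fun X Y => heq_of_eq (Category.assoc (F.st X Y) _ _)

/-- The functor `V(X,-)`. -/
def ihom (X : V.carrier) : EndoFunctor V where
  functor := V.hom.obj (Opposite.op X)
  st Y Z := V.L X Y Z
  st_left f Z := V.L_natural_left X f Z
  st_right Y _ _ g := V.L_natural_right X Y g
  -- CC1 and CC3 say precisely that V(X,-) preserves enriched identities and composition.
  j_st Y := V.cc1 X Y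
  L_st Y U W := V.cc3 X Y U W

/-- Enriched naturality of a natural transformation. -/
def IsNatural (F G : EndoFunctor V) (α : F.functor ⟶ G.functor) : Prop :=
  ∀ X Y : V.carrier, F.st X Y ≫ hr V.hom (F.functor.obj X) (α.app Y) =
    G.st X Y ≫ hl V.hom (α.app X) (G.functor.obj Y)

theorem IsNatural.id (F : EndoFunctor V) : IsNatural F F (𝟙 F.functor) := fun X Y => by
  simp [hl_id, hr_id]

theorem IsNatural.eqToHom {F G : EndoFunctor V} (h : F = G) :
    IsNatural F G (CategoryTheory.eqToHom (congrArg functor h)) := by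
  subst h
  exact IsNatural.id F

theorem IsNatural.comp {F G K : EndoFunctor V} {α : F.functor ⟶ G.functor}
    {β : G.functor ⟶ K.functor} (hα : IsNatural F G α) (hβ : IsNatural G K β) :
    IsNatural F K (α ≫ β) := fun X Y => by
  have h := hα X Y
  have h' := hβ X Y
  rw [NatTrans.comp_app, NatTrans.comp_app, hr_comp, hl_comp, reassoc_of% h, ← hr_hl,
    reassoc_of% h']

theorem IsNatural.whiskerLeft (F : EndoFunctor V) {G K : EndoFunctor V}
    {α : G.functor ⟶ K.functor} (hα : IsNatural G K α) :
    IsNatural (F.comp G) (F.comp K) (Functor.whiskerLeft F.functor α) := fun X Y => by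
  have h := hα (F.functor.obj X) (F.functor.obj Y)
  refine (Category.assoc _ _ _).trans (Eq.trans ?_ (Category.assoc _ _ _).symm)
  exact congrArg (fun q => F.st X Y ≫ q) h

theorem IsNatural.whiskerRight {F G : EndoFunctor V} {α : F.functor ⟶ G.functor}
    (hα : IsNatural F G α) (K : EndoFunctor V) :
    IsNatural (F.comp K) (G.comp K) (Functor.whiskerRight α K.functor) := fun X Y => by
  have h := hα X Y
  refine (Category.assoc _ _ _).trans (Eq.trans ?_ (Category.assoc _ _ _).symm)
  refine (congrArg (fun q => F.st X Y ≫ q) (K.st_right _ (α.app Y)).symm).trans ?_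
  refine Eq.trans ?_ (congrArg (fun q => G.st X Y ≫ q) (K.st_left (α.app X) _))
  rw [reassoc_of% h]

/-- Enriched naturality of i⁻¹ from V(1,-) to the identity functor: CC4 with both isomorphisms moved
across. -/
theorem L_unit (Y Z : V.carrier) :
    V.L V.unit Y Z ≫ hr V.hom (hobj V.hom V.unit Y) (V.i Z).inv =
      hl V.hom (V.i Y).inv Z := by
  have h := V.cc4 Y Z
  have h₁ : hr V.hom Y (V.i Z).hom ≫ hr V.hom Y (V.i Z).inv = 𝟙 _ := by
    rw [← hr_comp, Iso.hom_inv_id, hr_id]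
  have h₂ : hl V.hom (V.i Y).hom Z ≫ hl V.hom (V.i Y).inv Z = 𝟙 _ := by
    rw [← hl_comp, Iso.inv_hom_id, hl_id]
  rw [← Category.comp_id (V.L V.unit Y Z ≫ _), ← h₂, Category.assoc,
    ← Category.assoc (hr _ _ _), hr_hl, Category.assoc, reassoc_of% h, reassoc_of% h₁]

/-- The component `V(Y,Z) → FZ` that corresponds to `f : 1 → FY`. -/
def yonedaApp (F : EndoFunctor V) {Y : V.carrier} (f : V.unit ⟶ F.functor.obj Y)
    (Z : V.carrier) : hobj V.hom Y Z ⟶ F.functor.obj Z :=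
  F.st Y Z ≫ hl V.hom f (F.functor.obj Z) ≫ (V.i (F.functor.obj Z)).inv

theorem yonedaApp_naturality (F : EndoFunctor V) {Y : V.carrier} (f : V.unit ⟶ F.functor.obj Y)
    {Z Z' : V.carrier} (g : Z ⟶ Z') :
    hr V.hom Y g ≫ F.yonedaApp f Z' = F.yonedaApp f Z ≫ F.functor.map g := by
  have h := F.st_right Y g
  rw [yonedaApp, yonedaApp, reassoc_of% h, ← Category.assoc (hr _ _ _), hr_hl, Category.assoc,
    Category.assoc, Category.assoc]
  congr 2
  rw [Iso.comp_inv_eq, Category.assoc, V.i_natural, Iso.inv_hom_id_assoc]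

/-- Each factor of `yonedaApp` is enriched natural: the action of F by `L_st`, V(f,-) by
dinaturality of L, and i⁻¹ by `L_unit`. -/
theorem L_yonedaApp (F : EndoFunctor V) {Y : V.carrier} (f : V.unit ⟶ F.functor.obj Y)
    (Z W : V.carrier) :
    V.L Y Z W ≫ hr V.hom (hobj V.hom Y Z) (F.yonedaApp f W) =
      F.st Z W ≫ hl V.hom (F.yonedaApp f Z) (F.functor.obj W) := by
  have h₁ := F.L_st Y Z W
  have h₂ := V.L_dinatural f (F.functor.obj Z) (F.functor.obj W)
  rw [yonedaApp, yonedaApp, hr_comp, hr_comp, hl_comp, hl_comp, reassoc_of% h₁,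
    ← Category.assoc (hl V.hom (F.st Y Z) _), ← hr_hl, Category.assoc, ← hr_hl,
    reassoc_of% h₂, ← Category.assoc (hl V.hom (hl _ _ _) _), ← hr_hl, Category.assoc,
    ← Category.assoc (V.L _ _ _), L_unit, Category.assoc]

/-- F preserves j, dinaturality replaces j_{FY}·V(f,1) by j_1·V(1,f), and with j_1 = i_1 naturality
of i leaves f. -/
theorem j_yonedaApp (F : EndoFunctor V) {Y : V.carrier} (f : V.unit ⟶ F.functor.obj Y) :
    V.j Y ≫ F.yonedaApp f Y = f := by
  have h := F.j_st Y
  rw [yonedaApp, reassoc_of% h, ← Category.assoc, ← V.j_dinatural, j_unit, ← V.i_natural,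
    Category.assoc, Iso.hom_inv_id, Category.comp_id]

/-- Uniqueness in the enriched Yoneda lemma. Composing the naturality square at (Y,Z) with V(j_Y,1)
turns L into i by CC2, and naturality of i isolates a_Z. Only squares starting at Y are needed. -/
theorem eq_yonedaApp (F : EndoFunctor V) {Y : V.carrier}
    (a : ∀ Z, hobj V.hom Y Z ⟶ F.functor.obj Z)
    (ha : ∀ Z, V.L Y Y Z ≫ hr V.hom (hobj V.hom Y Y) (a Z) =
      F.st Y Z ≫ hl V.hom (a Y) (F.functor.obj Z)) (Z : V.carrier) :
    a Z = F.yonedaApp (V.j Y ≫ a Y) Z := by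
  have h := ha Z
  rw [yonedaApp, hl_comp, Category.assoc, ← reassoc_of% h, ← Category.assoc (hr _ _ _), hr_hl,
    Category.assoc, ← Category.assoc (V.L _ _ _), V.cc2, reassoc_of% (V.i_natural (a Z)).symm, Iso.hom_inv_id,
    Category.comp_id]

/-- The morphism `f` from the unit object to `FY` induces a transformation `V(Y,-) → F`. -/
def yoneda (F : EndoFunctor V) {Y : V.carrier} (f : V.unit ⟶ F.functor.obj Y) :
    (ihom Y).functor ⟶ F.functor where
  app Z := F.yonedaApp f Z
  naturality _ _ g := F.yonedaApp_naturality f g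

theorem yoneda_isNatural (F : EndoFunctor V) {Y : V.carrier} (f : V.unit ⟶ F.functor.obj Y) :
    IsNatural (ihom Y) F (F.yoneda f) := fun Z W => F.L_yonedaApp f Z W

theorem IsNatural.eq_yoneda {F : EndoFunctor V} {Y : V.carrier}
    {α : (ihom Y).functor ⟶ F.functor} (hα : IsNatural (ihom Y) F α)
    (f : V.unit ⟶ F.functor.obj Y) (h : V.j Y ≫ (show hobj V.hom Y Y ⟶ _ from α.app Y) = f) :
    α = F.yoneda f := by
  subst h
  ext Z
  exact F.eq_yonedaApp (fun Z => α.app Z) (fun Z => hα Y Z) Z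

/-- Both sides are enriched natural, so by uniqueness it suffices to compare them at j_Y. -/
theorem yoneda_comp {F G : EndoFunctor V} {Y : V.carrier} (f : V.unit ⟶ F.functor.obj Y)
    {α : F.functor ⟶ G.functor} (hα : IsNatural F G α) :
    F.yoneda f ≫ α = G.yoneda (f ≫ α.app Y) := by
  refine ((F.yoneda_isNatural f).comp hα).eq_yoneda _ ?_
  refine (Category.assoc _ _ _).symm.trans ?_
  exact congrArg (fun q => q ≫ α.app Y) (F.j_yonedaApp f)

end EndoFunctor

end ClosedCategory

end ClosedMulti

namespace ClosedMulti

/-! ### The multicategory of a closed category -/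

namespace ClosedCategory

open EndoFunctor

variable (V : ClosedCategory.{v, u})

/-- The functor `V(Xₙ,…V(X₁,-)…)`. -/
def iter : List V.carrier → EndoFunctor V
  | [] => EndoFunctor.id V
  | X :: Xs => (ihom X).comp (iter Xs)

theorem iter_append (Xs Ws : List V.carrier) :
    (V.iter Xs).comp (V.iter Ws) = V.iter (Xs ++ Ws) := by
  induction Xs with
  | nil => exact EndoFunctor.id_comp _
  | cons X Xs ih => exact (EndoFunctor.assoc _ _ _).trans (congrArg (ihom X).comp ih)

/-- The object `V(Xₙ,…V(X₁,Z)…)`. -/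
abbrev iterObj (Xs : List V.carrier) (Z : V.carrier) : V.carrier := (V.iter Xs).functor.obj Z

/-- A morphism `X₁,…,Xₙ → Y` is a morphism `1 → V(Xₙ,…V(X₁,Y)…)`. -/
abbrev MultiHom (Xs : List V.carrier) (Y : V.carrier) : Type v := V.unit ⟶ V.iterObj Xs Y

theorem iterObj_append {Xs Ws Vs : List V.carrier} (h : Vs = Xs ++ Ws) (Z : V.carrier) :
    V.iterObj Ws (V.iterObj Xs Z) = V.iterObj Vs Z := by
  subst h
  exact congrArg (fun F : EndoFunctor V => F.functor.obj Z) (V.iter_append Xs Ws)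

theorem iter_append_functor {Xs Ws Vs : List V.carrier} (h : Vs = Xs ++ Ws) :
    (V.iter Xs).comp (V.iter Ws) = V.iter Vs := by
  subst h
  exact V.iter_append Xs Ws

/-- The iterated functors agree only propositionally; the mediating `eqToHom` is a natural
transformation and so slides past any morphism. -/
theorem iter_append_map {Xs Ws Vs : List V.carrier} (h : Vs = Xs ++ Ws) {Z Z' : V.carrier}
    (g : Z ⟶ Z') :
    (V.iter Ws).functor.map ((V.iter Xs).functor.map g) ≫ eqToHom (V.iterObj_append h Z') =
      eqToHom (V.iterObj_append h Z) ≫ (V.iter Vs).functor.map g := by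
  have := (eqToHom (congrArg EndoFunctor.functor (V.iter_append_functor h))).naturality g
  rw [CategoryTheory.eqToHom_app, CategoryTheory.eqToHom_app] at this
  exact this

variable {V}

/-- The transformation `V(Y₁,…,Yₙ;-) → V(W₁,…,Wₘ;-)` induced by a sequence of morphisms. -/
def famTrans : ∀ {Ws Ys : List V.carrier}, Fam V.MultiHom Ws Ys →
    ((V.iter Ys).functor ⟶ (V.iter Ws).functor)
  | _, _, .nil => 𝟙 _
  | _, _, .cons (Xs := Xs) (Ws := Ws) (Vs := Vs) (Ys := Ys) (Y := Y) f fs h =>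
    (Functor.whiskerLeft (ihom Y).functor (famTrans fs) ≫
      Functor.whiskerRight ((V.iter Xs).yoneda f) (V.iter Ws).functor ≫
        eqToHom (congrArg EndoFunctor.functor (V.iter_append_functor h)) :
        ((ihom Y).comp (V.iter Ys)).functor ⟶ (V.iter Vs).functor)

theorem famTrans_isNatural {Ws Ys : List V.carrier} (fs : Fam V.MultiHom Ws Ys) :
    IsNatural (V.iter Ys) (V.iter Ws) (famTrans fs) := by
  induction fs with
  | nil => exact IsNatural.id _
  | @cons Xs Ws Vs Ys Y f fs h ih =>
    exact (ih.whiskerLeft (ihom Y)).comp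
      ((((V.iter Xs).yoneda_isNatural f).whiskerRight (V.iter Ws)).comp
        (IsNatural.eqToHom (V.iter_append_functor h)))

/-- The components of `famTrans`. -/
def famApp {Ws Ys : List V.carrier} (fs : Fam V.MultiHom Ws Ys) (Z : V.carrier) :
    V.iterObj Ys Z ⟶ V.iterObj Ws Z := (famTrans fs).app Z

theorem famApp_naturality {Ws Ys : List V.carrier} (fs : Fam V.MultiHom Ws Ys) {Z Z' : V.carrier}
    (g : Z ⟶ Z') :
    (V.iter Ys).functor.map g ≫ famApp fs Z' = famApp fs Z ≫ (V.iter Ws).functor.map g :=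
  (famTrans fs).naturality g

theorem famApp_cons {Xs Ws Vs Ys : List V.carrier} {Y : V.carrier} (f : V.MultiHom Xs Y)
    (fs : Fam V.MultiHom Ws Ys) (h : Vs = Xs ++ Ws) (Z : V.carrier) :
    famApp (.cons f fs h) Z = famApp fs (hobj V.hom Y Z) ≫
      (V.iter Ws).functor.map ((V.iter Xs).yonedaApp f Z) ≫
        eqToHom (V.iterObj_append h Z) := by
  refine congrArg (fun q => famApp fs (hobj V.hom Y Z) ≫
      (V.iter Ws).functor.map ((V.iter Xs).yonedaApp f Z) ≫ q) ?_
  exact CategoryTheory.eqToHom_app _ _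

/-- Concatenation of sequences corresponds to horizontal composition of transformations. -/
theorem famApp_append {Ws Ys Ws' Ys' : List V.carrier} (fs : Fam V.MultiHom Ws Ys)
    (gs : Fam V.MultiHom Ws' Ys') (Z : V.carrier) :
    famApp (fs.append gs) Z = eqToHom (V.iterObj_append rfl Z).symm ≫
      famApp gs (V.iterObj Ys Z) ≫ (V.iter Ws').functor.map (famApp fs Z) ≫
        eqToHom (V.iterObj_append rfl Z) := by
  induction fs generalizing Z with
  | nil =>
    refine Eq.trans ?_ (Category.id_comp _).symm
    refine Eq.trans ?_ (congrArg (fun q => famApp gs Z ≫ q) (Eq.trans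
      (congrArg (fun q => q ≫ 𝟙 _) ((V.iter Ws').functor.map_id Z)) (Category.id_comp _))).symm
    exact (Category.comp_id _).symm
  | @cons Xs Ws Vs Ys Y f fs h ih =>
    subst h
    refine (famApp_cons f (fs.append gs) _ Z).trans ?_
    refine Eq.trans ?_ (congrArg (fun q : V.iterObj Ys (hobj V.hom Y Z) ⟶ V.iterObj (Xs ++ Ws) Z =>
      eqToHom (V.iterObj_append rfl (hobj V.hom Y Z)).symm ≫
        famApp gs (V.iterObj Ys (hobj V.hom Y Z)) ≫ (V.iter Ws').functor.map q ≫
        eqToHom (V.iterObj_append rfl Z)) (famApp_cons f fs rfl Z)).symm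
    have := V.iter_append_map (rfl : Ws ++ Ws' = Ws ++ Ws') ((V.iter Xs).yonedaApp f Z)
    rw [ih, Functor.map_comp, Functor.map_comp, eqToHom_map]
    simp only [Category.assoc]
    rw [← reassoc_of% this]
    simp only [eqToHom_trans]
    rfl

/-- Under the Yoneda correspondence, composing with fs is vertical composition with `famTrans fs`.
Its enriched naturality is what makes this true. -/
theorem yonedaApp_comp {Ws Xs : List V.carrier} {Y : V.carrier} (fs : Fam V.MultiHom Ws Xs)
    (g : V.MultiHom Xs Y) (Z : V.carrier) :
    (V.iter Ws).yonedaApp (g ≫ famApp fs Y) Z = (V.iter Xs).yonedaApp g Z ≫ famApp fs Z :=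
  (congrArg (fun t => NatTrans.app t Z) (yoneda_comp g (famTrans_isNatural fs))).symm

theorem yonedaApp_j (X Z : V.carrier) : (V.iter [X]).yonedaApp (V.j X) Z = 𝟙 (hobj V.hom X Z) := by
  refine Eq.trans ?_ ((V.iter [X]).eq_yonedaApp (fun Z => 𝟙 (hobj V.hom X Z)) (fun Z => ?_) Z).symm
  · exact congrArg (fun q => (V.iter [X]).yonedaApp q Z) (Category.comp_id (V.j X)).symm
  -- The action of `iter [X]` is L followed by the identity contributed by the empty sequence.
  · refine Eq.trans ?_ (congrArg₂ (· ≫ ·) (Category.comp_id (V.L X X Z)).symm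
      (hl_id V.hom (hobj V.hom X X) (hobj V.hom X Z)).symm)
    exact congrArg (V.L X X Z ≫ ·) (hr_id V.hom (hobj V.hom X X) (hobj V.hom X Z))

theorem famApp_ids (Xs : List V.carrier) (Z : V.carrier) :
    famApp (Fam.ids (H := V.MultiHom) V.j Xs) Z = 𝟙 (V.iterObj Xs Z) := by
  induction Xs generalizing Z with
  | nil => rfl
  | cons X Xs ih =>
    refine (famApp_cons (Xs := [X]) (V.j X) (Fam.ids V.j Xs) rfl Z).trans ?_
    rw [ih, yonedaApp_j]
    refine (Category.id_comp _).trans ?_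
    refine (congrArg (fun q => q ≫ 𝟙 _) ((V.iter Xs).functor.map_id _)).trans ?_
    exact Category.id_comp _

theorem famApp_single {Xs : List V.carrier} {Y : V.carrier} (f : V.MultiHom Xs Y)
    (Z : V.carrier) : famApp (Fam.single f) Z = (V.iter Xs).yonedaApp f Z := by
  rw [Fam.single, famApp_cons]
  exact (Category.id_comp _).trans (Category.comp_id _)

/-- The composite of a sequence of morphisms with a morphism. -/
def multiComp {Ws Xs : List V.carrier} {Y : V.carrier} (fs : Fam V.MultiHom Ws Xs)
    (g : V.MultiHom Xs Y) : V.MultiHom Ws Y := g ≫ famApp fs Y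

/-- Associativity as the interchange law. In the induction step, naturality of `famApp p.first`
exchanges it with the transformation of g, which separates the two layers. -/
theorem famApp_composites {Ws Xs Ys : List V.carrier} (p : Fam₂ V.MultiHom Ws Xs Ys)
    (Z : V.carrier) :
    famApp (p.composites multiComp) Z = famApp p.second Z ≫ famApp p.first Z := by
  induction p generalizing Z with
  | nil => exact (Category.id_comp (𝟙 Z)).symm
  | @cons W X Ws Xs Vs Us Ys Y fs g p h h' ih =>
    subst h h'
    refine (famApp_cons (multiComp fs g) (p.composites multiComp) rfl Z).trans ?_
    refine Eq.trans ?_ (congrArg₂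
      (fun (q : V.iterObj Ys (hobj V.hom Y Z) ⟶ V.iterObj (X ++ Xs) Z) r => q ≫ r)
      (famApp_cons g p.second rfl Z) (famApp_append fs p.first Z)).symm
    rw [multiComp, ih, yonedaApp_comp, Functor.map_comp]
    simp only [Category.assoc, eqToHom_trans_assoc, eqToHom_refl, Category.id_comp]
    rw [← reassoc_of% (famApp_naturality p.first ((V.iter X).yonedaApp g Z))]

variable (V)

/-- The multicategory of a closed category. -/
def multicategory : Multicategory.{v, u} where
  Ob := V.carrier
  Hom := V.MultiHom
  comp := multiComp
  id X := V.j X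
  id_comp {Xs Y} f := (congrArg (fun q => f ≫ q) (famApp_ids Xs Y)).trans (Category.comp_id f)
  comp_id {Xs Y} f :=
    (congrArg (fun q => V.j Y ≫ q) (famApp_single f Y)).trans ((V.iter Xs).j_yonedaApp f)
  assoc {_ _ _ Z} p h := (congrArg (fun q => h ≫ q) (famApp_composites p Z)).trans
    (Category.assoc _ _ _).symm

end ClosedCategory

end ClosedMulti

namespace ClosedMulti

/-! ### The closed structure of the multicategory of a closed category -/

namespace Multicategory

variable {C : Multicategory.{v, u}}

/-- Evaluation is natural in the remaining arguments. For fs = (1,…,1,f) this factors evaluation at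
a sequence X, Xs through evaluation at Xs and at X. -/
theorem evalMap_single {X Z E : C.Ob} (ev : C.Hom [X, E] Z) {Ws Ys : List C.Ob}
    (fs : Fam C.Hom Ws Ys) (k : C.Hom Ys E) :
    C.evalMap (Xs := [X]) ev Ws (C.comp fs k) =
      C.comp (.cons (C.id X) fs rfl) (C.evalMap (Xs := [X]) ev Ys k) :=
  comp_cons_single_comp (C.id X) fs k ev rfl rfl

/-- The internal Hom-object of the empty sequence. -/
def InternalHom.nil (Z : C.Ob) : C.InternalHom [] Z where
  obj := Z
  ev := C.id Z
  bijective Ys := by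
    have : C.evalMap (Xs := []) (C.id Z) Ys = _root_.id := funext fun f => C.comp_id f
    rw [this]
    exact Function.bijective_id

/-- Internal Hom-objects of sequences are iterated internal Hom-objects. -/
def InternalHom.cons {X Z : C.Ob} {Xs : List C.Ob} (I : C.InternalHom [X] Z)
    (E : C.InternalHom Xs I.obj) : C.InternalHom (X :: Xs) Z where
  obj := E.obj
  ev := C.evalMap I.ev (Xs ++ [E.obj]) E.ev
  bijective Ys := by
    have : C.evalMap (Xs := X :: Xs) (C.evalMap I.ev (Xs ++ [E.obj]) E.ev) Ys =
        C.evalMap I.ev (Xs ++ Ys) ∘ C.evalMap E.ev Ys := funext fun f =>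
      (evalMap_single I.ev ((Fam.ids C.id Xs).append (Fam.single f)) E.ev).symm
    rw [this]
    exact (I.bijective _).comp (E.bijective _)

theorem isClosed_of_unary (h : ∀ X Z : C.Ob, Nonempty (C.InternalHom [X] Z)) : C.IsClosed := by
  intro Xs
  induction Xs with
  | nil => exact fun Z => ⟨.nil Z⟩
  | cons X Xs ih => exact fun Z => ⟨.cons (h X Z).some (ih _).some⟩

/-- An object with a nullary morphism that represents nullary morphisms in the presence of
further arguments is a unit object. -/
def UnitObject.ofBijective (one : C.Ob) (u : C.Hom [] one)
    (h : ∀ (Ys : List C.Ob) (X : C.Ob),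
      Function.Bijective (fun f : C.Hom (one :: Ys) X => (pre u f : C.Hom Ys X))) :
    C.UnitObject where
  one := one
  u := u
  isIso X E := by
    have hb : ∀ Ys : List C.Ob, Function.Bijective
        (fun k : C.Hom Ys E.obj => comp₁ k (pre (Ys := [E.obj]) u E.ev)) := fun Ys => by
      have : (fun k : C.Hom Ys E.obj => comp₁ k (pre (Ys := [E.obj]) u E.ev)) =
          (fun f => (pre u f : C.Hom Ys X)) ∘ C.evalMap E.ev Ys :=
        funext fun k => ClosedData.sec_pre_nil u k E.ev
      rw [this]
      exact (h Ys X).comp (E.bijective Ys)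
    -- Surjectivity with source `[X]` gives a one-sided inverse; injectivity with source `[E.obj]`
    -- makes it two-sided.
    obtain ⟨g, hg⟩ := (hb [X]).2 (C.id X)
    refine ⟨g, (hb [E.obj]).1 ?_, hg⟩
    refine (comp₁_assoc (pre (Ys := [E.obj]) u E.ev) g _).trans ?_
    refine (congrArg (comp₁ (pre (Ys := [E.obj]) u E.ev)) hg).trans ?_
    exact (comp₁_id _).trans (id_comp₁ _).symm

end Multicategory

namespace ClosedCategory

open EndoFunctor Multicategory

variable (V : ClosedCategory.{v, u})

variable {V} in
-- The first argument is the innermost one, so morphisms X, Ws → Z are by definition morphisms Ws →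
-- V(X,Z), and j_X induces the identity transformation. Consequently, with evaluation j_{V(X,Z)},
-- currying is the identity map.
theorem multiComp_cons_j {X Z : V.carrier} {Ws Ys : List V.carrier} (fs : Fam V.MultiHom Ws Ys)
    (g : V.MultiHom Ys (hobj V.hom X Z)) :
    multiComp (Y := Z) (.cons (Xs := [X]) (V.j X) fs rfl) g = multiComp fs g := by
  refine congrArg (fun q => g ≫ q) ((famApp_cons (Xs := [X]) (V.j X) fs rfl Z).trans ?_)
  rw [yonedaApp_j]
  refine (congrArg (fun q => famApp fs _ ≫ q ≫ 𝟙 _) ((V.iter Ws).functor.map_id _)).trans ?_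
  exact (congrArg (fun q => famApp fs _ ≫ q) (Category.comp_id _)).trans (Category.comp_id _)

/-- The internal Hom-object of a closed category. -/
abbrev ihomObj (X Z : V.carrier) : V.carrier := hobj V.hom X Z

theorem evalMap_multicategory {X Z : V.carrier} {Ys : List V.carrier}
    (f : V.MultiHom Ys (hobj V.hom X Z)) :
    V.multicategory.evalMap (Xs := [X]) (E := V.ihomObj X Z) (Z := Z)
      (V.j (V.ihomObj X Z)) Ys f = f :=
  (multiComp_cons_j (Fam.single f) (V.j (hobj V.hom X Z))).trans (V.multicategory.comp_id f)

theorem multiComp_cons_ids {A Z : V.carrier} {Xs Ys : List V.carrier} (f : V.MultiHom Xs A)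
    (g : V.unit ⟶ V.iterObj Ys (hobj V.hom A Z)) :
    multiComp (Y := Z) (.cons f (Fam.ids V.j Ys) rfl) g =
      g ≫ (V.iter Ys).functor.map ((V.iter Xs).yonedaApp f Z) ≫
        eqToHom (V.iterObj_append rfl Z) := by
  refine congrArg (fun q : V.iterObj Ys (hobj V.hom A Z) ⟶ _ => g ≫ q)
    ((famApp_cons f (Fam.ids V.j Ys) rfl Z).trans ?_)
  rw [famApp_ids, Category.id_comp]

/-- The name of a morphism. -/
def name {X Y : V.carrier} (f : X ⟶ Y) : V.unit ⟶ hobj V.hom X Y := V.j X ≫ hr V.hom X f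

/-- Naturality of `yonedaApp` moves f to the end, and `j_yonedaApp` leaves k. -/
theorem multiComp_single_name {Xs : List V.carrier} {Y Z : V.carrier}
    (k : V.unit ⟶ V.iterObj Xs Y) (f : Y ⟶ Z) :
    multiComp (Fam.single k) (V.name f : V.MultiHom [Y] Z) = k ≫ (V.iter Xs).functor.map f := by
  refine (congrArg (fun q => (V.j Y ≫ hr V.hom Y f) ≫ q) (famApp_single k Z)).trans ?_
  rw [Category.assoc, yonedaApp_naturality, ← Category.assoc, j_yonedaApp]

theorem name_id (X : V.carrier) : V.name (𝟙 X) = V.j X :=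
  (congrArg (fun q => V.j X ≫ q) (hr_id V.hom X X)).trans (Category.comp_id _)

theorem name_comp {X Y Z : V.carrier} (f : X ⟶ Y) (g : Y ⟶ Z) :
    V.name (f ≫ g) = multiComp (Fam.single (Xs := [X]) (V.name f)) (V.name g : V.MultiHom [Y] Z) := by
  refine Eq.trans ?_ (V.multiComp_single_name (Xs := [X]) (V.name f) g).symm
  exact (congrArg (fun q => V.j X ≫ q) (hr_comp V.hom X f g)).trans (Category.assoc _ _ _).symm

/-- V(f,-) is enriched natural by dinaturality of L, and its value at j_X is the name of f by
dinaturality of j; Yoneda uniqueness applies. -/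
theorem yonedaApp_name {X' X : V.carrier} (f : X' ⟶ X) (Z : V.carrier) :
    (V.iter [X']).yonedaApp (V.name f) Z = hl V.hom f Z := by
  refine (((V.iter [X']).eq_yonedaApp (fun Z => hl V.hom f Z) (fun Z => ?_) Z).trans ?_).symm
  · refine (V.L_dinatural f X Z).trans ?_
    exact congrArg (fun q => q ≫ _) (Category.comp_id (V.L X' X Z)).symm
  · exact congrArg (fun q => (V.iter [X']).yonedaApp q Z) (V.j_dinatural f).symm

/-- As a transformation in Z, L is enriched natural by CC3 and takes j_Y to j_{V(X,Y)} by CC1, so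
uniqueness identifies it. -/
theorem yonedaApp_j_hom (X Y Z : V.carrier) :
    (V.iter [X, hobj V.hom X Y]).yonedaApp (V.j (hobj V.hom X Y)) Z = V.L X Y Z := by
  refine (((V.iter [X, hobj V.hom X Y]).eq_yonedaApp (fun Z => V.L X Y Z)
    (fun Z => ?_) Z).trans ?_).symm
  · refine (V.cc3 X Y Y Z).trans ((Category.assoc _ _ _).symm.trans ?_)
    exact congrArg (fun q => (V.L X Y Z ≫ q) ≫ _) (Category.comp_id _).symm
  · exact congrArg (fun q => (V.iter [X, hobj V.hom X Y]).yonedaApp q Z) (V.cc1 X Y)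

theorem yonedaApp_unit (Z : V.carrier) :
    (V.iter []).yonedaApp (𝟙 V.unit) Z = (V.i Z).inv := by
  refine (Category.id_comp _).trans ?_
  exact (congrArg (fun q => q ≫ (V.i Z).inv) (hl_id V.hom V.unit Z)).trans (Category.id_comp _)

theorem multiComp_cons_unit {Z : V.carrier} {Ys : List V.carrier}
    (g : V.unit ⟶ V.iterObj Ys (hobj V.hom V.unit Z)) :
    multiComp (Y := Z) (.cons (Xs := []) (𝟙 V.unit) (Fam.ids V.j Ys) rfl) g =
      g ≫ (V.iter Ys).functor.map (V.i Z).inv := by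
  refine (V.multiComp_cons_ids (Xs := []) (𝟙 V.unit) g).trans ?_
  rw [yonedaApp_unit]
  exact congrArg (fun q => g ≫ q) (Category.comp_id _)

/-- The internal Hom-objects of the multicategory of a closed category. -/
def internalHom (X Z : V.carrier) : V.multicategory.InternalHom [X] Z where
  obj := V.ihomObj X Z
  ev := V.j (V.ihomObj X Z)
  bijective Ys := by
    have : V.multicategory.evalMap (Xs := [X]) (E := V.ihomObj X Z) (Z := Z)
        (V.j (V.ihomObj X Z)) Ys = _root_.id := funext fun f => V.evalMap_multicategory f
    exact this ▸ Function.bijective_id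

/-- Inserting the unit is postcomposition with the image of the isomorphism i⁻¹ under an iterated
Hom-functor. -/
theorem multiComp_cons_unit_bijective (Ys : List V.carrier) (X : V.carrier) :
    Function.Bijective (fun g : V.unit ⟶ V.iterObj Ys (hobj V.hom V.unit X) =>
      multiComp (Y := X) (.cons (Xs := []) (𝟙 V.unit) (Fam.ids V.j Ys) rfl) g) := by
  rw [funext fun g => V.multiComp_cons_unit (Ys := Ys) (Z := X) g]
  exact (Iso.homToEquiv ((V.iter Ys).functor.mapIso (V.i X).symm)).bijective

/-- The unit object of the multicategory of a closed category. -/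
def unitObject : V.multicategory.UnitObject :=
  .ofBijective (C := V.multicategory) V.unit (𝟙 V.unit) V.multiComp_cons_unit_bijective

/-- Internal Hom-objects and a unit object of the multicategory of a closed category. -/
def closedData : V.multicategory.ClosedData where
  ihom := V.internalHom
  unit := V.unitObject

/-- The closed multicategory with unit objects of a closed category. -/
def closedMulticategory : ClosedMulticategory.{v, u} where
  toMulticategory := V.multicategory
  isClosed := isClosed_of_unary fun X Z => ⟨V.closedData.ihom X Z⟩
  hasUnit := ⟨V.closedData.unit⟩

theorem phi_closedData {X Z : V.carrier} {Ys : List V.carrier}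
    (f : V.MultiHom Ys (hobj V.hom X Z)) :
    V.closedData.phi (X := X) (Z := Z) f = f := V.evalMap_multicategory f

/-- Because φ is the identity here, each structure morphism is computed by one explicit composite.
The comparisons with V needed for the isomorphism are all obtained from this. -/
theorem homL_name {X' X : V.carrier} (f : X' ⟶ X) (Z : V.carrier) :
    V.closedData.homL (X' := X') (X := X) (V.name f) Z =
      (V.name (hl V.hom f Z) : V.MultiHom [hobj V.hom X Z] (hobj V.hom X' Z)) := by
  apply V.closedData.phi_inj
  refine (V.closedData.phi_homL _ Z).trans (Eq.trans ?_ (V.phi_closedData _).symm)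
  refine (V.multiComp_cons_ids (Xs := [X']) (Ys := [hobj V.hom X Z]) (V.name f)
    (V.j (hobj V.hom X Z))).trans ?_
  rw [yonedaApp_name]
  exact congrArg (fun q => V.j (hobj V.hom X Z) ≫ q) (Category.comp_id _)

theorem homR_name (X : V.carrier) {Y Z : V.carrier} (g : Y ⟶ Z) :
    V.closedData.homR (Y := Y) (Z := Z) X (V.name g) =
      (V.name (hr V.hom X g) : V.MultiHom [hobj V.hom X Y] (hobj V.hom X Z)) := by
  apply V.closedData.phi_inj
  refine (V.closedData.phi_homR (Y := Y) (Z := Z) X (V.name g)).trans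
    (Eq.trans ?_ (V.phi_closedData _).symm)
  exact V.multiComp_single_name (Xs := [X, hobj V.hom X Y]) _ g

theorem L_closedData (X Y Z : V.carrier) : V.closedData.L X Y Z =
    (V.name (V.L X Y Z) :
      V.MultiHom [hobj V.hom Y Z] (hobj V.hom (hobj V.hom X Y) (hobj V.hom X Z))) := by
  apply V.closedData.phi_inj
  apply V.closedData.phi_inj
  refine (V.closedData.phi_phi_L X Y Z).trans ?_
  refine Eq.trans ?_ ((congrArg (V.closedData.phi (X := X) (Z := Z))
    (V.phi_closedData _)).trans (V.phi_closedData (Ys := [hobj V.hom X Y, hobj V.hom Y Z]) _)).symm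
  refine (V.multiComp_cons_ids (Xs := [X, hobj V.hom X Y]) (Ys := [hobj V.hom Y Z])
    (V.j (hobj V.hom X Y)) (V.j (hobj V.hom Y Z))).trans ?_
  rw [yonedaApp_j_hom]
  exact congrArg (fun q => V.j (hobj V.hom Y Z) ≫ q) (Category.comp_id _)

theorem nullary_closedData (X : V.carrier) :
    V.closedData.nullary X = (V.name (V.i X).inv : V.MultiHom [hobj V.hom V.unit X] X) :=
  V.multiComp_cons_unit (Ys := [hobj V.hom V.unit X]) (V.j (hobj V.hom V.unit X))

/-- Both sides are inverse to `nullary`, which is the name of i⁻¹. -/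
theorem i_closedData (X : V.carrier) :
    V.closedData.i X = (V.name (V.i X).hom : V.MultiHom [X] (hobj V.hom V.unit X)) := by
  apply V.closedData.nullary_cancel
  refine (V.closedData.i_nullary X).trans ((V.name_id X).symm.trans ?_)
  rw [← (V.i X).hom_inv_id]
  refine (V.name_comp _ _).trans ?_
  exact congrArg (comp₁ (C := V.multicategory) (Xs := [X]) (Y := V.ihomObj V.unit X)
    (V.name (V.i X).hom))
    (V.nullary_closedData X).symm

theorem j_closedData (X : V.carrier) :
    V.closedData.j X = (V.name (V.j X) : V.MultiHom [V.unit] (hobj V.hom X X)) := by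
  apply V.closedData.u_cancel
  refine (V.closedData.u_j X).trans ?_
  apply V.closedData.phi_inj
  refine (V.closedData.phi_one X).trans ?_
  refine Eq.trans ?_ (V.phi_closedData (X := X) (Z := X) (Ys := []) _).symm
  refine Eq.trans ?_ (V.multiComp_single_name (Xs := []) (𝟙 V.unit) (V.j X)).symm
  exact (Category.id_comp (V.j X)).symm

end ClosedCategory

end ClosedMulti

/-! ### Recovering a closed category from its multicategory -/

namespace ClosedMulti

open Multicategory

namespace ClosedCategory

variable (V : ClosedCategory.{v, u})

/-- Naming as a bijection on morphisms. -/
noncomputable def nameEquiv (X Y : V.carrier) : (X ⟶ Y) ≃ (V.unit ⟶ hobj V.hom X Y) :=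
  Equiv.ofBijective V.name (V.cc5 X Y)

theorem name_symm {X Y : V.carrier} (f : V.unit ⟶ hobj V.hom X Y) :
    V.name ((V.nameEquiv X Y).symm f) = f := (V.nameEquiv X Y).apply_symm_apply f

theorem symm_name {X Y : V.carrier} (f : X ⟶ Y) : (V.nameEquiv X Y).symm (V.name f) = f :=
  (V.nameEquiv X Y).symm_apply_apply f

/-- Naming as a functor. -/
def nameFunctor : V.carrier ⥤ V.multicategory.Underlying where
  obj X := X
  map f := V.name f
  map_id X := V.name_id X
  map_comp f g := V.name_comp f g

/-- The inverse of naming as a functor. -/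
noncomputable def unnameFunctor : V.multicategory.Underlying ⥤ V.carrier where
  obj X := X
  map {X Y} f := (V.nameEquiv X Y).symm f
  map_id X := (V.nameEquiv X X).symm_apply_eq.2 (V.name_id X).symm
  map_comp {X Y Z} f g := (V.nameEquiv X Z).symm_apply_eq.2 (by
    refine Eq.trans ?_ (V.name_comp _ _).symm
    exact (congrArg₂ (comp₁ (C := V.multicategory) (Xs := [X]) (Y := Y) (Z := Z))
      (V.name_symm f) (V.name_symm g)).symm)

/-- Naming as a closed functor. -/
noncomputable def nameClosedFunctor : ClosedFunctor V V.closedData.closedCategory where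
  functor := V.nameFunctor
  -- The internal Hom-objects coincide, so the closing is an identity and the axioms reduce to the
  -- comparisons of i, j, L and of the Hom-functors.
  hat X Y := V.multicategory.id (V.ihomObj X Y)
  hat_natural_left f Y := (comp₁_id _).trans
    ((V.homL_name f Y).symm.trans (id_comp₁ (C := V.multicategory) _).symm)
  hat_natural_right X _ _ g := (comp₁_id _).trans
    ((V.homR_name X g).symm.trans (id_comp₁ (C := V.multicategory) _).symm)
  zero := V.multicategory.id V.unit
  cf1 X := (id_comp₁ (C := V.multicategory) _).trans
    ((comp₁_id _).trans (V.j_closedData X).symm)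
  cf2 X := by
    refine (congrArg (comp₁ (C := V.multicategory) (Xs := [X]) (Y := V.ihomObj V.unit X)
      (V.name (V.i X).hom))
      (id_comp₁ (C := V.multicategory) _)).trans ?_
    refine (congrArg (comp₁ (C := V.multicategory) (Xs := [X]) (Y := V.ihomObj V.unit X)
      (V.name (V.i X).hom))
      (hl_id V.closedData.homFunctor (V.unit : V.multicategory.Underlying) X)).trans ?_
    exact (comp₁_id _).trans (V.i_closedData X).symm
  cf3 X Y Z := by
    refine (congrArg (comp₁ (C := V.multicategory) (Xs := [V.ihomObj Y Z])
      (Y := V.ihomObj (V.ihomObj X Y) (V.ihomObj X Z)) (V.name (V.L X Y Z)))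
      (id_comp₁ (C := V.multicategory) _)).trans ?_
    refine (congrArg (comp₁ (C := V.multicategory) (Xs := [V.ihomObj Y Z])
      (Y := V.ihomObj (V.ihomObj X Y) (V.ihomObj X Z)) (V.name (V.L X Y Z)))
      (hr_id V.closedData.homFunctor (V.ihomObj X Y : V.multicategory.Underlying)
        (V.ihomObj X Z))).trans ?_
    refine (comp₁_id _).trans ((V.L_closedData X Y Z).symm.trans ?_)
    refine Eq.trans ?_ (id_comp₁ (C := V.multicategory) _).symm
    refine (comp₁_id _).symm.trans ?_
    exact congrArg (comp₁ (C := V.multicategory) (V.closedData.L X Y Z))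
      (hl_id V.closedData.homFunctor (V.ihomObj X Y : V.multicategory.Underlying)
        (V.ihomObj X Z)).symm

/-- The inverse of naming as a closed functor. -/
noncomputable def unnameClosedFunctor : ClosedFunctor V.closedData.closedCategory V where
  functor := V.unnameFunctor
  hat X Y := 𝟙 (V.ihomObj X Y)
  hat_natural_left {X' X} f Y := by
    obtain ⟨f, rfl⟩ := (V.nameEquiv X' X).surjective f
    refine (Category.comp_id _).trans (Eq.trans ?_ (Category.id_comp _).symm)
    refine (congrArg (V.nameEquiv _ _).symm (V.homL_name f Y)).trans ((V.symm_name _).trans ?_)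
    exact congrArg (fun q => hl V.hom q Y) (V.symm_name f).symm
  hat_natural_right X Y Y' g := by
    obtain ⟨g, rfl⟩ := (V.nameEquiv Y Y').surjective g
    refine (Category.comp_id _).trans (Eq.trans ?_ (Category.id_comp _).symm)
    refine (congrArg (V.nameEquiv _ _).symm (V.homR_name X g)).trans ((V.symm_name _).trans ?_)
    exact congrArg (fun q => hr V.hom X q) (V.symm_name g).symm
  zero := 𝟙 V.unit
  cf1 X := (Category.id_comp _).trans ((Category.comp_id _).trans
    ((congrArg (V.nameEquiv _ _).symm (V.j_closedData X)).trans (V.symm_name _)))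
  cf2 X := by
    refine (congrArg (fun q => (V.nameEquiv _ _).symm (V.closedData.i X) ≫ q)
      ((Category.id_comp _).trans (hl_id V.hom V.unit X))).trans ?_
    exact (Category.comp_id _).trans
      ((congrArg (V.nameEquiv _ _).symm (V.i_closedData X)).trans (V.symm_name _))
  cf3 X Y Z := by
    refine (congrArg (fun q => (V.nameEquiv _ _).symm (V.closedData.L X Y Z) ≫ q)
      ((Category.id_comp _).trans (hr_id V.hom (V.ihomObj X Y) (V.ihomObj X Z)))).trans ?_
    refine (Category.comp_id _).trans
      ((congrArg (V.nameEquiv _ _).symm (V.L_closedData X Y Z)).trans ((V.symm_name _).trans ?_))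
    refine Eq.trans ?_ (Category.id_comp _).symm
    refine (Category.comp_id _).symm.trans ?_
    exact congrArg (fun q => V.L X Y Z ≫ q)
      (hl_id V.hom (V.ihomObj X Y) (V.ihomObj X Z)).symm

/-- A closed category is isomorphic to the underlying closed category of its multicategory. -/
noncomputable def nameIso : V.closedData.closedCategory ≅ V where
  hom := V.unnameClosedFunctor
  inv := V.nameClosedFunctor
  hom_inv_id := ClosedFunctor.ext'
    (CategoryTheory.Functor.hext (fun _ => rfl) fun _ _ f => heq_of_eq (V.name_symm f))
    (fun X Y => heq_of_eq ((comp₁_id (C := V.multicategory) (Xs := [V.ihomObj X Y])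
      (Y := V.ihomObj X Y) (V.name (𝟙 (V.ihomObj X Y)))).trans (V.name_id (V.ihomObj X Y))))
    (heq_of_eq ((id_comp₁ (C := V.multicategory) _).trans (V.name_id V.unit)))
  inv_hom_id := ClosedFunctor.ext'
    (CategoryTheory.Functor.hext (fun _ => rfl) fun _ _ f => heq_of_eq (V.symm_name f))
    (fun X Y => heq_of_eq ((Category.comp_id _).trans
      ((V.nameEquiv _ _).symm_apply_eq.2 (V.name_id (V.ihomObj X Y)).symm)))
    (heq_of_eq ((Category.id_comp _).trans
      ((V.nameEquiv _ _).symm_apply_eq.2 (V.name_id V.unit).symm)))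

end ClosedCategory

/-- Different choices of internal Hom-objects and of a unit object lead to isomorphic closed
categories. -/
noncomputable def Multicategory.ClosedData.closedCategoryIso {C : Multicategory.{v, u}}
    (K K' : C.ClosedData) : K.closedCategory ≅ K'.closedCategory where
  hom := (Multifunctor.id C).closedFunctor K K'
  inv := (Multifunctor.id C).closedFunctor K' K
  hom_inv_id := by
    refine (closedFunctor_comp K K' K _ _).symm.trans ?_
    rw [Multifunctor.id_comp]
    exact closedFunctor_id K
  inv_hom_id := by
    refine (closedFunctor_comp K' K K' _ _).symm.trans ?_
    rw [Multifunctor.id_comp]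
    exact closedFunctor_id K'

/-! ### The main theorem -/

section

variable (K : ∀ C : ClosedMulticategory.{v, u}, C.toMulticategory.ClosedData)

theorem underlyingTwoFunctor_map_bijective (C D : ClMulticatU.{v, u}) :
    Function.Bijective (fun F : C ⟶ D => (underlyingTwoFunctor K).map F) :=
  (Multifunctor.closedFunctor_bijective (K C) (K D)).comp
    ⟨fun _ _ h => Bicategory.InducedBicategory.hom_ext h, fun F =>
      ⟨Bicategory.InducedBicategory.mkHom F, rfl⟩⟩

theorem underlyingTwoFunctor_map₂_bijective {C D : ClMulticatU.{v, u}} (F G : C ⟶ D) :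
    Function.Bijective (fun r : F ⟶ G => (underlyingTwoFunctor K).map₂ r) :=
  (MultinatTrans.closedNatTrans_bijective (K C) (K D) (F := F.hom) (G := G.hom)).comp
    ⟨fun _ _ h => Bicategory.InducedBicategory.hom₂_ext h, fun r => ⟨⟨r⟩, rfl⟩⟩

theorem underlyingTwoFunctor_exists_iso (V : ClCat.{v, u}) :
    ∃ C : ClMulticatU.{v, u}, Nonempty ((underlyingTwoFunctor K).obj C ≅ V) :=
  ⟨V.closedMulticategory,
    -- The prescribed choice `K` may differ from the canonical one, so the identity multifunctor
    -- compares the two before unnaming.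
    ⟨((K V.closedMulticategory).closedCategoryIso V.closedData).trans V.nameIso⟩⟩

end

end ClosedMulti

theorem mainTheorem1
    (K : ∀ C : ClosedMulticategory.{v, u}, C.toMulticategory.ClosedData) :
    IsCatEquivalence (underlyingTwoFunctor K) ∧
      (∀ C D : ClMulticatU.{v, u}, Function.Bijective
        (fun F : C ⟶ D => (underlyingTwoFunctor K).map F)) ∧
      (∀ (C D : ClMulticatU.{v, u}) (F G : C ⟶ D), Function.Bijective
        (fun r : F ⟶ G => (underlyingTwoFunctor K).map₂ r)) ∧
      (∀ V : ClCat.{v, u}, ∃ C : ClMulticatU.{v, u},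
        Nonempty ((underlyingTwoFunctor K).obj C ≅ V)) :=
  ⟨.of_bijective _ (underlyingTwoFunctor_map_bijective K)
    (underlyingTwoFunctor_map₂_bijective K) (underlyingTwoFunctor_exists_iso K),
    underlyingTwoFunctor_map_bijective K,
    fun _ _ => underlyingTwoFunctor_map₂_bijective K, underlyingTwoFunctor_exists_iso K⟩
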